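/- Notation and standing assumptions. All function spaces in $x$ are on $\mathbb R^3$: $L^2=L^2(\mathbb R^3,\mathbb C)$, $H^2=H^2(\mathbb R^3,\mathbb C)$, and $W^{2,\infty}=W^{2,\infty}(\mathbb R^3,\mathbb R)$. Let $T>0$, $\alpha>0$, $\delta,\eta\in(0,2)$, let $V,\mu\in W^{2,\infty}$, $H=-\Delta+V$, let $O$ be a bounded positive symmetric operator on $L^2$ that maps $H^2$ into $H^2$, and let $\psi_0\in H^2$ with $\|\psi_0\|_{L^2}=1$. Controls are real-valued functions on $(0,T)$. Write $\langle f|\mu|g\rangle=\int_{\mathbb R^3}\overline{f}\,\mu\, g\,dx$. For a control $e\in L^2(0,T)$, a solution of $$i\partial_t\psi-[H-\mu e(t)]\psi=0\quad\text{on }(0,T)\qquad (S_e)$$ means a function $\psi\in L^\infty(0,T;H^2)\cap W^{1,\infty}(0,T;L^2)$ (taken continuous from $[0,T]$ to $L^2$) that satisfies the equation in $L^2$ for almost every $t\in(0,T)$. Let $C_J$ be the set of critical points of the functional $J(e)=\langle\psi(T)|O|\psi(T)\rangle-\alpha\int_0^T e(t)^2\,dt$ ($\psi$ solving $(S_e)$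 with $\psi(0)=\psi_0$), defined by the critical point equations: $e\in L^2(0,T)$ belongs to $C_J$ if and only if there are solutions $\psi,\chi$ of $(S_e)$ with $\psi(0)=\psi_0$, $\chi(T)=O\psi(T)$ and $$\alpha e(t)+\operatorname{Im}\langle\chi(t)|\mu|\psi(t)\rangle=0\quad\text{for almost every }t\in(0,T).$$ Let $(\varepsilon^k)_{k\ge 0}$, $(\tilde\varepsilon^k)_{k\ge 0}$ in $L^2(0,T)$ and $(\psi^k)_{k\ge0}$, $(\chi^k)_{k\ge0}$ be sequences produced by the monotonic scheme with initial fields $\varepsilon^0,\tilde\varepsilon^0\in L^\infty(0,T)$, that is: - for all $k\ge0$, $\psi^k$ solves $(S_{\varepsilon^k})$ with $\psi^k(0)=\psi_0$; - for all $k\ge1$, $\chi^k$ solves $(S_{\tilde\varepsilon^k})$, while $\chi^0$ solves $(S_{\tilde\varepsilon^0})$ or $(S_{\varepsilon^0})$; and $\chi^k(T)=O\psi^k(T)$ for all $k\ge0$; - for all $k\ge1$ and almost every $t\in(0,T)$, $$\varepsilon^k(t)=(1-\delta)\tilde\varepsilon^{k-1}(t)-\frac{\delta}{\alpha}\operatorname{Im}\langle\chi^{k-1}(t)|\mu|\psi^k(t)\rangle,\qquad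 \tilde\varepsilon^k(t)=(1-\eta)\varepsilon^k(t)-\frac{\eta}{\alpha}\operatorname{Im}\langle\chi^k(t)|\mu|\psi^k(t)\rangle .$$ Lemma. Let $(\varepsilon^{k_n})_{n\ge0}$ be a subsequence of $(\varepsilon^k)_{k\ge0}$ that converges weakly in $L^2(0,T)$ to some $\varepsilon$. Then every $\varepsilon^{k_n}$ and $\varepsilon$ belong to $L^\infty(0,T)$, $\|\varepsilon^{k_n}-\varepsilon\|_{L^\infty(0,T)}\to0$ as $n\to\infty$, and $\varepsilon\in C_J$. -/

import Mathlib

open MeasureTheory Set Filter Topology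
open scoped ENNReal ContDiff SchwartzMap Laplacian

noncomputable section

namespace QControl

/-- The space `ℝ³`. -/
abbrev Space : Type := EuclideanSpace ℝ (Fin 3)

/-- `L²(ℝ³, ℂ)`. -/
abbrev L2 : Type := Lp ℂ 2 (volume : Measure Space)

/-- Lebesgue measure on `(0, T)`. -/
abbrev timeMeasure (T : ℝ) : Measure ℝ := volume.restrict (Ioo 0 T)

/-- The space `L²(0, T)` of real controls. -/
abbrev Control (T : ℝ) : Type := Lp ℝ 2 (timeMeasure T)

/-- `g` is the weak derivative of `f : ℝ³ → ℝ` in the direction `v`. -/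
def HasWeakDeriv (v : Space) (f g : Space → ℝ) : Prop :=
  ∀ φ : Space → ℝ, ContDiff ℝ ∞ φ → HasCompactSupport φ →
    ∫ x, f x * fderiv ℝ φ x v = - ∫ x, g x * φ x

/-- `f ∈ W^{2,∞}(ℝ³, ℝ)`: `f` and its weak partial derivatives of order one and two are
essentially bounded. -/
def MemW2Infty (f : Space → ℝ) : Prop :=
  MemLp f ∞ volume ∧
    ∀ i : Fin 3, ∃ g : Space → ℝ, MemLp g ∞ volume ∧
      HasWeakDeriv (EuclideanSpace.single i 1) f g ∧
      ∀ j : Fin 3, ∃ h : Space → ℝ, MemLp h ∞ volume ∧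
        HasWeakDeriv (EuclideanSpace.single j 1) g h

/-- `f ∈ H²(ℝ³, ℂ)`. -/
def MemH2 (f : L2) : Prop :=
  TemperedDistribution.MemSobolev 2 2 (f : 𝓢'(Space, ℂ))

/-- `f ∈ H²(ℝ³, ℂ)` with `‖f‖_{H²} ≤ C`, where `H²` carries the (equivalent) Hilbert norm
`‖(1 + |ξ|²) f̂(ξ)‖_{L²}`, `f̂` being the Fourier transform with kernel `exp(-2πi ξ·x)`. -/
def H2NormLE (f : L2) (C : ℝ) : Prop :=
  ∃ g : L2, TemperedDistribution.besselPotential Space ℂ 2 (f : 𝓢'(Space, ℂ)) =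
    (g : 𝓢'(Space, ℂ)) ∧ ‖g‖ ≤ C

/-- `h = (H - a μ) f` in `L²`, where `H = -Δ + V`, `a` is a real number, and `Δ f` is the
distributional Laplacian of `f`. -/
def IsHamiltonianApply (V μ : Space → ℝ) (a : ℝ) (f h : L2) : Prop :=
  ∃ lap : L2, Δ (f : 𝓢'(Space, ℂ)) = (lap : 𝓢'(Space, ℂ)) ∧
    ∀ᵐ x : Space, h x = -lap x + (V x : ℂ) * f x - (a : ℂ) * (μ x : ℂ) * f x

/-- `ψ ∈ L^∞(0,T;H²) ∩ W^{1,∞}(0,T;L²)` (represented by its continuous version on `[0, T]`) solves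
`i ∂ₜψ - [H - μ e(t)] ψ = 0` on `(0, T)`.  The function `dψ ∈ L^∞(0,T;L²)` is the
weak time derivative of `ψ`. -/
def IsSchrodingerSolution (T : ℝ) (V μ : Space → ℝ) (e : Control T) (ψ : ℝ → L2) : Prop :=
  (∃ C : ℝ, ∀ᵐ t ∂(timeMeasure T), H2NormLE (ψ t) C) ∧
  ∃ dψ : ℝ → L2, MemLp dψ ∞ (timeMeasure T) ∧
    (∀ t ∈ Icc 0 T, ψ t = ψ 0 + ∫ s in (0 : ℝ)..t, dψ s) ∧
    ∀ᵐ t ∂(timeMeasure T), IsHamiltonianApply V μ (e t) (ψ t) (Complex.I • dψ t)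

/-- `⟨f | μ | g⟩ = ∫ conj(f(x)) μ(x) g(x) dx`. -/
def bracket (f : L2) (μ : Space → ℝ) (g : L2) : ℂ :=
  ∫ x, (starRingEnd ℂ) (f x) * ((μ x : ℂ) * g x)

/-- The set `C_J` of the critical points of
`J(e) = ⟨ψ(T) | O | ψ(T)⟩ - α ∫₀ᵀ e(t)² dt`: the controls `e ∈ L²(0, T)` such that
`α e(t) + Im ⟨χ(t) | μ | ψ(t)⟩ = 0` on `(0, T)`, where `ψ` is the state of `e` (with
`ψ(0) = ψ₀`) and `χ` its adjoint state (with `χ(T) = O ψ(T)`). -/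
def criticalSet (T α : ℝ) (V μ : Space → ℝ) (O : L2 →L[ℂ] L2) (ψ₀ : L2) : Set (Control T) :=
  {e | ∃ ψ χ : ℝ → L2,
    IsSchrodingerSolution T V μ e ψ ∧ ψ 0 = ψ₀ ∧
    IsSchrodingerSolution T V μ e χ ∧ χ T = O (ψ T) ∧
    ∀ᵐ t ∂(timeMeasure T), α * e t + (bracket (χ t) μ (ψ t)).im = 0}

/-- The sequences `ε^k`, `ε̃^k`, `ψ^k`, `χ^k` of the monotonic scheme with parameters `δ`, `η`,
started from arbitrary `ε⁰, ε̃⁰ ∈ L^∞(0, T)`.  The state `ψ⁰` is driven by `ε⁰`; the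
initial adjoint state `χ⁰` may be driven by either of the two initial fields. -/
structure IsMonotonicScheme (T α δ η : ℝ) (V μ : Space → ℝ) (O : L2 →L[ℂ] L2) (ψ₀ : L2)
    (ε ε' : ℕ → Control T) (ψ χ : ℕ → ℝ → L2) : Prop where
  field_zero : MemLp (ε 0) ∞ (timeMeasure T)
  field'_zero : MemLp (ε' 0) ∞ (timeMeasure T)
  state : ∀ k, IsSchrodingerSolution T V μ (ε k) (ψ k)
  state_init : ∀ k, ψ k 0 = ψ₀
  adjoint_zero : IsSchrodingerSolution T V μ (ε 0) (χ 0) ∨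
    IsSchrodingerSolution T V μ (ε' 0) (χ 0)
  adjoint_succ : ∀ k, IsSchrodingerSolution T V μ (ε' (k + 1)) (χ (k + 1))
  adjoint_final : ∀ k, χ k T = O (ψ k T)
  field_succ : ∀ k, ∀ᵐ t ∂(timeMeasure T),
    ε (k + 1) t = (1 - δ) * ε' k t - δ / α * (bracket (χ k t) μ (ψ (k + 1) t)).im
  field'_succ : ∀ k, ∀ᵐ t ∂(timeMeasure T),
    ε' (k + 1) t = (1 - η) * ε (k + 1) t
      - η / α * (bracket (χ (k + 1) t) μ (ψ (k + 1) t)).im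

end QControl

end

/-! ### Multiplication operators and Fourier multipliers on `L²`. -/

namespace QControl

open FourierTransform TemperedDistribution

/-! The argument is a strengthened monotonicity estimate followed by a contraction in `L^∞`, with no
compactness theorem.

If `ψ` is driven by `e` and `χ` by `e'`, the self-adjoint part of the Hamiltonian cancels and
`⟨χ|ψ⟩' = i (e - e') ⟨χ|μ|ψ⟩`. Pairing `χ^k` with `ψ^k` and with `ψ^(k+1)`, and using positivity of
`O`, one finds for `k ≥ 1` that `J(ε^(k+1)) - J(ε^k)` is at least `α(2/δ - 1) ‖ε^(k+1) - ε̃^k‖² +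
α(2/η - 1) ‖ε̃^k - ε^k‖²` (`IsScheme.functional_increment`). Since `J ≤ ‖O‖` along the scheme, these
norms tend to zero, so consecutive fields approach each other in `L²`, hence in `L¹`. The same
pairing identity and conservation of the norm bound `‖ψ^i - ψ^j‖²` uniformly in time by the `L¹`
distance of the fields (`IsSolution.norm_sub_sq_le`), so consecutive states and adjoint states merge
as well.

Let `f_k = -Im⟨χ^k|μ|ψ^k⟩/α`. The update rules give `ε̃^k - f_k = (1-η)(ε^k - f_k)`, and `ε^(k+1) -
f_(k+1)` equals `(1-δ)(ε̃^k - f_k)` up to a uniformly vanishing error. As `|1-δ||1-η| < 1`, both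
fields approach `f_k` in `L^∞` along the whole sequence (`IsScheme.exists_feedback_bound`). The
states and adjoint states are bounded in `H²` uniformly in `k` (`IsSolution.exists_bound`), so the
equation makes the `f_k` equi-Lipschitz in time. For equi-Lipschitz functions, convergence of
integrals over intervals already forces uniform convergence (`uniformCauchySeqOn_of_lipschitz`);
weak convergence of `ε^(k_n)` supplies those integrals.

Once the fields converge uniformly, states and adjoint states converge uniformly in `L²`, their
limits solve the limit equations (`isSolution_of_tendsto`), and the limit of `f_(k_n)` gives the
critical point equation.

The dynamics are treated on an abstract Hilbert space: `SpectralFrame` encodes the Laplacian by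
bounded operators only, and `ControlledHamiltonian` adds potentials that preserve its domain. For
`W^{2,∞}` potentials this last property is the Leibniz rule (`MemW2Infty.exists_conj`). -/

/-- Multiplication by an essentially bounded real function, as a bounded operator on `L²`. -/
noncomputable def mulOp (m : Space → ℝ) (hm : MemLp m ∞ volume) : L2 →L[ℂ] L2 :=
  (ContinuousLinearMap.mul ℂ ℂ).holderL volume ∞ 2 2 (hm.ofReal (K := ℂ)).toLp

lemma mulOp_coeFn (m : Space → ℝ) (hm : MemLp m ∞ volume) (f : L2) :
    mulOp m hm f =ᵐ[volume] fun x => (m x : ℂ) * f x := by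
  have h := (ContinuousLinearMap.mul ℂ ℂ).coeFn_holder (r := 2)
    (hm.ofReal (K := ℂ)).toLp f
  filter_upwards [h, (hm.ofReal (K := ℂ)).coeFn_toLp] with x hx hx'
  change ((ContinuousLinearMap.mul ℂ ℂ).holder 2 (hm.ofReal (K := ℂ)).toLp f) x = _
  rw [hx, hx']
  rfl

lemma mulOp_comp (m m' m'' : Space → ℝ) (hm : MemLp m ∞ volume) (hm' : MemLp m' ∞ volume)
    (hm'' : MemLp m'' ∞ volume) (h : ∀ x, m x * m' x = m'' x) (f : L2) :
    mulOp m hm (mulOp m' hm' f) = mulOp m'' hm'' f := by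
  apply Lp.ext
  filter_upwards [mulOp_coeFn m hm (mulOp m' hm' f), mulOp_coeFn m' hm' f,
    mulOp_coeFn m'' hm'' f] with x h1 h2 h3
  rw [h1, h2, h3, ← h x]
  push_cast
  ring

lemma inner_mulOp (m : Space → ℝ) (hm : MemLp m ∞ volume) (f g : L2) :
    inner ℂ (mulOp m hm f) g = inner ℂ f (mulOp m hm g) := by
  rw [L2.inner_def, L2.inner_def]
  apply integral_congr_ae
  filter_upwards [mulOp_coeFn m hm f, mulOp_coeFn m hm g] with x h1 h2
  rw [h1, h2]
  simp only [RCLike.inner_apply, map_mul, Complex.conj_ofReal]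
  ring

lemma bracket_eq_inner (m : Space → ℝ) (hm : MemLp m ∞ volume) (f g : L2) :
    bracket f m g = inner ℂ f (mulOp m hm g) := by
  rw [L2.inner_def, bracket]
  apply integral_congr_ae
  filter_upwards [mulOp_coeFn m hm g] with x h1
  rw [h1, RCLike.inner_apply]
  ring

lemma mulOp_eq_smul (m : Space → ℝ) (hm : MemLp m ∞ volume) (f : L2) :
    mulOp m hm f = ((hm.ofReal (K := ℂ)).toLp _ • f : L2) := by
  apply Lp.ext
  filter_upwards [mulOp_coeFn m hm f, Lp.coeFn_lpSMul (r := 2) ((hm.ofReal (K := ℂ)).toLp _) f,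
    (hm.ofReal (K := ℂ)).coeFn_toLp] with x h1 h2 h3
  rw [h1, h2, Pi.smul_apply', h3]
  rfl

lemma toTemperedDistribution_mulOp (m : Space → ℝ) (hm : MemLp m ∞ volume)
    (hg : (fun x => (m x : ℂ)).HasTemperateGrowth) (f : L2) :
    ((mulOp m hm f : L2) : 𝓢'(Space, ℂ)) = smulLeftCLM ℂ (fun x => (m x : ℂ)) f := by
  rw [mulOp_eq_smul]
  exact MeasureTheory.Lp.toTemperedDistribution_smul_eq hg (hm.ofReal (K := ℂ)) f

lemma toTemperedDistribution_injective :
    Function.Injective (fun f : L2 => (f : 𝓢'(Space, ℂ))) := by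
  have h := Lp.ker_toTemperedDistributionCLM_eq_bot (E := Space) (F := ℂ) (μ := volume) (p := 2)
  exact LinearMap.ker_eq_bot.1 h

/-- Dominated convergence, with `|f|²` dominating the squared error. Conjugated by the Fourier
transform, this says that the spectral projections increase to the identity. -/
lemma tendsto_mulOp_indicator (f : L2)
    (h : ∀ n : ℕ, MemLp ((Metric.closedBall (0 : Space) n).indicator (fun _ => (1 : ℝ))) ∞ volume) :
    Tendsto (fun n : ℕ => mulOp _ (h n) f) atTop (𝓝 f) := by
  rw [tendsto_iff_norm_sub_tendsto_zero]
  have hsq : ∀ n : ℕ, ‖mulOp _ (h n) f - f‖ ^ 2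
      = ∫ x, ‖(mulOp _ (h n) f - f) x‖ ^ 2 := by
    intro n
    rw [← inner_self_eq_norm_sq (𝕜 := ℂ), L2.inner_def, ← integral_re]
    · simp [inner_self_eq_norm_sq_to_K, ← Complex.ofReal_pow]
    · exact L2.integrable_inner _ _
  have hlim : Tendsto (fun n : ℕ => ∫ x, ‖(mulOp _ (h n) f - f) x‖ ^ 2) atTop
      (𝓝 (∫ _ : Space, (0 : ℝ))) := by
    refine tendsto_integral_of_dominated_convergence (fun x => ‖f x‖ ^ 2) ?_ ?_ ?_ ?_
    · intro n
      exact (Lp.aestronglyMeasurable _).norm.pow 2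
    · exact (memLp_two_iff_integrable_sq_norm (Lp.aestronglyMeasurable f)).1 (Lp.memLp f)
    · intro n
      filter_upwards [Lp.coeFn_sub (mulOp _ (h n) f) f, mulOp_coeFn _ (h n) f] with x h1 h2
      rw [h1, Pi.sub_apply, h2]
      by_cases hx : x ∈ Metric.closedBall (0 : Space) n
      · simp [indicator_of_mem hx]
      · simp [indicator_of_notMem hx]
    · have h1 := fun n : ℕ => Lp.coeFn_sub (mulOp _ (h n) f) f
      have h2 := fun n : ℕ => mulOp_coeFn _ (h n) f
      filter_upwards [ae_all_iff.2 h1, ae_all_iff.2 h2] with x h1 h2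
      refine tendsto_const_nhds.congr' ?_
      obtain ⟨N, hN⟩ := exists_nat_ge ‖x‖
      filter_upwards [eventually_ge_atTop N] with n hn
      have hx : x ∈ Metric.closedBall (0 : Space) n := by
        rw [mem_closedBall_zero_iff]
        exact hN.trans (by exact_mod_cast hn)
      rw [h1, Pi.sub_apply, h2]
      simp [indicator_of_mem hx]
  rw [integral_zero] at hlim
  have h3 := (hlim.congr (fun n => (hsq n).symm)).sqrt
  simpa [Real.sqrt_sq (norm_nonneg _)] using h3

/-- The Fourier multiplier with an essentially bounded real symbol, as a bounded operator on
`L²`. -/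
noncomputable def multOp (m : Space → ℝ) (hm : MemLp m ∞ volume) : L2 →L[ℂ] L2 :=
  ((Lp.fourierTransformₗᵢ Space ℂ).symm.toContinuousLinearEquiv : L2 →L[ℂ] L2) ∘L
    mulOp m hm ∘L ((Lp.fourierTransformₗᵢ Space ℂ).toContinuousLinearEquiv : L2 →L[ℂ] L2)

lemma multOp_apply (m : Space → ℝ) (hm : MemLp m ∞ volume) (f : L2) :
    multOp m hm f = 𝓕⁻ (mulOp m hm (𝓕 f)) := rfl

lemma multOp_comp (m m' m'' : Space → ℝ) (hm : MemLp m ∞ volume) (hm' : MemLp m' ∞ volume)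
    (hm'' : MemLp m'' ∞ volume) (h : ∀ x, m x * m' x = m'' x) (f : L2) :
    multOp m hm (multOp m' hm' f) = multOp m'' hm'' f := by
  simp only [multOp_apply, fourier_fourierInv_eq]
  rw [mulOp_comp m m' m'' hm hm' hm'' h]

lemma inner_multOp (m : Space → ℝ) (hm : MemLp m ∞ volume) (f g : L2) :
    inner ℂ (multOp m hm f) g = inner ℂ f (multOp m hm g) := by
  rw [← Lp.inner_fourier_eq (multOp m hm f) g, ← Lp.inner_fourier_eq f]
  simp only [multOp_apply, fourier_fourierInv_eq]
  exact inner_mulOp m hm _ _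

/-- `multOp` is built on the `L²` side so that discontinuous symbols, such as sharp frequency
cutoffs, are allowed; the distributional multiplier requires temperate growth, so the comparison is
restricted to such symbols. -/
lemma toTemperedDistribution_multOp (m : Space → ℝ) (hm : MemLp m ∞ volume)
    (hg : (fun x => (m x : ℂ)).HasTemperateGrowth) (f : L2) :
    ((multOp m hm f : L2) : 𝓢'(Space, ℂ)) = fourierMultiplierCLM ℂ (fun x => (m x : ℂ)) f := by
  rw [multOp_apply, ← Lp.fourierInv_toTemperedDistribution_eq, toTemperedDistribution_mulOp m hm hg,
    ← Lp.fourier_toTemperedDistribution_eq, fourierMultiplierCLM_apply]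

lemma memLp_top_of_bounded {m : Space → ℝ} (hm : Measurable m) (C : ℝ) (hC : ∀ x, |m x| ≤ C) :
    MemLp m ∞ volume :=
  memLp_top_of_bound hm.aestronglyMeasurable C (Eventually.of_forall hC)

end QControl

/-! ### Weak derivatives tested against Schwartz functions. -/

namespace QControl

open FourierTransform TemperedDistribution LineDeriv

lemma exists_ae_abs_le {α : Type*} [MeasurableSpace α] {ν : Measure α} {f : α → ℝ}
    (hf : MemLp f ∞ ν) : ∃ C, 0 ≤ C ∧ ∀ᵐ x ∂ν, |f x| ≤ C := by
  refine ⟨(eLpNorm f ∞ ν).toReal, ENNReal.toReal_nonneg, ?_⟩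
  have h := ae_le_eLpNormEssSup (f := f) (μ := ν)
  rw [← eLpNorm_exponent_top] at h
  filter_upwards [h] with x hx
  have := ENNReal.toReal_mono hf.2.ne hx
  simpa using this

/-- The weak derivative can be tested against smooth integrable functions with integrable
derivative. -/
lemma HasWeakDeriv.integral_of_integrable {v : Space} {f g : Space → ℝ} (h : HasWeakDeriv v f g)
    (hf : MemLp f ∞ volume) (hg : MemLp g ∞ volume) {u : Space → ℝ} (hu : ContDiff ℝ ∞ u)
    (hui : Integrable u) (hui' : Integrable fun x => fderiv ℝ u x v) :
    ∫ x, f x * fderiv ℝ u x v = - ∫ x, g x * u x := by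
  obtain ⟨Cf, hCf0, hCf⟩ := exists_ae_abs_le hf
  obtain ⟨Cg, hCg0, hCg⟩ := exists_ae_abs_le hg
  let ρ : ContDiffBump (0 : Space) := ⟨1, 2, one_pos, by norm_num⟩
  have hρ : ContDiff ℝ ∞ (ρ : Space → ℝ) := ρ.contDiff
  have hρd : Continuous fun x => fderiv ℝ (ρ : Space → ℝ) x v := by
    have := hρ.continuous_fderiv (by simp)
    fun_prop
  have hρdc : HasCompactSupport fun x => fderiv ℝ (ρ : Space → ℝ) x v :=
    ρ.hasCompactSupport.fderiv_apply ℝ v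
  obtain ⟨Cρ, hCρ⟩ := hρdc.exists_bound_of_continuous hρd
  have hCρ0 : 0 ≤ Cρ := (norm_nonneg _).trans (hCρ 0)
  -- The cutoffs `ρ (c n • x)` are eventually one at each point, and their derivatives carry the
  -- factor `c n`, which removes the extra term of the product rule in the limit.
  let c : ℕ → ℝ := fun n => ((n : ℝ) + 1)⁻¹
  have hcpos : ∀ n, 0 < c n := fun n => by positivity
  have hc0 : Tendsto c atTop (𝓝 0) := tendsto_inv_atTop_zero.comp
    (tendsto_atTop_add_const_right _ _ tendsto_natCast_atTop_atTop)
  have hcle : ∀ n, c n ≤ 1 := fun n => inv_le_one_of_one_le₀ (by simp)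
  let r : ℕ → Space → ℝ := fun n x => ρ (c n • x)
  have hr : ∀ n, ContDiff ℝ ∞ (r n) := fun n => hρ.comp (contDiff_const_smul _)
  have hr1 : ∀ n x, |r n x| ≤ 1 := fun n x => by
    rw [abs_of_nonneg ρ.nonneg]
    exact ρ.le_one
  have hrlim : ∀ x, ∀ᶠ n in atTop, r n x = 1 := by
    intro x
    have : Tendsto (fun n => ‖c n • x‖) atTop (𝓝 0) := by
      simpa using (hc0.smul_const x).norm
    filter_upwards [this.eventually_lt_const one_pos] with n hn
    exact ρ.one_of_mem_closedBall (by rw [mem_closedBall_zero_iff]; exact hn.le)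
  have hrd : ∀ n x, fderiv ℝ (r n) x v = c n * fderiv ℝ (ρ : Space → ℝ) (c n • x) v := by
    intro n x
    have h1 : HasFDerivAt (r n)
        ((fderiv ℝ (ρ : Space → ℝ) (c n • x)).comp (c n • ContinuousLinearMap.id ℝ Space)) x :=
      ((hρ.differentiable (by simp)) (c n • x)).hasFDerivAt.comp x
        ((ContinuousLinearMap.id ℝ Space).hasFDerivAt.const_smul (c n))
    rw [h1.fderiv]
    simp
  have key : ∀ n, ∫ x, f x * (r n x * fderiv ℝ u x v
      + u x * (c n * fderiv ℝ (ρ : Space → ℝ) (c n • x) v)) = - ∫ x, g x * (r n x * u x) := by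
    intro n
    have hcs : HasCompactSupport (r n) :=
      ρ.hasCompactSupport.comp_smul (hcpos n).ne'
    rw [← h (fun x => r n x * u x) ((hr n).mul hu) hcs.mul_right]
    congr 1
    ext x
    rw [fderiv_fun_mul ((hr n).differentiable (by simp) x) (hu.differentiable (by simp) x)]
    simp [hrd]
  have hL : Tendsto (fun n => ∫ x, f x * (r n x * fderiv ℝ u x v
      + u x * (c n * fderiv ℝ (ρ : Space → ℝ) (c n • x) v))) atTop
      (𝓝 (∫ x, f x * fderiv ℝ u x v)) := by
    refine tendsto_integral_of_dominated_convergence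
      (fun x => Cf * (|fderiv ℝ u x v| + |u x| * Cρ)) ?_ ?_ ?_ ?_
    · intro n
      refine hf.1.mul ((((hr n).continuous.aestronglyMeasurable).mul hui'.1).add (hui.1.mul ?_))
      have := hρd.comp (continuous_const_smul (c n) : Continuous fun x : Space => c n • x)
      exact (continuous_const.mul this).aestronglyMeasurable
    · exact ((hui'.abs).add (hui.abs.mul_const _)).const_mul _
    · intro n
      filter_upwards [hCf] with x hx
      rw [Real.norm_eq_abs, abs_mul]
      refine mul_le_mul hx ?_ (abs_nonneg _) hCf0
      refine (abs_add_le _ _).trans (add_le_add ?_ ?_)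
      · rw [abs_mul]
        exact mul_le_of_le_one_left (abs_nonneg _) (hr1 n x)
      · rw [abs_mul, abs_mul, abs_of_pos (hcpos n)]
        refine mul_le_mul_of_nonneg_left ?_ (abs_nonneg _)
        have := hCρ (c n • x)
        rw [Real.norm_eq_abs] at this
        calc c n * |fderiv ℝ (ρ : Space → ℝ) (c n • x) v| ≤ 1 * Cρ :=
              mul_le_mul (hcle n) this (abs_nonneg _) zero_le_one
          _ = Cρ := one_mul _
    · refine Eventually.of_forall fun x => ?_
      refine Tendsto.const_mul _ ?_
      have h1 : Tendsto (fun n => r n x * fderiv ℝ u x v) atTop (𝓝 (fderiv ℝ u x v)) := by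
        refine tendsto_const_nhds.congr' ?_
        filter_upwards [hrlim x] with n hn
        rw [hn, one_mul]
      have h2 : Tendsto (fun n => u x * (c n * fderiv ℝ (ρ : Space → ℝ) (c n • x) v)) atTop
          (𝓝 0) := by
        refine squeeze_zero_norm (a := fun n => |u x| * (c n * Cρ)) (fun n => ?_) ?_
        · rw [norm_mul, norm_mul, Real.norm_eq_abs, Real.norm_eq_abs, abs_of_pos (hcpos n)]
          gcongr
          exact hCρ _
        · simpa using (hc0.mul_const Cρ).const_mul |u x|
      simpa using h1.add h2
  have hR : Tendsto (fun n => - ∫ x, g x * (r n x * u x)) atTop (𝓝 (- ∫ x, g x * u x)) := by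
    refine (tendsto_integral_of_dominated_convergence (fun x => Cg * |u x|) ?_ ?_ ?_ ?_).neg
    · intro n
      exact hg.1.mul (((hr n).continuous.aestronglyMeasurable).mul hui.1)
    · exact hui.abs.const_mul _
    · intro n
      filter_upwards [hCg] with x hx
      rw [Real.norm_eq_abs, abs_mul, abs_mul]
      exact mul_le_mul hx (mul_le_of_le_one_left (abs_nonneg _) (hr1 n x)) (by positivity) hCg0
    · refine Eventually.of_forall fun x => ?_
      refine tendsto_const_nhds.congr' ?_
      filter_upwards [hrlim x] with n hn
      rw [hn, one_mul]
  exact tendsto_nhds_unique (hL.congr key) hR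

/-- The integral of a Schwartz function against a real function. -/
noncomputable def schwartzIntegral (f : Space → ℝ) (p : 𝓢(Space, ℂ)) : ℂ :=
  ∫ x, (f x : ℂ) * p x

lemma integrable_mul_schwartz {f : Space → ℝ} (hf : MemLp f ∞ volume) (p : 𝓢(Space, ℂ)) :
    Integrable fun x => (f x : ℂ) * p x := by
  obtain ⟨C, -, hC⟩ := exists_ae_abs_le hf
  refine (p.integrable (μ := volume)).bdd_mul (c := C) (hf.ofReal (K := ℂ)).1 ?_
  filter_upwards [hC] with x hx
  simpa using hx

lemma schwartzIntegral_add {f : Space → ℝ} (hf : MemLp f ∞ volume) (p q : 𝓢(Space, ℂ)) :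
    schwartzIntegral f (p + q) = schwartzIntegral f p + schwartzIntegral f q := by
  simp only [schwartzIntegral]
  rw [← integral_add (integrable_mul_schwartz hf p) (integrable_mul_schwartz hf q)]
  congr 1
  ext x
  simp [mul_add]

lemma HasWeakDeriv.schwartzIntegral_lineDeriv {v : Space} {f g : Space → ℝ}
    (h : HasWeakDeriv v f g) (hf : MemLp f ∞ volume) (hg : MemLp g ∞ volume) (p : 𝓢(Space, ℂ)) :
    schwartzIntegral f (∂_{v} p) = - schwartzIntegral g p := by
  have hp : Integrable (fun x => p x) := p.integrable
  have hp' : Integrable (fun x => fderiv ℝ p x v) :=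
    ((∂_{v} p : 𝓢(Space, ℂ)).integrable (μ := volume))
  have hre : ∀ x, fderiv ℝ (fun y => (p y).re) x v = (fderiv ℝ p x v).re := by
    intro x
    have := (Complex.reCLM.hasFDerivAt (x := p x)).comp x p.differentiableAt.hasFDerivAt
    have h2 : fderiv ℝ (fun y => (p y).re) x = Complex.reCLM.comp (fderiv ℝ p x) := this.fderiv
    rw [h2]
    rfl
  have him : ∀ x, fderiv ℝ (fun y => (p y).im) x v = (fderiv ℝ p x v).im := by
    intro x
    have := (Complex.imCLM.hasFDerivAt (x := p x)).comp x p.differentiableAt.hasFDerivAt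
    have h2 : fderiv ℝ (fun y => (p y).im) x = Complex.imCLM.comp (fderiv ℝ p x) := this.fderiv
    rw [h2]
    rfl
  have e1 := h.integral_of_integrable hf hg (u := fun y => (p y).re)
    (Complex.reCLM.contDiff.comp p.smooth') hp.re (by simp_rw [hre]; exact hp'.re)
  have e2 := h.integral_of_integrable hf hg (u := fun y => (p y).im)
    (Complex.imCLM.contDiff.comp p.smooth') hp.im (by simp_rw [him]; exact hp'.im)
  simp_rw [hre] at e1
  simp_rw [him] at e2
  have i1 := integrable_mul_schwartz hf (∂_{v} p)
  have i2 := integrable_mul_schwartz hg p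
  simp only [schwartzIntegral]
  apply Complex.ext
  · rw [Complex.neg_re]
    have a1 := integral_re i1
    have a2 := integral_re i2
    simp only [RCLike.re_eq_complex_re, Complex.re_ofReal_mul] at a1 a2
    rw [← a1, ← a2]
    exact e1
  · rw [Complex.neg_im]
    have a1 := integral_im i1
    have a2 := integral_im i2
    simp only [RCLike.im_eq_complex_im, Complex.im_ofReal_mul] at a1 a2
    rw [← a1, ← a2]
    exact e2

/-- The pointwise product of two Schwartz functions. -/
noncomputable def schwartzMul (p q : 𝓢(Space, ℂ)) : 𝓢(Space, ℂ) :=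
  SchwartzMap.pairing (ContinuousLinearMap.mul ℂ ℂ) p q

lemma schwartzMul_apply (p q : 𝓢(Space, ℂ)) (x : Space) : schwartzMul p q x = p x * q x := rfl

lemma lineDeriv_schwartzMul (v : Space) (p q : 𝓢(Space, ℂ)) :
    (∂_{v} (schwartzMul p q) : 𝓢(Space, ℂ))
      = schwartzMul (∂_{v} p) q + schwartzMul p (∂_{v} q) := by
  ext x
  rw [SchwartzMap.lineDerivOp_apply_eq_fderiv, add_apply, schwartzMul_apply,
    schwartzMul_apply, SchwartzMap.lineDerivOp_apply_eq_fderiv,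
    SchwartzMap.lineDerivOp_apply_eq_fderiv]
  change fderiv ℝ (fun y => p y * q y) x v = _
  rw [fderiv_fun_mul p.differentiableAt q.differentiableAt]
  simp only [add_apply, smul_apply, smul_eq_mul]
  ring

/-- The weak form of `∂²(f p) = (∂²f) p + 2 (∂f)(∂p) + f ∂²p`, obtained from three integrations by
parts: against `p ∂q`, `p q` and `(∂p) q`. -/
lemma schwartzIntegral_second_deriv {v : Space} {f g h : Space → ℝ}
    (hfg : HasWeakDeriv v f g) (hgh : HasWeakDeriv v g h) (hf : MemLp f ∞ volume)
    (hg : MemLp g ∞ volume) (hh : MemLp h ∞ volume) (p q : 𝓢(Space, ℂ)) :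
    schwartzIntegral f (schwartzMul p (∂_{v} (∂_{v} q)))
      = schwartzIntegral h (schwartzMul p q) + 2 * schwartzIntegral g (schwartzMul (∂_{v} p) q)
        + schwartzIntegral f (schwartzMul (∂_{v} (∂_{v} p)) q) := by
  have e1 := hfg.schwartzIntegral_lineDeriv hf hg (schwartzMul p (∂_{v} q))
  have e2 := hgh.schwartzIntegral_lineDeriv hg hh (schwartzMul p q)
  have e3 := hfg.schwartzIntegral_lineDeriv hf hg (schwartzMul (∂_{v} p) q)
  rw [lineDeriv_schwartzMul, schwartzIntegral_add hf] at e1 e3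
  rw [lineDeriv_schwartzMul, schwartzIntegral_add hg] at e2
  linear_combination e1 - e2 - e3

lemma toTemperedDistribution_mulOp_toLp (m : Space → ℝ) (hm : MemLp m ∞ volume)
    (p q : 𝓢(Space, ℂ)) :
    ((mulOp m hm (p.toLp 2) : L2) : 𝓢'(Space, ℂ)) q = schwartzIntegral m (schwartzMul p q) := by
  rw [Lp.toTemperedDistribution_apply, schwartzIntegral]
  apply integral_congr_ae
  filter_upwards [mulOp_coeFn m hm (p.toLp 2), p.coeFn_toLp 2 volume] with x h1 h2
  rw [h1, h2, schwartzMul_apply, smul_eq_mul]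
  ring

end QControl

/-! ### The Laplacian encoded by bounded operators. -/

namespace QControl

/-- A nonpositive operator `Δ` on a Hilbert space, given through bounded operators: an injective
operator `R` whose range is the domain of `Δ`, `S = Δ R`, spectral projections `P n` of `Δ`
increasing to the identity, `L n = R⁻¹ P n` and `A n = Δ P n`. -/
structure SpectralFrame (X : Type*) [NormedAddCommGroup X] [InnerProductSpace ℂ X] where
  R : X →L[ℂ] X
  S : X →L[ℂ] X
  P : ℕ → X →L[ℂ] X
  L : ℕ → X →L[ℂ] X
  A : ℕ → X →L[ℂ] X
  inner_R : ∀ x y, inner ℂ (R x) y = inner ℂ x (R y)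
  inner_S : ∀ x y, inner ℂ (S x) y = inner ℂ x (S y)
  inner_P : ∀ n x y, inner ℂ (P n x) y = inner ℂ x (P n y)
  inner_A : ∀ n x y, inner ℂ (A n x) y = inner ℂ x (A n y)
  R_S : ∀ x, R (S x) = S (R x)
  L_R : ∀ n x, L n (R x) = P n x
  R_L : ∀ n x, R (L n x) = P n x
  P_L : ∀ n m x, n ≤ m → P n (L m x) = L n x
  P_P : ∀ n x, P n (P n x) = P n x
  L_S : ∀ n x, L n (S x) = A n (P n x)
  A_R : ∀ n x, A n (R x) = P n (S x)
  tendsto_P : ∀ x, Tendsto (fun n => P n x) atTop (𝓝 x)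

open FourierTransform TemperedDistribution LineDeriv

/-- The symbol `(1 + |ξ|²)⁻¹`. -/
noncomputable def resolventSymbol (ξ : Space) : ℝ := (1 + ‖ξ‖ ^ 2) ^ (-1 : ℝ)

/-- The symbol of the Laplacian. -/
noncomputable def laplaceSymbol (ξ : Space) : ℝ := -(2 * Real.pi) ^ 2 * ‖ξ‖ ^ 2

/-- The indicator function of the ball of radius `n`. -/
noncomputable def cutoff (n : ℕ) : Space → ℝ :=
  (Metric.closedBall (0 : Space) n).indicator fun _ => 1

lemma resolventSymbol_eq (ξ : Space) : resolventSymbol ξ = (1 + ‖ξ‖ ^ 2)⁻¹ :=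
  Real.rpow_neg_one _

lemma resolventSymbol_mul (ξ : Space) : resolventSymbol ξ * (1 + ‖ξ‖ ^ 2) = 1 := by
  rw [resolventSymbol_eq]
  exact inv_mul_cancel₀ (by positivity)

lemma cutoff_sq (n : ℕ) (ξ : Space) : cutoff n ξ * cutoff n ξ = cutoff n ξ := by
  by_cases h : ξ ∈ Metric.closedBall (0 : Space) n <;> simp [cutoff, h]

lemma cutoff_mul_of_le {n m : ℕ} (h : n ≤ m) (ξ : Space) :
    cutoff n ξ * cutoff m ξ = cutoff n ξ := by
  by_cases h1 : ξ ∈ Metric.closedBall (0 : Space) n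
  · have h2 : ξ ∈ Metric.closedBall (0 : Space) m :=
      Metric.closedBall_subset_closedBall (by exact_mod_cast h) h1
    simp [cutoff, indicator_of_mem h1, indicator_of_mem h2]
  · simp [cutoff, indicator_of_notMem h1]

lemma measurable_cutoff (n : ℕ) : Measurable (cutoff n) :=
  measurable_const.indicator measurableSet_closedBall

lemma measurable_resolventSymbol : Measurable resolventSymbol := by
  unfold resolventSymbol
  fun_prop

lemma measurable_laplaceSymbol : Measurable laplaceSymbol := by
  unfold laplaceSymbol
  fun_prop

lemma abs_cutoff_mul_le {n : ℕ} {φ : ℝ → ℝ} (hφ : MonotoneOn φ (Ici 0)) (h0 : 0 ≤ φ 0)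
    (ξ : Space) : |cutoff n ξ * φ ‖ξ‖| ≤ φ n := by
  by_cases h : ξ ∈ Metric.closedBall (0 : Space) n
  · rw [cutoff, indicator_of_mem h, one_mul,
      abs_of_nonneg (h0.trans (hφ self_mem_Ici (norm_nonneg ξ) (norm_nonneg ξ)))]
    exact hφ (norm_nonneg ξ) (Nat.cast_nonneg (α := ℝ) n) (mem_closedBall_zero_iff.1 h)
  · rw [cutoff, indicator_of_notMem h, zero_mul, abs_zero]
    exact h0.trans (hφ self_mem_Ici (Nat.cast_nonneg (α := ℝ) n) (Nat.cast_nonneg (α := ℝ) n))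

lemma memLp_resolventSymbol : MemLp resolventSymbol ∞ volume := by
  refine memLp_top_of_bounded measurable_resolventSymbol 1 fun ξ => ?_
  rw [resolventSymbol_eq, abs_of_nonneg (by positivity)]
  exact inv_le_one_of_one_le₀ (by nlinarith [sq_nonneg ‖ξ‖])

lemma memLp_laplace_resolvent :
    MemLp (fun ξ => laplaceSymbol ξ * resolventSymbol ξ) ∞ volume := by
  refine memLp_top_of_bounded (measurable_laplaceSymbol.mul measurable_resolventSymbol)
    ((2 * Real.pi) ^ 2) fun ξ => ?_
  rw [resolventSymbol_eq, laplaceSymbol, abs_mul, abs_mul, abs_neg,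
    abs_of_nonneg (sq_nonneg (2 * Real.pi)), abs_of_nonneg (sq_nonneg ‖ξ‖),
    abs_of_nonneg (a := (1 + ‖ξ‖ ^ 2)⁻¹) (by positivity), mul_assoc]
  refine mul_le_of_le_one_right (by positivity) ?_
  rw [← div_eq_mul_inv, div_le_one (by positivity)]
  linarith

lemma memLp_cutoff (n : ℕ) : MemLp (cutoff n) ∞ volume := by
  refine memLp_top_of_bounded (measurable_cutoff n) 1 fun ξ => ?_
  simpa using abs_cutoff_mul_le (n := n) (φ := fun _ => 1) monotoneOn_const zero_le_one ξ

lemma memLp_cutoff_bessel (n : ℕ) :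
    MemLp (fun ξ => cutoff n ξ * (1 + ‖ξ‖ ^ 2)) ∞ volume := by
  refine memLp_top_of_bounded ((measurable_cutoff n).mul (by fun_prop)) (1 + (n : ℝ) ^ 2)
    fun ξ => ?_
  refine abs_cutoff_mul_le (φ := fun r => 1 + r ^ 2) (fun a ha b hb hab => ?_) (by simp) ξ
  have := pow_le_pow_left₀ ha hab 2
  simpa using this

lemma memLp_cutoff_laplace (n : ℕ) :
    MemLp (fun ξ => cutoff n ξ * laplaceSymbol ξ) ∞ volume := by
  refine memLp_top_of_bounded ((measurable_cutoff n).mul measurable_laplaceSymbol)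
    ((2 * Real.pi) ^ 2 * (n : ℝ) ^ 2) fun ξ => ?_
  rw [laplaceSymbol, neg_mul, mul_neg, abs_neg]
  refine abs_cutoff_mul_le (φ := fun r => (2 * Real.pi) ^ 2 * r ^ 2) (fun a ha b hb hab => ?_)
    (by simp) ξ
  exact mul_le_mul_of_nonneg_left (pow_le_pow_left₀ ha hab 2) (sq_nonneg (2 * Real.pi))

/-- The spectral frame of the Laplacian on `L²(ℝ³)`. -/
noncomputable def laplaceFrame : SpectralFrame L2 where
  R := multOp _ memLp_resolventSymbol
  S := multOp _ memLp_laplace_resolvent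
  P n := multOp _ (memLp_cutoff n)
  L n := multOp _ (memLp_cutoff_bessel n)
  A n := multOp _ (memLp_cutoff_laplace n)
  inner_R := inner_multOp _ _
  inner_S := inner_multOp _ _
  inner_P _ := inner_multOp _ _
  inner_A _ := inner_multOp _ _
  R_S x := by
    have h : MemLp (fun ξ => resolventSymbol ξ * (laplaceSymbol ξ * resolventSymbol ξ)) ∞
        (volume : Measure Space) := memLp_laplace_resolvent.mul memLp_resolventSymbol
    rw [multOp_comp _ _ _ _ _ h (fun ξ => rfl), multOp_comp _ _ _ _ _ h (fun ξ => by ring)]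
  L_R n x := multOp_comp _ _ _ _ _ _ (fun ξ => by
    linear_combination cutoff n ξ * resolventSymbol_mul ξ) x
  R_L n x := multOp_comp _ _ _ _ _ _ (fun ξ => by
    linear_combination cutoff n ξ * resolventSymbol_mul ξ) x
  P_L n m x h := multOp_comp _ _ _ _ _ _ (fun ξ => by
    linear_combination (1 + ‖ξ‖ ^ 2) * cutoff_mul_of_le h ξ) x
  P_P n x := multOp_comp _ _ _ _ _ _ (cutoff_sq n) x
  L_S n x := by
    rw [multOp_comp _ _ _ _ _ (memLp_cutoff_laplace n) (fun ξ => by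
        linear_combination cutoff n ξ * laplaceSymbol ξ * resolventSymbol_mul ξ),
      multOp_comp _ _ _ _ _ (memLp_cutoff_laplace n) (fun ξ => by
        linear_combination laplaceSymbol ξ * cutoff_sq n ξ)]
  A_R n x := by
    have h : MemLp (fun ξ => cutoff n ξ * (laplaceSymbol ξ * resolventSymbol ξ)) ∞
        (volume : Measure Space) := memLp_laplace_resolvent.mul (memLp_cutoff n)
    rw [multOp_comp _ _ _ _ _ h (fun ξ => by ring), multOp_comp _ _ _ _ _ h (fun ξ => rfl)]
  tendsto_P x := by
    have h := (tendsto_mulOp_indicator (𝓕 x) memLp_cutoff)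
    have h2 := ((Lp.fourierTransformₗᵢ Space ℂ).symm.continuous.tendsto (𝓕 x)).comp h
    have h3 : (Lp.fourierTransformₗᵢ Space ℂ).symm (𝓕 x) = x :=
      (Lp.fourierTransformₗᵢ Space ℂ).symm_apply_apply x
    rw [h3] at h2
    exact h2

lemma hasTemperateGrowth_resolventSymbol :
    (fun ξ => (resolventSymbol ξ : ℂ)).HasTemperateGrowth := by
  unfold resolventSymbol
  fun_prop

lemma hasTemperateGrowth_laplaceSymbol :
    (fun ξ => (laplaceSymbol ξ : ℂ)).HasTemperateGrowth := by
  unfold laplaceSymbol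
  fun_prop

lemma toTemperedDistribution_R (g : L2) :
    ((laplaceFrame.R g : L2) : 𝓢'(Space, ℂ)) = besselPotential Space ℂ (-2) g := by
  refine (toTemperedDistribution_multOp _ _ hasTemperateGrowth_resolventSymbol g).trans ?_
  simp [besselPotential, resolventSymbol]

lemma besselPotential_eq_iff (f g : L2) :
    besselPotential Space ℂ 2 (f : 𝓢'(Space, ℂ)) = (g : 𝓢'(Space, ℂ)) ↔ f = laplaceFrame.R g := by
  rw [← besselPotential_neg_apply_eq_iff, ← toTemperedDistribution_R,
    toTemperedDistribution_injective.eq_iff, eq_comm]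

lemma H2NormLE_iff (f : L2) (C : ℝ) : H2NormLE f C ↔ ∃ g, f = laplaceFrame.R g ∧ ‖g‖ ≤ C := by
  simp only [H2NormLE, besselPotential_eq_iff]

lemma MemH2_iff (f : L2) : MemH2 f ↔ ∃ g, f = laplaceFrame.R g := by
  simp only [MemH2, TemperedDistribution.MemSobolev, besselPotential_eq_iff]

lemma laplacian_eq_fourierMultiplier (f : 𝓢'(Space, ℂ)) :
    Δ f = fourierMultiplierCLM ℂ (fun ξ => (laplaceSymbol ξ : ℂ)) f := by
  have h : (fun ξ : Space => (laplaceSymbol ξ : ℂ))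
      = (-(2 * Real.pi) ^ 2 : ℂ) • fun ξ : Space => ((‖ξ‖ ^ 2 : ℝ) : ℂ) := by
    ext ξ
    simp [laplaceSymbol]
  rw [laplacian_eq_fourierMultiplierCLM, h, fourierMultiplierCLM_smul (by fun_prop),
    smul_apply]
  rw [← Complex.coe_smul]
  simp

lemma laplacian_R (g : L2) :
    Δ ((laplaceFrame.R g : L2) : 𝓢'(Space, ℂ)) = ((laplaceFrame.S g : L2) : 𝓢'(Space, ℂ)) := by
  have h1 : ((laplaceFrame.R g : L2) : 𝓢'(Space, ℂ)) = _ :=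
    toTemperedDistribution_multOp _ _ hasTemperateGrowth_resolventSymbol g
  have h3 : (fun ξ : Space => ((laplaceSymbol ξ * resolventSymbol ξ : ℝ) : ℂ))
      = (fun ξ => (resolventSymbol ξ : ℂ)) * fun ξ => (laplaceSymbol ξ : ℂ) := by
    ext ξ
    simp [mul_comm]
  have h2 : ((laplaceFrame.S g : L2) : 𝓢'(Space, ℂ)) = _ :=
    toTemperedDistribution_multOp _ _ (by
      rw [h3]
      exact hasTemperateGrowth_resolventSymbol.mul hasTemperateGrowth_laplaceSymbol) g
  rw [h1, h2, laplacian_eq_fourierMultiplier, fourierMultiplierCLM_fourierMultiplierCLM_apply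
    hasTemperateGrowth_resolventSymbol hasTemperateGrowth_laplaceSymbol, h3]

end QControl

/-! ### Operators that preserve `H²`. -/

namespace QControl

lemma SpectralFrame.R_injective {X : Type*} [NormedAddCommGroup X] [InnerProductSpace ℂ X]
    (F : SpectralFrame X) : Function.Injective F.R := by
  intro x y h
  have hP : ∀ n, F.P n x = F.P n y := fun n => by rw [← F.L_R, ← F.L_R, h]
  exact tendsto_nhds_unique (F.tendsto_P x) ((F.tendsto_P y).congr fun n => (hP n).symm)

/-- A bounded operator that preserves the domain of the frame is bounded on that domain. -/
lemma SpectralFrame.exists_conj {X : Type*} [NormedAddCommGroup X] [InnerProductSpace ℂ X]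
    [CompleteSpace X] (F : SpectralFrame X) (O : X →L[ℂ] X)
    (h : ∀ g, ∃ g', O (F.R g) = F.R g') : ∃ B : X →L[ℂ] X, ∀ g, O (F.R g) = F.R (B g) := by
  choose T hT using h
  let T' : X →ₗ[ℂ] X :=
    { toFun := T
      map_add' := fun x y => F.R_injective (by rw [map_add, ← hT, ← hT, ← hT, map_add, map_add])
      map_smul' := fun c x => F.R_injective (by
        rw [RingHom.id_apply, map_smul, ← hT, ← hT, map_smul, map_smul]) }
  -- Injectivity of `R` makes preimages unique, so their choice is linear. Its graph is closed
  -- because `R` and `O R` are continuous, and the closed graph theorem yields boundedness.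
  have hg : ∀ (u : ℕ → X) (x y : X), Tendsto u atTop (𝓝 x) → Tendsto (T' ∘ u) atTop (𝓝 y) →
      y = T' x := by
    intro u x y hu hy
    apply F.R_injective
    have h1 := (F.R.continuous.tendsto y).comp hy
    have h2 := ((O.comp F.R).continuous.tendsto x).comp hu
    have h3 : F.R (T' x) = O (F.R x) := (hT x).symm
    rw [h3]
    refine tendsto_nhds_unique h1 (h2.congr fun n => ?_)
    exact hT (u n)
  exact ⟨ContinuousLinearMap.ofSeqClosedGraph hg, hT⟩

open FourierTransform TemperedDistribution LineDeriv

/-- `γ ↦ (1 - (2π)⁻² Δ)⁻¹ γ` on Schwartz functions. -/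
noncomputable def schwartzResolvent (γ : 𝓢(Space, ℂ)) : 𝓢(Space, ℂ) :=
  SchwartzMap.fourierMultiplierCLM ℂ (fun ξ => (resolventSymbol ξ : ℂ)) γ

lemma toTemperedDistribution_schwartzResolvent (γ : 𝓢(Space, ℂ)) :
    ((schwartzResolvent γ : 𝓢(Space, ℂ)) : 𝓢'(Space, ℂ))
      = fourierMultiplierCLM ℂ (fun ξ => (resolventSymbol ξ : ℂ)) (γ : 𝓢'(Space, ℂ)) :=
  (fourierMultiplierCLM_toTemperedDistributionCLM_eq hasTemperateGrowth_resolventSymbol γ).symm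

lemma R_toLp (γ : 𝓢(Space, ℂ)) :
    laplaceFrame.R (γ.toLp 2) = (schwartzResolvent γ).toLp 2 := by
  apply toTemperedDistribution_injective
  have h1 : ((laplaceFrame.R (γ.toLp 2) : L2) : 𝓢'(Space, ℂ)) = _ :=
    toTemperedDistribution_multOp _ _ hasTemperateGrowth_resolventSymbol _
  simp only [h1, Lp.toTemperedDistribution_toLp_eq, toTemperedDistribution_schwartzResolvent]

lemma S_toLp (γ : 𝓢(Space, ℂ)) :
    laplaceFrame.S (γ.toLp 2) = (Δ (schwartzResolvent γ) : 𝓢(Space, ℂ)).toLp 2 := by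
  apply toTemperedDistribution_injective
  simp only [← laplacian_R, R_toLp, Lp.toTemperedDistribution_toLp_eq,
    laplacian_toTemperedDistributionCLM_eq]

lemma memLp_inner_resolvent (v : Space) :
    MemLp (fun ξ : Space => inner ℝ ξ v * resolventSymbol ξ) ∞ volume := by
  refine memLp_top_of_bounded ((by fun_prop : Measurable fun ξ : Space => inner ℝ ξ v).mul
    measurable_resolventSymbol) ‖v‖ fun ξ => ?_
  rw [resolventSymbol_eq, ← div_eq_mul_inv, abs_div, abs_of_pos (a := 1 + ‖ξ‖ ^ 2) (by positivity),
    div_le_iff₀ (by positivity)]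
  refine (abs_real_inner_le_norm ξ v).trans ?_
  nlinarith [mul_nonneg (norm_nonneg v) (sq_nonneg (‖ξ‖ - 1)), norm_nonneg v, norm_nonneg ξ,
    mul_nonneg (norm_nonneg v) (sq_nonneg ‖ξ‖)]

/-- The operator `∂_v (1 - (2π)⁻² Δ)⁻¹`. -/
noncomputable def derivOp (v : Space) : L2 →L[ℂ] L2 :=
  (2 * Real.pi * Complex.I : ℂ) • multOp _ (memLp_inner_resolvent v)

lemma derivOp_toLp (v : Space) (γ : 𝓢(Space, ℂ)) :
    derivOp v (γ.toLp 2) = (∂_{v} (schwartzResolvent γ) : 𝓢(Space, ℂ)).toLp 2 := by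
  have h3 : (fun ξ : Space => ((inner ℝ ξ v * resolventSymbol ξ : ℝ) : ℂ))
      = (fun ξ => (resolventSymbol ξ : ℂ)) * fun ξ => ((inner ℝ ξ v : ℝ) : ℂ) := by
    ext ξ
    simp [mul_comm]
  have hv : (fun ξ : Space => ((inner ℝ ξ v : ℝ) : ℂ)).HasTemperateGrowth := by fun_prop
  have h1 : ((multOp _ (memLp_inner_resolvent v) (γ.toLp 2) : L2) : 𝓢'(Space, ℂ)) = _ :=
    toTemperedDistribution_multOp _ _ (by
      rw [h3]
      exact hasTemperateGrowth_resolventSymbol.mul hv) _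
  apply toTemperedDistribution_injective
  have h2 : ((derivOp v (γ.toLp 2) : L2) : 𝓢'(Space, ℂ)) = (2 * Real.pi * Complex.I : ℂ) •
      ((multOp _ (memLp_inner_resolvent v) (γ.toLp 2) : L2) : 𝓢'(Space, ℂ)) :=
    (Lp.toTemperedDistributionCLM ℂ volume 2).map_smul _ _
  simp only [h2, h1]
  rw [Lp.toTemperedDistribution_toLp_eq, Lp.toTemperedDistribution_toLp_eq,
    ← lineDerivOp_toTemperedDistributionCLM_eq, toTemperedDistribution_schwartzResolvent,
    TemperedDistribution.lineDeriv_eq_fourierMultiplierCLM,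
    fourierMultiplierCLM_fourierMultiplierCLM_apply hasTemperateGrowth_resolventSymbol hv, h3]

/-- The factor `(2π)⁻²` comes from the Fourier kernel `exp(-2πi ξ·x)`, for which `-Δ` has symbol
`(2π)²|ξ|²`. -/
lemma besselPotential_two (f : 𝓢'(Space, ℂ)) :
    besselPotential Space ℂ 2 f = f - ((2 * Real.pi) ^ 2 : ℂ)⁻¹ • Δ f := by
  have h : (fun ξ : Space => (((1 + ‖ξ‖ ^ 2) ^ ((2 : ℝ) / 2) : ℝ) : ℂ))
      = (fun _ => (1 : ℂ)) - ((2 * Real.pi) ^ 2 : ℂ)⁻¹ • fun ξ => (laplaceSymbol ξ : ℂ) := by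
    ext ξ
    have hpi : (2 * Real.pi : ℂ) ^ 2 ≠ 0 := by
      have := Real.pi_ne_zero
      simp [this]
    simp only [laplaceSymbol, Pi.sub_apply, Pi.smul_apply, smul_eq_mul]
    norm_num
  have hl := hasTemperateGrowth_laplaceSymbol
  have h1 : (fun _ : Space => (1 : ℂ)).HasTemperateGrowth := by fun_prop
  have hs : ((((2 * Real.pi) ^ 2 : ℂ)⁻¹) • fun ξ => (laplaceSymbol ξ : ℂ)).HasTemperateGrowth := by
    have : (fun _ : Space => (((2 * Real.pi) ^ 2 : ℂ)⁻¹)).HasTemperateGrowth := by fun_prop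
    exact this.mul hl
  have hsub : fourierMultiplierCLM ℂ ((fun _ : Space => (1 : ℂ)) -
      ((2 * Real.pi) ^ 2 : ℂ)⁻¹ • fun ξ => (laplaceSymbol ξ : ℂ)) f
      = fourierMultiplierCLM ℂ (fun _ => (1 : ℂ)) f
        - fourierMultiplierCLM ℂ (((2 * Real.pi) ^ 2 : ℂ)⁻¹ • fun ξ => (laplaceSymbol ξ : ℂ)) f := by
    simp only [fourierMultiplierCLM_apply]
    rw [TemperedDistribution.smulLeftCLM_sub h1 hs]
    exact (fourierInvCLM ℂ 𝓢'(Space, ℂ)).map_sub _ _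
  rw [besselPotential, h, hsub, fourierMultiplierCLM_smul hl, laplacian_eq_fourierMultiplier]
  simp

/-- The Leibniz rule for `Δ(f p)`, in which only the pure second derivatives of `f` occur. Tested
against `q`, it is the coordinatewise identity `schwartzIntegral_second_deriv` summed over the axes.
-/
lemma laplacian_mulOp {f : Space → ℝ} (hf : MemLp f ∞ volume) (g h : Fin 3 → Space → ℝ)
    (hg : ∀ i, MemLp (g i) ∞ volume) (hh : ∀ i, MemLp (h i) ∞ volume)
    (hfg : ∀ i, HasWeakDeriv (EuclideanSpace.single i 1) f (g i))
    (hgh : ∀ i, HasWeakDeriv (EuclideanSpace.single i 1) (g i) (h i)) (p : 𝓢(Space, ℂ)) :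
    Δ ((mulOp f hf (p.toLp 2) : L2) : 𝓢'(Space, ℂ))
      = ((mulOp f hf ((Δ p : 𝓢(Space, ℂ)).toLp 2)
          + ∑ i, (mulOp (h i) (hh i) (p.toLp 2) + (2 : ℂ) • mulOp (g i) (hg i)
            ((∂_{EuclideanSpace.single i (1 : ℝ)} p : 𝓢(Space, ℂ)).toLp 2)) : L2) :
            𝓢'(Space, ℂ)) := by
  ext q
  let b := EuclideanSpace.basisFun (Fin 3) ℝ
  have hb : ∀ i, b i = EuclideanSpace.single i (1 : ℝ) := EuclideanSpace.basisFun_apply _ _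
  have hsumL : schwartzMul p (Δ q) = ∑ i, schwartzMul p (∂_{b i} (∂_{b i} q)) := by
    rw [SchwartzMap.laplacian_eq_sum b]
    ext x
    simp [schwartzMul_apply, Finset.mul_sum]
  have hsumR : schwartzMul (Δ p) q = ∑ i, schwartzMul (∂_{b i} (∂_{b i} p)) q := by
    rw [SchwartzMap.laplacian_eq_sum b]
    ext x
    simp [schwartzMul_apply, Finset.sum_mul]
  let I : 𝓢(Space, ℂ) →+ ℂ :=
    { toFun := schwartzIntegral f
      map_zero' := by simp [schwartzIntegral]
      map_add' := schwartzIntegral_add hf }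
  have hI : ∀ s : Fin 3 → 𝓢(Space, ℂ), schwartzIntegral f (∑ i, s i)
      = ∑ i, schwartzIntegral f (s i) := fun s => map_sum I s _
  have hR : ∀ (a : L2) (c : Fin 3 → L2), ((a + ∑ i, c i : L2) : 𝓢'(Space, ℂ)) q
      = (a : 𝓢'(Space, ℂ)) q + ∑ i, (c i : 𝓢'(Space, ℂ)) q := by
    intro a c
    simp only [← Lp.toTemperedDistributionCLM_apply, map_add, map_sum]
    simp
  have hR2 : ∀ (a c : L2), ((a + (2 : ℂ) • c : L2) : 𝓢'(Space, ℂ)) q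
      = (a : 𝓢'(Space, ℂ)) q + 2 * (c : 𝓢'(Space, ℂ)) q := by
    intro a c
    simp only [← Lp.toTemperedDistributionCLM_apply, map_add, map_smul]
    simp
  rw [hR]
  simp only [hR2, laplacian_apply_apply, toTemperedDistribution_mulOp_toLp]
  rw [hsumL, hsumR, hI, hI, ← Finset.sum_add_distrib]
  refine Finset.sum_congr rfl fun i _ => ?_
  rw [← hb, schwartzIntegral_second_deriv (hb i ▸ hfg i) (hb i ▸ hgh i) hf (hg i) (hh i)]
  ring

lemma eq_of_eq_on_schwartz (T T' : L2 →L[ℂ] L2)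
    (h : ∀ γ : 𝓢(Space, ℂ), T (γ.toLp 2) = T' (γ.toLp 2)) (u : L2) : T u = T' u :=
  congrFun (DenseRange.equalizer
    (SchwartzMap.denseRange_toLpCLM (F := ℂ) (p := 2) (μ := (volume : Measure Space))
      ENNReal.ofNat_ne_top)
    T.continuous T'.continuous (funext h)) u

/-- Multiplication by a `W^{2,∞}` function is bounded on `H²`. -/
lemma MemW2Infty.exists_conj {f : Space → ℝ} (hf : MemW2Infty f) (hf0 : MemLp f ∞ volume) :
    ∃ B : L2 →L[ℂ] L2, ∀ g, mulOp f hf0 (laplaceFrame.R g) = laplaceFrame.R (B g) := by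
  obtain ⟨-, hf1⟩ := hf
  choose g hg hfg hf2 using hf1
  choose h hh hgh using fun i => hf2 i i
  let c : ℂ := ((2 * Real.pi) ^ 2 : ℂ)⁻¹
  -- With `p = R γ`, this is `(1 - (2π)⁻²Δ)(f p)` expanded by the Leibniz rule. Each term is bounded
  -- in `γ` because `p`, its first derivatives and its Laplacian are, so it suffices to check the
  -- identity on the dense set of Schwartz functions.
  let B : L2 →L[ℂ] L2 := mulOp f hf0 ∘L laplaceFrame.R - c • (mulOp f hf0 ∘L laplaceFrame.S
    + ∑ i, (mulOp (h i) (hh i) ∘L laplaceFrame.R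
      + (2 : ℂ) • (mulOp (g i) (hg i) ∘L derivOp (EuclideanSpace.single i 1))))
  refine ⟨B, fun u => ?_⟩
  refine eq_of_eq_on_schwartz (mulOp f hf0 ∘L laplaceFrame.R) (laplaceFrame.R ∘L B) ?_ u
  intro γ
  rw [ContinuousLinearMap.comp_apply, ContinuousLinearMap.comp_apply]
  rw [← besselPotential_eq_iff, besselPotential_two, R_toLp,
    laplacian_mulOp hf0 g h hg hh hfg hgh]
  have hB : B (γ.toLp 2) = mulOp f hf0 ((schwartzResolvent γ).toLp 2)
      - c • (mulOp f hf0 ((Δ (schwartzResolvent γ) : 𝓢(Space, ℂ)).toLp 2)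
        + ∑ i, (mulOp (h i) (hh i) ((schwartzResolvent γ).toLp 2) + (2 : ℂ) • mulOp (g i) (hg i)
          ((∂_{EuclideanSpace.single i (1 : ℝ)} (schwartzResolvent γ) :
            𝓢(Space, ℂ)).toLp 2))) := by
    rw [← R_toLp, ← S_toLp]
    simp only [← derivOp_toLp]
    simp only [B, sub_apply, add_apply, smul_apply, sum_apply,
      ContinuousLinearMap.comp_apply]
  rw [hB]
  simp only [← Lp.toTemperedDistributionCLM_apply, map_sub, map_smul]
  rfl

end QControl

/-! ### Lipschitz functions of time and their primitives. -/

namespace QControl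

lemma ae_uIoc_of_ae_timeMeasure {T s t : ℝ} {p : ℝ → Prop} (hs : s ∈ Icc 0 T) (ht : t ∈ Icc 0 T)
    (h : ∀ᵐ r ∂timeMeasure T, p r) : ∀ᵐ r, r ∈ uIoc s t → p r := by
  rw [ae_restrict_iff' measurableSet_Ioo] at h
  have hT : ∀ᵐ r : ℝ, r ≠ T := by simp [ae_iff, measure_singleton]
  filter_upwards [h, hT] with r hr hrT hmem
  have h1 : min s t < r := hmem.1
  have h2 : r ≤ max s t := hmem.2
  exact hr ⟨(le_min hs.1 ht.1).trans_lt h1, lt_of_le_of_ne (h2.trans (max_le hs.2 ht.2)) hrT⟩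

lemma intervalIntegrable_of_integrable {T s t : ℝ} {E : Type*} [NormedAddCommGroup E] {f : ℝ → E} (hs : s ∈ Icc 0 T)
    (ht : t ∈ Icc 0 T) (h : Integrable f (timeMeasure T)) : IntervalIntegrable f volume s t := by
  rw [intervalIntegrable_iff]
  have h1 : IntegrableOn f (Ioc 0 T) volume := by
    rw [integrableOn_Ioc_iff_integrableOn_Ioo]
    exact h
  refine h1.mono_set fun r hr => ?_
  exact ⟨(le_min hs.1 ht.1).trans_lt hr.1, hr.2.trans (max_le hs.2 ht.2)⟩

lemma intervalIntegrable_of_memLp_top {T s t : ℝ} {E : Type*} [NormedAddCommGroup E] {f : ℝ → E} (hs : s ∈ Icc 0 T)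
    (ht : t ∈ Icc 0 T) (h : MemLp f ∞ (timeMeasure T)) : IntervalIntegrable f volume s t :=
  intervalIntegrable_of_integrable hs ht (h.integrable le_top)

lemma exists_ae_norm_le {E : Type*} [NormedAddCommGroup E] {f : ℝ → E} {T : ℝ} (h : MemLp f ∞ (timeMeasure T)) :
    ∃ C, 0 ≤ C ∧ ∀ᵐ t ∂timeMeasure T, ‖f t‖ ≤ C := by
  obtain ⟨C, h0, hC⟩ := exists_ae_abs_le h.norm
  exact ⟨C, h0, by simpa using hC⟩

section Primitive

variable {E : Type*} [NormedAddCommGroup E] [NormedSpace ℝ E]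

/-- `u` is, on `[0, T]`, a primitive of the essentially bounded function `du`. -/
structure IsPrimitive (T : ℝ) (u du : ℝ → E) : Prop where
  memLp : MemLp du ∞ (timeMeasure T)
  eq_integral : ∀ t ∈ Icc 0 T, u t = u 0 + ∫ s in (0 : ℝ)..t, du s

namespace IsPrimitive

variable {T : ℝ} {u du : ℝ → E}

lemma sub_eq_integral (h : IsPrimitive T u du) {s t : ℝ} (hs : s ∈ Icc 0 T) (ht : t ∈ Icc 0 T) :
    u t - u s = ∫ r in s..t, du r := by
  have h0 : (0 : ℝ) ∈ Icc 0 T := ⟨le_rfl, hs.1.trans hs.2⟩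
  rw [h.eq_integral t ht, h.eq_integral s hs, add_sub_add_left_eq_sub,
    intervalIntegral.integral_interval_sub_left (intervalIntegrable_of_memLp_top h0 ht h.memLp)
      (intervalIntegrable_of_memLp_top h0 hs h.memLp)]

lemma norm_sub_le (h : IsPrimitive T u du) {C : ℝ} (hC : ∀ᵐ t ∂timeMeasure T, ‖du t‖ ≤ C)
    {s t : ℝ} (hs : s ∈ Icc 0 T) (ht : t ∈ Icc 0 T) : ‖u t - u s‖ ≤ C * |t - s| := by
  rw [h.sub_eq_integral hs ht]
  exact intervalIntegral.norm_integral_le_of_norm_le_const_ae (ae_uIoc_of_ae_timeMeasure hs ht hC)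

lemma continuousOn (h : IsPrimitive T u du) : ContinuousOn u (Icc 0 T) := by
  obtain ⟨C, h0, hC⟩ := exists_ae_norm_le h.memLp
  have : LipschitzOnWith ⟨C, h0⟩ u (Icc 0 T) := by
    refine LipschitzOnWith.of_dist_le_mul fun x hx y hy => ?_
    rw [dist_eq_norm, Real.dist_eq]
    exact h.norm_sub_le hC hy hx
  exact this.continuousOn

lemma ae_hasDerivAt [CompleteSpace E] (h : IsPrimitive T u du) :
    ∀ᵐ t ∂timeMeasure T, HasDerivAt u (du t) t := by
  rw [ae_restrict_iff' measurableSet_Ioo]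
  rcases le_total T 0 with hT | hT
  · simp [Ioo_eq_empty_of_le hT]
  have h0 : (0 : ℝ) ∈ Icc 0 T := ⟨le_rfl, hT⟩
  have hTm : T ∈ Icc 0 T := ⟨hT, le_rfl⟩
  filter_upwards [(intervalIntegrable_of_memLp_top h0 hTm h.memLp).ae_hasDerivAt_integral]
    with t ht hmem
  rw [uIcc_of_le hT] at ht
  refine ((ht (Ioo_subset_Icc_self hmem) 0 h0).const_add (u 0)).congr_of_eventuallyEq ?_
  filter_upwards [Ioo_mem_nhds hmem.1 hmem.2] with r hr
  exact h.eq_integral r (Ioo_subset_Icc_self hr)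

lemma map {G : Type*} [NormedAddCommGroup G] [NormedSpace ℝ G] [CompleteSpace E] [CompleteSpace G]
    (h : IsPrimitive T u du) (L : E →L[ℝ] G) :
    IsPrimitive T (fun t => L (u t)) fun t => L (du t) where
  memLp := L.comp_memLp' h.memLp
  eq_integral t ht := by
    have h0 : (0 : ℝ) ∈ Icc 0 T := ⟨le_rfl, ht.1.trans ht.2⟩
    rw [L.intervalIntegral_comp_comm (intervalIntegrable_of_memLp_top h0 ht h.memLp), ← map_add,
      ← h.eq_integral t ht]

end IsPrimitive

/-- A Lipschitz function is the integral of its derivative. -/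
lemma sub_eq_integral_of_lipschitz [CompleteSpace E] {T : ℝ} {h h' : ℝ → E} {C : ℝ} (hC0 : 0 ≤ C)
    (hlip : ∀ s ∈ Icc 0 T, ∀ t ∈ Icc 0 T, ‖h t - h s‖ ≤ C * |t - s|)
    (hderiv : ∀ᵐ t ∂timeMeasure T, HasDerivAt h (h' t) t) (hmem : MemLp h' ∞ (timeMeasure T))
    {s t : ℝ} (hs : s ∈ Icc 0 T) (ht : t ∈ Icc 0 T) : h t - h s = ∫ r in s..t, h' r := by
  have hT : 0 ≤ T := hs.1.trans hs.2
  have h0 : (0 : ℝ) ∈ Icc 0 T := ⟨le_rfl, hT⟩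
  have hTm : T ∈ Icc 0 T := ⟨hT, le_rfl⟩
  let w : ℝ → E := fun t => ∫ r in (0 : ℝ)..t, h' r
  have hw : IsPrimitive T w h' := ⟨hmem, fun t _ => by simp [w]⟩
  obtain ⟨D, hD0, hD⟩ := exists_ae_norm_le hmem
  -- Subtracting the primitive `w` of `h'` leaves a Lipschitz, hence absolutely continuous, function
  -- whose derivative vanishes almost everywhere; it is therefore constant.
  have hac : AbsolutelyContinuousOnInterval (fun t => h t - w t) 0 T := by
    refine LipschitzOnWith.absolutelyContinuousOnInterval (K := ⟨C + D, by positivity⟩) ?_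
    rw [uIcc_of_le hT]
    refine LipschitzOnWith.of_dist_le_mul fun x hx y hy => ?_
    rw [dist_eq_norm, Real.dist_eq]
    have e : h x - w x - (h y - w y) = (h x - h y) - (w x - w y) := by abel
    rw [e]
    refine (norm_sub_le _ _).trans ?_
    have := add_le_add (hlip y hy x hx) (hw.norm_sub_le hD hy hx)
    rwa [← add_mul] at this
  have hd : ∀ᵐ x, x ∈ uIcc 0 T → HasDerivAt (fun t => h t - w t) 0 x := by
    have hd1 := hderiv
    have hd2 := hw.ae_hasDerivAt
    rw [ae_restrict_iff' measurableSet_Ioo] at hd1 hd2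
    have n1 : ∀ᵐ r : ℝ, r ≠ T := by simp [ae_iff, measure_singleton]
    have n2 : ∀ᵐ r : ℝ, r ≠ 0 := by simp [ae_iff, measure_singleton]
    filter_upwards [hd1, hd2, n1, n2] with x h1 h2 h3 h4 hx
    rw [uIcc_of_le hT] at hx
    have hxm : x ∈ Ioo 0 T := ⟨lt_of_le_of_ne hx.1 (Ne.symm h4), lt_of_le_of_ne hx.2 h3⟩
    have h5 := (h1 hxm).fun_sub (h2 hxm)
    rwa [sub_self] at h5
  obtain ⟨c, hc⟩ := hac.const_of_ae_hasDerivAt_zero hd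
  rw [uIcc_of_le hT] at hc
  rw [← hw.sub_eq_integral hs ht, ← sub_eq_zero]
  have e : h t - h s - (w t - w s) = (h t - w t) - (h s - w s) := by abel
  rw [e, hc t ht, hc s hs, sub_self]

lemma IsPrimitive.inner_sub_eq_integral {X : Type*} [NormedAddCommGroup X] [InnerProductSpace ℂ X]
    [CompleteSpace X] {T : ℝ} {u du v dv : ℝ → X} (hu : IsPrimitive T u du)
    (hv : IsPrimitive T v dv) {s t : ℝ} (hs : s ∈ Icc 0 T) (ht : t ∈ Icc 0 T) :
    inner ℂ (u t) (v t) - inner ℂ (u s) (v s)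
      = ∫ r in s..t, (inner ℂ (u r) (dv r) + inner ℂ (du r) (v r)) := by
  obtain ⟨C, hC0, hC⟩ := exists_ae_norm_le hu.memLp
  obtain ⟨D, hD0, hD⟩ := exists_ae_norm_le hv.memLp
  obtain ⟨A, hA⟩ := isCompact_Icc.exists_bound_of_continuousOn hu.continuousOn
  obtain ⟨B, hB⟩ := isCompact_Icc.exists_bound_of_continuousOn hv.continuousOn
  have hA0 : 0 ≤ A := (norm_nonneg _).trans (hA s hs)
  have hB0 : 0 ≤ B := (norm_nonneg _).trans (hB s hs)
  have hum : AEStronglyMeasurable u (timeMeasure T) :=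
    (hu.continuousOn.mono Ioo_subset_Icc_self).aestronglyMeasurable measurableSet_Ioo
  have hvm : AEStronglyMeasurable v (timeMeasure T) :=
    (hv.continuousOn.mono Ioo_subset_Icc_self).aestronglyMeasurable measurableSet_Ioo
  refine sub_eq_integral_of_lipschitz (h := fun t => inner ℂ (u t) (v t))
    (h' := fun r => inner ℂ (u r) (dv r) + inner ℂ (du r) (v r)) (C := A * D + C * B)
    (by positivity) ?_ ?_ ?_ hs ht
  · intro s hs t ht
    have e : inner ℂ (u t) (v t) - inner ℂ (u s) (v s)
        = inner ℂ (u s) (v t - v s) + inner ℂ (u t - u s) (v t) := by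
      rw [inner_sub_left, inner_sub_right]
      ring
    rw [e, add_mul, mul_assoc, mul_right_comm]
    refine (norm_add_le _ _).trans (add_le_add ?_ ?_)
    · exact (norm_inner_le_norm _ _).trans (mul_le_mul (hA s hs) (hv.norm_sub_le hD hs ht)
        (norm_nonneg _) hA0)
    · exact (norm_inner_le_norm _ _).trans (mul_le_mul (hu.norm_sub_le hC hs ht) (hB t ht)
        (norm_nonneg _) (by positivity))
  · filter_upwards [hu.ae_hasDerivAt, hv.ae_hasDerivAt] with r h1 h2
    exact h1.inner ℂ h2
  · refine memLp_top_of_bound ((hum.inner hv.memLp.1).add (hu.memLp.1.inner hvm))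
      (A * D + C * B) ?_
    filter_upwards [hC, hD, ae_restrict_mem measurableSet_Ioo] with r h1 h2 hr
    refine (norm_add_le _ _).trans (add_le_add ?_ ?_)
    · exact (norm_inner_le_norm _ _).trans (mul_le_mul (hA r (Ioo_subset_Icc_self hr)) h2
        (norm_nonneg _) hA0)
    · exact (norm_inner_le_norm _ _).trans (mul_le_mul h1 (hB r (Ioo_subset_Icc_self hr))
        (norm_nonneg _) hC0)

end Primitive

end QControl

/-! ### Abstract controlled Hamiltonians: conservation laws and the domain estimate. -/

namespace QControl

/-- A Hamiltonian `-Δ + V` with a coupling operator `M`, where `V` and `M` are bounded, symmetric,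
and bounded on the domain of `Δ`. -/
structure ControlledHamiltonian (X : Type*) [NormedAddCommGroup X] [InnerProductSpace ℂ X] extends
    SpectralFrame X where
  V : X →L[ℂ] X
  M : X →L[ℂ] X
  BV : X →L[ℂ] X
  BM : X →L[ℂ] X
  inner_V : ∀ x y, inner ℂ (V x) y = inner ℂ x (V y)
  inner_M : ∀ x y, inner ℂ (M x) y = inner ℂ x (M y)
  V_R : ∀ x, V (R x) = R (BV x)
  M_R : ∀ x, M (R x) = R (BM x)

variable {X : Type*} [NormedAddCommGroup X] [InnerProductSpace ℂ X]

namespace SpectralFrame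

variable (F : SpectralFrame X)

lemma norm_P_le (n : ℕ) (x : X) : ‖F.P n x‖ ≤ ‖x‖ := by
  have h1 : ‖F.P n x‖ * ‖F.P n x‖ ≤ ‖x‖ * ‖F.P n x‖ := by
    rw [← inner_self_eq_norm_mul_norm (𝕜 := ℂ), F.inner_P, F.P_P]
    exact re_inner_le_norm x _
  rcases (norm_nonneg (F.P n x)).eq_or_lt with h | h
  · rw [← h]
    exact norm_nonneg x
  · exact le_of_mul_le_mul_right h1 h

lemma norm_L_le (n : ℕ) {f g : X} {C : ℝ} (h : f = F.R g) (hg : ‖g‖ ≤ C) : ‖F.L n f‖ ≤ C := by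
  rw [h, F.L_R]
  exact (F.norm_P_le n g).trans hg

/-- The increments of `L n f` are orthogonal to its earlier values, so `‖L m f - L n f‖²` is a
difference of terms of a bounded monotone sequence and `L n f` is Cauchy. Applying `R` to its limit
gives `lim P n f = f`. This is how domain bounds survive strong limits. -/
lemma exists_of_norm_L_le [CompleteSpace X] {f : X} {C : ℝ} (h : ∀ n, ‖F.L n f‖ ≤ C) :
    ∃ g, f = F.R g ∧ ‖g‖ ≤ C := by
  have hC : 0 ≤ C := (norm_nonneg _).trans (h 0)
  have hsq : ∀ n m, n ≤ m → ‖F.L m f - F.L n f‖ ^ 2 = ‖F.L m f‖ ^ 2 - ‖F.L n f‖ ^ 2 := by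
    intro n m hnm
    have h1 : F.L n f = F.P n (F.L m f) := (F.P_L n m f hnm).symm
    have h2 : RCLike.re (inner ℂ (F.L m f) (F.L n f)) = ‖F.L n f‖ ^ 2 := by
      rw [← inner_self_eq_norm_sq (𝕜 := ℂ)]
      conv_rhs => rw [h1, F.inner_P, F.P_P, ← h1]
    rw [norm_sub_sq (𝕜 := ℂ), h2]
    ring
  have hmono : Monotone fun n => ‖F.L n f‖ ^ 2 := by
    intro n m hnm
    have := hsq n m hnm
    have := sq_nonneg ‖F.L m f - F.L n f‖
    change ‖F.L n f‖ ^ 2 ≤ ‖F.L m f‖ ^ 2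
    linarith
  have hbdd : BddAbove (range fun n => ‖F.L n f‖ ^ 2) := by
    refine ⟨C ^ 2, ?_⟩
    rintro _ ⟨n, rfl⟩
    exact pow_le_pow_left₀ (norm_nonneg _) (h n) 2
  have hcs : CauchySeq fun n => F.L n f := by
    have hc := (tendsto_atTop_ciSup hmono hbdd).cauchySeq
    rw [Metric.cauchySeq_iff'] at hc ⊢
    intro ε hε
    obtain ⟨N, hN⟩ := hc (ε ^ 2) (by positivity)
    refine ⟨N, fun n hn => ?_⟩
    have h1 := hN n hn
    rw [Real.dist_eq, ← hsq N n hn, abs_of_nonneg (sq_nonneg _)] at h1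
    rw [dist_eq_norm]
    exact lt_of_pow_lt_pow_left₀ 2 hε.le h1
  obtain ⟨g, hg⟩ := cauchySeq_tendsto_of_complete hcs
  refine ⟨g, ?_, le_of_tendsto hg.norm (Eventually.of_forall h)⟩
  refine tendsto_nhds_unique (F.tendsto_P f) (((F.R.continuous.tendsto g).comp hg).congr fun n => ?_)
  exact F.R_L n f

end SpectralFrame

namespace ControlledHamiltonian

variable (H : ControlledHamiltonian X)

/-- `ψ` solves `i ψ' = (-Δ + V - e M) ψ` on `(0, T)`, with `ψ` essentially bounded in the domain of
`Δ` and essentially bounded derivative. -/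
def IsSolution (T : ℝ) (e : ℝ → ℝ) (ψ : ℝ → X) : Prop :=
  (∃ C : ℝ, ∀ᵐ t ∂timeMeasure T, ∃ g, ψ t = H.R g ∧ ‖g‖ ≤ C) ∧
  ∃ dψ : ℝ → X, IsPrimitive T ψ dψ ∧ ∀ᵐ t ∂timeMeasure T, ∃ g, ψ t = H.R g ∧
    Complex.I • dψ t = -H.S g + H.V (ψ t) - (e t : ℂ) • H.M (ψ t)

variable {H} {T : ℝ}

lemma IsSolution.continuousOn {e : ℝ → ℝ} {ψ : ℝ → X} (h : H.IsSolution T e ψ) :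
    ContinuousOn ψ (Icc 0 T) :=
  h.2.choose_spec.1.continuousOn

lemma eq_neg_I_smul {x y : X} (h : Complex.I • x = y) : x = -(Complex.I • y) := by
  rw [← h, smul_smul, Complex.I_mul_I, neg_one_smul, neg_neg]

lemma IsSolution.inner_sub_eq_integral [CompleteSpace X] {e e' : ℝ → ℝ} {ψ χ : ℝ → X}
    (hψ : H.IsSolution T e ψ) (hχ : H.IsSolution T e' χ) {s t : ℝ} (hs : s ∈ Icc 0 T)
    (ht : t ∈ Icc 0 T) :
    inner ℂ (χ t) (ψ t) - inner ℂ (χ s) (ψ s)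
      = ∫ r in s..t, Complex.I * (e r - e' r : ℝ) * inner ℂ (χ r) (H.M (ψ r)) := by
  obtain ⟨-, dψ, hpψ, hψ⟩ := hψ
  obtain ⟨-, dχ, hpχ, hχ⟩ := hχ
  rw [hpχ.inner_sub_eq_integral hpψ hs ht]
  refine intervalIntegral.integral_congr_ae ?_
  filter_upwards [ae_uIoc_of_ae_timeMeasure hs ht hψ, ae_uIoc_of_ae_timeMeasure hs ht hχ]
    with r h1 h2 hr
  obtain ⟨g, hg, h1⟩ := h1 hr
  obtain ⟨g', hg', h2⟩ := h2 hr
  -- Symmetry of the Laplacian on its domain, written through the symmetric and commuting bounded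
  -- operators `R` and `S`.
  have hS : inner ℂ (χ r) (H.S g) = inner ℂ (H.S g') (ψ r) := by
    rw [hg, hg', H.inner_R, H.R_S, H.inner_S]
  have hV := H.inner_V (χ r) (ψ r)
  have hM := H.inner_M (χ r) (ψ r)
  rw [eq_neg_I_smul h1, eq_neg_I_smul h2]
  simp only [inner_neg_left, inner_neg_right, inner_add_left, inner_add_right, inner_sub_left,
    inner_sub_right, inner_smul_left, inner_smul_right, Complex.conj_I, Complex.conj_ofReal]
  rw [hS, hV, hM]
  push_cast
  ring

lemma IsSolution.norm_eq [CompleteSpace X] {e : ℝ → ℝ} {ψ : ℝ → X} (hψ : H.IsSolution T e ψ)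
    {s t : ℝ} (hs : s ∈ Icc 0 T) (ht : t ∈ Icc 0 T) : ‖ψ t‖ = ‖ψ s‖ := by
  have h := hψ.inner_sub_eq_integral hψ hs ht
  simp only [sub_self, Complex.ofReal_zero, mul_zero, zero_mul, intervalIntegral.integral_zero,
    sub_eq_zero, inner_self_eq_norm_sq_to_K] at h
  have h2 : ‖ψ t‖ ^ 2 = ‖ψ s‖ ^ 2 := by
    apply Complex.ofReal_injective
    simpa using h
  exact (pow_left_inj₀ (norm_nonneg _) (norm_nonneg _) two_ne_zero).1 h2

/-- The two solutions stay close if the controls are close in `L¹`. -/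
lemma IsSolution.norm_sub_sq_le [CompleteSpace X] {e e' : ℝ → ℝ} {ψ χ : ℝ → X} {C : ℝ}
    (hψ : H.IsSolution T e ψ) (hχ : H.IsSolution T e' χ)
    (hC : ∀ r ∈ Icc 0 T, ‖χ r‖ * ‖H.M (ψ r)‖ ≤ C)
    (hint : Integrable (fun r => e r - e' r) (timeMeasure T)) {s t : ℝ} (hs : s ∈ Icc 0 T)
    (ht : t ∈ Icc 0 T) :
    ‖ψ t - χ t‖ ^ 2 ≤ ‖ψ s - χ s‖ ^ 2 + 2 * (C * ∫ r, |e r - e' r| ∂timeMeasure T) := by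
  have h := hψ.inner_sub_eq_integral hχ hs ht
  have hre : |RCLike.re (inner ℂ (χ t) (ψ t)) - RCLike.re (inner ℂ (χ s) (ψ s))|
      ≤ C * ∫ r, |e r - e' r| ∂timeMeasure T := by
    rw [← map_sub, h]
    refine (RCLike.abs_re_le_norm _).trans ?_
    refine (intervalIntegral.norm_integral_le_integral_norm_uIoc).trans ?_
    rw [← integral_const_mul]
    have h1 : IntegrableOn (fun r => C * |e r - e' r|) (Ioc 0 T) volume := by
      rw [integrableOn_Ioc_iff_integrableOn_Ioo]
      exact hint.abs.const_mul C
    have hsub : uIoc s t ⊆ Ioc 0 T := fun r hr =>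
      ⟨(le_min hs.1 ht.1).trans_lt hr.1, hr.2.trans (max_le hs.2 ht.2)⟩
    have hCn : ∀ r ∈ Ioc 0 T, ‖Complex.I * (e r - e' r : ℝ) * inner ℂ (χ r) (H.M (ψ r))‖
        ≤ C * |e r - e' r| := by
      intro r hr
      rw [norm_mul, norm_mul, Complex.norm_I, one_mul, Complex.norm_real, Real.norm_eq_abs,
        mul_comm]
      exact mul_le_mul_of_nonneg_right ((norm_inner_le_norm _ _).trans
        (hC r (Ioc_subset_Icc_self hr))) (abs_nonneg _)
    have hC0 : 0 ≤ C := (by positivity : (0 : ℝ) ≤ ‖χ s‖ * ‖H.M (ψ s)‖).trans (hC s hs)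
    calc ∫ r in uIoc s t, ‖Complex.I * (e r - e' r : ℝ) * inner ℂ (χ r) (H.M (ψ r))‖
        ≤ ∫ r in uIoc s t, C * |e r - e' r| := by
          refine integral_mono_of_nonneg (Eventually.of_forall fun r => norm_nonneg _)
            (h1.mono_set hsub) ?_
          rw [EventuallyLE, ae_restrict_iff' measurableSet_uIoc]
          exact Eventually.of_forall fun r hr => hCn r (hsub hr)
      _ ≤ ∫ r in Ioc 0 T, C * |e r - e' r| :=
          setIntegral_mono_set h1 (Eventually.of_forall fun r => by positivity)
            (LE.le.eventuallyLE hsub)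
      _ = ∫ r, C * |e r - e' r| ∂timeMeasure T := integral_Ioc_eq_integral_Ioo
  -- Both norms are conserved, so only the cross term of `‖χ‖² - 2 Re⟨χ, ψ⟩ + ‖ψ‖²` varies. No
  -- Gronwall argument and no domain norm is needed.
  have e1 := hψ.norm_eq hs ht
  have e2 := hχ.norm_eq hs ht
  have s1 := norm_sub_sq (𝕜 := ℂ) (χ t) (ψ t)
  have s2 := norm_sub_sq (𝕜 := ℂ) (χ s) (ψ s)
  rw [norm_sub_rev (ψ t), norm_sub_rev (ψ s), s1, s2, e1, e2]
  have := abs_le.1 hre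
  linarith [this.1]

/-- One step of the a priori estimate for the graph norm. -/
lemma IsSolution.norm_L_sq_le [CompleteSpace X] {e : ℝ → ℝ} {ψ : ℝ → X} {E c t₀ : ℝ} {wt : ℝ → ℝ}
    {g₀ : X} (hψ : H.IsSolution T e ψ) (he : ∀ᵐ t ∂timeMeasure T, |e t| ≤ E) (hw : Continuous wt)
    (ht₀ : t₀ ∈ Icc 0 T) (hg₀ : ψ t₀ = H.R g₀)
    (hc : ∀ᵐ t ∂timeMeasure T, ∃ g, ψ t = H.R g ∧ ‖g‖ ^ 2 ≤ c * wt t) {t : ℝ} (ht : t ∈ Icc 0 T)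
    (n : ℕ) :
    ‖H.L n (ψ t)‖ ^ 2 ≤ ‖g₀‖ ^ 2
      + |∫ r in t₀..t, 2 * (‖H.BV‖ + E * ‖H.BM‖) * (c * wt r)| := by
  obtain ⟨-, dψ, hp, hψ⟩ := hψ
  have hL : IsPrimitive T (fun t => H.L n (ψ t)) fun t => H.L n (dψ t) :=
    hp.map ((H.L n).restrictScalars ℝ)
  have h := hL.inner_sub_eq_integral hL ht₀ ht
  have hint : IntervalIntegrable
      (fun r => inner ℂ (H.L n (ψ r)) (H.L n (dψ r)) + inner ℂ (H.L n (dψ r)) (H.L n (ψ r)))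
      volume t₀ t := by
    obtain ⟨D, hD0, hD⟩ := exists_ae_norm_le hL.memLp
    obtain ⟨A, hA⟩ := isCompact_Icc.exists_bound_of_continuousOn hL.continuousOn
    have hm : AEStronglyMeasurable (fun t => H.L n (ψ t)) (timeMeasure T) :=
      (hL.continuousOn.mono Ioo_subset_Icc_self).aestronglyMeasurable measurableSet_Ioo
    refine intervalIntegrable_of_memLp_top ht₀ ht (memLp_top_of_bound
      ((hm.inner hL.memLp.1).add (hL.memLp.1.inner hm)) (A * D + D * A) ?_)
    filter_upwards [hD, ae_restrict_mem measurableSet_Ioo] with r h2 hr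
    have h1 := hA r (Ioo_subset_Icc_self hr)
    refine (norm_add_le _ _).trans (add_le_add ?_ ?_)
    · exact (norm_inner_le_norm _ _).trans (mul_le_mul h1 h2 (norm_nonneg _)
        ((norm_nonneg _).trans h1))
    · exact (norm_inner_le_norm _ _).trans (mul_le_mul h2 h1 (norm_nonneg _) hD0)
  have h2 := congrArg RCLike.re h
  rw [map_sub, inner_self_eq_norm_sq, inner_self_eq_norm_sq] at h2
  have h3 : RCLike.re (∫ r in t₀..t,
      (inner ℂ (H.L n (ψ r)) (H.L n (dψ r)) + inner ℂ (H.L n (dψ r)) (H.L n (ψ r))))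
      = ∫ r in t₀..t, RCLike.re
        (inner ℂ (H.L n (ψ r)) (H.L n (dψ r)) + inner ℂ (H.L n (dψ r)) (H.L n (ψ r))) :=
    ((RCLike.reCLM (K := ℂ)).intervalIntegral_comp_comm hint).symm
  have h4 : ‖H.L n (ψ t₀)‖ ≤ ‖g₀‖ := H.norm_L_le n hg₀ le_rfl
  have h5 : ‖∫ r in t₀..t, RCLike.re
        (inner ℂ (H.L n (ψ r)) (H.L n (dψ r)) + inner ℂ (H.L n (dψ r)) (H.L n (ψ r)))‖
      ≤ |∫ r in t₀..t, 2 * (‖H.BV‖ + E * ‖H.BM‖) * (c * wt r)| := by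
    refine intervalIntegral.norm_integral_le_abs_of_norm_le ?_ ?_
    · rw [ae_restrict_iff' measurableSet_uIoc]
      filter_upwards [ae_uIoc_of_ae_timeMeasure ht₀ ht hψ, ae_uIoc_of_ae_timeMeasure ht₀ ht hc,
        ae_uIoc_of_ae_timeMeasure ht₀ ht he] with r h1 h2 h3 hr
      obtain ⟨g, hg, h1⟩ := h1 hr
      obtain ⟨g', hg', h2⟩ := h2 hr
      obtain rfl : g = g' := H.R_injective (hg.symm.trans hg')
      have h3 := h3 hr
      -- Formally `g = R⁻¹ψ` solves `i g' = -Δg + (BV - e BM) g`. The truncation `L n` replaces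
      -- `R⁻¹` so that every term is bounded.
      let y : X := H.BV g - (e r : ℂ) • H.BM g
      have hd : H.L n (dψ r) = -(Complex.I • (-H.A n (H.P n g) + H.P n y)) := by
        rw [eq_neg_I_smul h1, map_neg, map_smul]
        congr 2
        rw [hg, H.V_R, H.M_R]
        simp only [y, map_add, map_sub, map_neg, map_smul, H.L_S, H.L_R]
        abel
      -- The truncated Laplacian is symmetric and contributes nothing to the growth of the norm; the
      -- bound is thus independent of `n`.
      have hA : (inner ℂ (H.P n g) (H.A n (H.P n g)) : ℂ).im = 0 := by
        have h := H.inner_A n (H.P n g) (H.P n g)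
        rw [← inner_conj_symm] at h
        exact Complex.conj_eq_iff_im.1 h
      have hy : ‖H.P n y‖ ≤ (‖H.BV‖ + E * ‖H.BM‖) * ‖g‖ := by
        refine (H.norm_P_le n y).trans ((norm_sub_le _ _).trans ?_)
        rw [norm_smul, Complex.norm_real, Real.norm_eq_abs, add_mul, mul_assoc]
        exact add_le_add (H.BV.le_opNorm g) (mul_le_mul h3 (H.BM.le_opNorm g) (norm_nonneg _)
          ((abs_nonneg _).trans h3))
      have hre : RCLike.re
          (inner ℂ (H.L n (ψ r)) (H.L n (dψ r)) + inner ℂ (H.L n (dψ r)) (H.L n (ψ r)))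
          = 2 * (inner ℂ (H.P n g) (H.P n y) : ℂ).im := by
        rw [map_add, inner_re_symm (𝕜 := ℂ) (H.L n (dψ r)), ← two_mul, hd, hg, H.L_R,
          inner_neg_right, inner_smul_right, inner_add_right, inner_neg_right]
        simp [hA]
      rw [hre, norm_mul, Real.norm_eq_abs, Real.norm_eq_abs, abs_two, mul_assoc]
      refine mul_le_mul_of_nonneg_left ?_ zero_le_two
      have hK : 0 ≤ ‖H.BV‖ + E * ‖H.BM‖ := by
        have : 0 ≤ E := (abs_nonneg _).trans h3
        positivity
      calc |(inner ℂ (H.P n g) (H.P n y) : ℂ).im| ≤ ‖H.P n g‖ * ‖H.P n y‖ :=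
            (Complex.abs_im_le_norm _).trans (norm_inner_le_norm _ _)
        _ ≤ ‖g‖ * ((‖H.BV‖ + E * ‖H.BM‖) * ‖g‖) :=
            mul_le_mul (H.norm_P_le n g) hy (norm_nonneg _) (norm_nonneg _)
        _ = (‖H.BV‖ + E * ‖H.BM‖) * ‖g‖ ^ 2 := by ring
        _ ≤ _ := mul_le_mul_of_nonneg_left h2 hK
    · exact (by fun_prop : Continuous fun r =>
        2 * (‖H.BV‖ + E * ‖H.BM‖) * (c * wt r)).intervalIntegrable _ _
  rw [h3] at h2
  have h6 := (le_abs_self _).trans h5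
  have h7 := pow_le_pow_left₀ (norm_nonneg _) h4 2
  linarith

/-- A priori bound of the graph norm in terms of its value at time `t₀`, forward (`σ = 1`) or
backward (`σ = -1`) in time. -/
lemma IsSolution.exists_bound [CompleteSpace X] {e : ℝ → ℝ} {ψ : ℝ → X} {E t₀ σ : ℝ} {g₀ : X}
    (hψ : H.IsSolution T e ψ) (hE : 0 ≤ E) (he : ∀ᵐ t ∂timeMeasure T, |e t| ≤ E)
    (ht₀ : t₀ ∈ Icc 0 T) (hg₀ : ψ t₀ = H.R g₀) (hσ : σ * σ = 1)
    (hσt : ∀ t ∈ Icc 0 T, 0 ≤ σ * (t - t₀)) {t : ℝ} (ht : t ∈ Icc 0 T) :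
    ∃ g, ψ t = H.R g ∧
      ‖g‖ ^ 2 ≤ 2 * ‖g₀‖ ^ 2 * Real.exp (4 * (‖H.BV‖ + E * ‖H.BM‖) * (σ * (t - t₀))) := by
  set K := ‖H.BV‖ + E * ‖H.BM‖ with hK
  have hK0 : 0 ≤ K := by positivity
  -- The exponent `4K` is twice the growth rate `2K`, so one integration of the estimate against
  -- this weight halves the constant.
  let wt : ℝ → ℝ := fun t => Real.exp (4 * K * (σ * (t - t₀)))
  have hwc : Continuous wt := by fun_prop
  have hw1 : ∀ t ∈ Icc 0 T, 1 ≤ wt t := fun t ht =>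
    Real.one_le_exp (mul_nonneg (by positivity) (hσt t ht))
  have hσa : |σ| = 1 := by
    have : |σ| * |σ| = 1 := by rw [abs_mul_abs_self, hσ]
    nlinarith [abs_nonneg σ]
  have hwint : ∀ c : ℝ, 0 ≤ c → ∀ t ∈ Icc 0 T,
      |∫ r in t₀..t, 2 * K * (c * wt r)| ≤ c / 2 * wt t := by
    intro c hc t ht
    have hd : ∀ r ∈ uIcc t₀ t, HasDerivAt (fun r => c * σ / 2 * wt r) (2 * K * (c * wt r)) r := by
      intro r _
      have h1 : HasDerivAt (fun r => 4 * K * (σ * (r - t₀))) (4 * K * (σ * 1)) r :=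
        (((hasDerivAt_id r).sub_const t₀).const_mul σ).const_mul (4 * K)
      refine (h1.exp.const_mul (c * σ / 2)).congr_deriv ?_
      change c * σ / 2 * (wt r * (4 * K * (σ * 1))) = _
      linear_combination (2 * c * K * wt r) * hσ
    have h0 : wt t₀ = 1 := by simp [wt]
    rw [intervalIntegral.integral_eq_sub_of_hasDerivAt hd
      ((by fun_prop : Continuous fun r => 2 * K * (c * wt r)).intervalIntegrable _ _), h0,
      ← mul_sub, abs_mul, abs_div, abs_mul, hσa, abs_of_nonneg hc, abs_two, mul_one,
      abs_of_nonneg (sub_nonneg.2 (hw1 t ht))]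
    exact mul_le_mul_of_nonneg_left (by linarith) (by positivity)
  obtain ⟨C, hC⟩ := hψ.1
  have key : ∀ k : ℕ, ∀ t ∈ Icc 0 T,
      ∃ g, ψ t = H.R g ∧ ‖g‖ ^ 2 ≤ (2 * ‖g₀‖ ^ 2 + C ^ 2 * (1 / 2) ^ k) * wt t := by
    -- Replaces Gronwall: a bound `c * wt` improves to `(‖g₀‖² + c/2) * wt`. Iterating from the
    -- qualitative bound `C²` converges to the fixed point `2‖g₀‖²`, which no longer depends on `C`.
    -- The improved bound holds at every time, not just almost every one.
    have step : ∀ c : ℝ, 0 ≤ c →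
        (∀ᵐ t ∂timeMeasure T, ∃ g, ψ t = H.R g ∧ ‖g‖ ^ 2 ≤ c * wt t) →
        ∀ t ∈ Icc 0 T, ∃ g, ψ t = H.R g ∧ ‖g‖ ^ 2 ≤ (‖g₀‖ ^ 2 + c / 2) * wt t := by
      intro c hc0 hc t ht
      have hw := hw1 t ht
      have hn : ∀ n, ‖H.L n (ψ t)‖ ≤ √((‖g₀‖ ^ 2 + c / 2) * wt t) := by
        intro n
        refine Real.le_sqrt_of_sq_le ?_
        refine (hψ.norm_L_sq_le he hwc ht₀ hg₀ hc ht n).trans ?_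
        rw [add_mul]
        exact add_le_add (le_mul_of_one_le_right (sq_nonneg _) hw) (hwint c hc0 t ht)
      obtain ⟨g, hg, hgn⟩ := H.exists_of_norm_L_le hn
      refine ⟨g, hg, ?_⟩
      have := pow_le_pow_left₀ (norm_nonneg _) hgn 2
      rwa [Real.sq_sqrt (by positivity)] at this
    intro k
    induction k with
    | zero =>
      intro t ht
      obtain ⟨g, hg, h⟩ := step (C ^ 2) (sq_nonneg _) (by
        filter_upwards [hC, ae_restrict_mem measurableSet_Ioo] with r hr hmem
        obtain ⟨g, hg, h⟩ := hr
        refine ⟨g, hg, (pow_le_pow_left₀ (norm_nonneg _) h 2).trans ?_⟩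
        exact le_mul_of_one_le_right (sq_nonneg _) (hw1 r (Ioo_subset_Icc_self hmem))) t ht
      refine ⟨g, hg, h.trans (mul_le_mul_of_nonneg_right ?_ (Real.exp_pos _).le)⟩
      nlinarith [sq_nonneg C, sq_nonneg ‖g₀‖]
    | succ k ih =>
      intro t ht
      obtain ⟨g, hg, h⟩ := step _ (by positivity)
        ((ae_restrict_mem measurableSet_Ioo).mono fun r hr => ih r (Ioo_subset_Icc_self hr)) t ht
      refine ⟨g, hg, h.trans (le_of_eq ?_)⟩
      ring
  obtain ⟨g, hg, -⟩ := key 0 t ht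
  refine ⟨g, hg, ?_⟩
  have hlim : Tendsto (fun k : ℕ => (2 * ‖g₀‖ ^ 2 + C ^ 2 * (1 / 2) ^ k) * wt t) atTop
      (𝓝 ((2 * ‖g₀‖ ^ 2 + C ^ 2 * 0) * wt t)) :=
    (((tendsto_pow_atTop_nhds_zero_of_lt_one (by norm_num) (by norm_num)).const_mul _).const_add
      _).mul_const _
  rw [mul_zero, add_zero] at hlim
  refine ge_of_tendsto hlim (Eventually.of_forall fun k => ?_)
  obtain ⟨g', hg', h⟩ := key k t ht
  obtain rfl : g = g' := H.R_injective (hg.symm.trans hg')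
  exact h

end ControlledHamiltonian

end QControl

/-! ### Stability of solutions under limits. -/

namespace QControl

namespace ControlledHamiltonian

variable {X : Type*} [NormedAddCommGroup X] [InnerProductSpace ℂ X]
variable {H : ControlledHamiltonian X} {T : ℝ}

lemma norm_rhs_le (H : ControlledHamiltonian X) {a E D : ℝ} {x g : X} (hx : x = H.R g)
    (hg : ‖g‖ ≤ D) (ha : |a| ≤ E) :
    ‖-H.S g + H.V x - (a : ℂ) • H.M x‖ ≤
      (‖H.S‖ + ‖H.V‖ * ‖H.R‖ + E * (‖H.M‖ * ‖H.R‖)) * D := by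
  have hD : 0 ≤ D := (norm_nonneg _).trans hg
  have hE : 0 ≤ E := (abs_nonneg _).trans ha
  have h1 : ‖H.S g‖ ≤ ‖H.S‖ * D := H.S.le_opNorm_of_le hg
  have h2 : ‖x‖ ≤ ‖H.R‖ * D := hx ▸ H.R.le_opNorm_of_le hg
  have h3 : ‖H.V x‖ ≤ ‖H.V‖ * (‖H.R‖ * D) := H.V.le_opNorm_of_le h2
  have h4 : ‖(a : ℂ) • H.M x‖ ≤ E * (‖H.M‖ * (‖H.R‖ * D)) := by
    rw [norm_smul, Complex.norm_real, Real.norm_eq_abs]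
    exact mul_le_mul ha (H.M.le_opNorm_of_le h2) (norm_nonneg _) hE
  calc ‖-H.S g + H.V x - (a : ℂ) • H.M x‖
      ≤ ‖H.S g‖ + ‖H.V x‖ + ‖(a : ℂ) • H.M x‖ := by
        refine (norm_sub_le _ _).trans (add_le_add_left ((norm_add_le _ _).trans ?_) _)
        rw [norm_neg]
    _ ≤ ‖H.S‖ * D + ‖H.V‖ * (‖H.R‖ * D) + E * (‖H.M‖ * (‖H.R‖ * D)) :=
        add_le_add (add_le_add h1 h3) h4
    _ = _ := by ring

lemma ae_norm_deriv_le {e : ℝ → ℝ} {ψ dψ : ℝ → X} {D E : ℝ}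
    (hψ : ∀ᵐ t ∂timeMeasure T, ∃ g, ψ t = H.R g ∧
      Complex.I • dψ t = -H.S g + H.V (ψ t) - (e t : ℂ) • H.M (ψ t))
    (hD : ∀ t ∈ Icc 0 T, ∃ g, ψ t = H.R g ∧ ‖g‖ ≤ D) (hE : ∀ᵐ t ∂timeMeasure T, |e t| ≤ E) :
    ∀ᵐ t ∂timeMeasure T, ‖dψ t‖ ≤ (‖H.S‖ + ‖H.V‖ * ‖H.R‖ + E * (‖H.M‖ * ‖H.R‖)) * D := by
  filter_upwards [hψ, hE, ae_restrict_mem measurableSet_Ioo] with r h1 h2 hr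
  obtain ⟨g, hg, h1⟩ := h1
  obtain ⟨g', hg', h3⟩ := hD r (Ioo_subset_Icc_self hr)
  obtain rfl : g = g' := H.R_injective (hg.symm.trans hg')
  have : ‖dψ r‖ = ‖Complex.I • dψ r‖ := by rw [norm_smul, Complex.norm_I, one_mul]
  rw [this, h1]
  exact H.norm_rhs_le hg h3 h2

lemma IsSolution.norm_sub_le {e : ℝ → ℝ} {ψ : ℝ → X} {D E : ℝ} (h : H.IsSolution T e ψ)
    (hD : ∀ t ∈ Icc 0 T, ∃ g, ψ t = H.R g ∧ ‖g‖ ≤ D) (hE : ∀ᵐ t ∂timeMeasure T, |e t| ≤ E)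
    {s t : ℝ} (hs : s ∈ Icc 0 T) (ht : t ∈ Icc 0 T) :
    ‖ψ t - ψ s‖ ≤ (‖H.S‖ + ‖H.V‖ * ‖H.R‖ + E * (‖H.M‖ * ‖H.R‖)) * D * |t - s| := by
  obtain ⟨-, dψ, hp, hψ⟩ := h
  exact hp.norm_sub_le (ae_norm_deriv_le hψ hD hE) hs ht

/-- A limit of solutions, for strongly converging controls, is a solution. -/
lemma isSolution_of_tendsto [CompleteSpace X] {en : ℕ → ℝ → ℝ} {ψn : ℕ → ℝ → X} {e : ℝ → ℝ}
    {ψ : ℝ → X} {D E : ℝ} (hsol : ∀ n, H.IsSolution T (en n) (ψn n))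
    (hD : ∀ n, ∀ t ∈ Icc 0 T, ∃ g, ψn n t = H.R g ∧ ‖g‖ ≤ D)
    (hE : ∀ n, ∀ᵐ t ∂timeMeasure T, |en n t| ≤ E) (hψc : ContinuousOn ψ (Icc 0 T))
    (hψ : ∀ t ∈ Icc 0 T, Tendsto (fun n => ψn n t) atTop (𝓝 (ψ t)))
    (hem : AEStronglyMeasurable e (timeMeasure T))
    (he : ∀ᵐ t ∂timeMeasure T, Tendsto (fun n => en n t) atTop (𝓝 (e t))) :
    H.IsSolution T e ψ := by
  have hdom : ∀ t, ∃ g, t ∈ Icc 0 T → ψ t = H.R g ∧ ‖g‖ ≤ D := by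
    intro t
    by_cases ht : t ∈ Icc 0 T
    · have hn : ∀ m, ‖H.L m (ψ t)‖ ≤ D := by
        intro m
        refine le_of_tendsto (((H.L m).continuous.tendsto _).comp (hψ t ht)).norm
          (Eventually.of_forall fun n => ?_)
        obtain ⟨g, hg, hgn⟩ := hD n t ht
        exact H.norm_L_le m hg hgn
      obtain ⟨g, hg⟩ := H.exists_of_norm_L_le hn
      exact ⟨g, fun _ => hg⟩
    · exact ⟨0, fun h => absurd h ht⟩
  choose g hg using hdom
  have heE : ∀ᵐ t ∂timeMeasure T, |e t| ≤ E := by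
    filter_upwards [ae_all_iff.2 hE, he] with t h1 h2
    exact le_of_tendsto h2.abs (Eventually.of_forall h1)
  let dψ : ℝ → X := fun t => -(Complex.I • (-H.S (g t) + H.V (ψ t) - (e t : ℂ) • H.M (ψ t)))
  have hIoo : ∀ᵐ t ∂timeMeasure T, t ∈ Icc 0 T :=
    (ae_restrict_mem measurableSet_Ioo).mono fun t ht => Ioo_subset_Icc_self ht
  have hψm : AEStronglyMeasurable ψ (timeMeasure T) :=
    (hψc.mono Ioo_subset_Icc_self).aestronglyMeasurable measurableSet_Ioo
  have hSm : AEStronglyMeasurable (fun t => H.S (g t)) (timeMeasure T) := by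
    -- The preimage `g t` is chosen pointwise, so measurability of `S (g t)` comes from writing it
    -- as the limit of `P n (S (g t)) = A n (ψ t)`.
    refine aestronglyMeasurable_of_tendsto_ae atTop (f := fun n t => H.A n (ψ t))
      (fun n => (H.A n).continuous.comp_aestronglyMeasurable hψm) ?_
    filter_upwards [hIoo] with t ht
    refine (H.tendsto_P (H.S (g t))).congr fun n => ?_
    rw [← H.A_R, ← (hg t ht).1]
  have hdm : AEStronglyMeasurable dψ (timeMeasure T) := by
    have h1 := H.V.continuous.comp_aestronglyMeasurable hψm
    have h2 := H.M.continuous.comp_aestronglyMeasurable hψm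
    have h3 := Complex.continuous_ofReal.comp_aestronglyMeasurable hem
    exact (((hSm.neg.add h1).sub (h3.smul h2)).const_smul Complex.I).neg
  have hdb : ∀ᵐ t ∂timeMeasure T,
      ‖dψ t‖ ≤ (‖H.S‖ + ‖H.V‖ * ‖H.R‖ + E * (‖H.M‖ * ‖H.R‖)) * D := by
    filter_upwards [hIoo, heE] with t ht h2
    rw [norm_neg, norm_smul, Complex.norm_I, one_mul]
    exact H.norm_rhs_le (hg t ht).1 (hg t ht).2 h2
  have hmem : MemLp dψ ∞ (timeMeasure T) := memLp_top_of_bound hdm _ hdb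
  refine ⟨⟨D, hIoo.mono fun t ht => ⟨g t, hg t ht⟩⟩, dψ, ⟨hmem, fun t ht => ?_⟩, ?_⟩
  · have h0 : (0 : ℝ) ∈ Icc 0 T := ⟨le_rfl, ht.1.trans ht.2⟩
    -- After applying `P m` the Laplacian becomes the bounded operator `A m`, so strong convergence
    -- in the ambient space is enough to pass to the limit under the integral. Letting `m → ∞` then
    -- removes the projection.
    have key : ∀ m, H.P m (ψ t) = H.P m (ψ 0 + ∫ s in (0 : ℝ)..t, dψ s) := by
      intro m
      choose dn hpn hdn using fun n => (hsol n).2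
      have hconv : Tendsto (fun n => ∫ s in (0 : ℝ)..t, H.P m (dn n s)) atTop
          (𝓝 (∫ s in (0 : ℝ)..t, H.P m (dψ s))) := by
        refine intervalIntegral.tendsto_integral_filter_of_dominated_convergence
          (fun _ => (‖H.S‖ + ‖H.V‖ * ‖H.R‖ + E * (‖H.M‖ * ‖H.R‖)) * D) ?_ ?_ ?_ ?_
        · refine Eventually.of_forall fun n => ?_
          exact (H.P m).continuous.comp_aestronglyMeasurable
            (intervalIntegrable_iff.1
              (intervalIntegrable_of_memLp_top h0 ht (hpn n).memLp)).aestronglyMeasurable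
        · refine Eventually.of_forall fun n => ?_
          filter_upwards [ae_uIoc_of_ae_timeMeasure h0 ht (ae_norm_deriv_le (hdn n) (hD n) (hE n))]
            with s hs hs'
          exact (H.norm_P_le m _).trans (hs hs')
        · exact intervalIntegrable_const
        · filter_upwards [ae_uIoc_of_ae_timeMeasure h0 ht (ae_all_iff.2 hdn),
            ae_uIoc_of_ae_timeMeasure h0 ht he, ae_uIoc_of_ae_timeMeasure h0 ht hIoo]
            with s h1 h2 h3 hs
          have hs3 := h3 hs
          have e1 : ∀ n, H.P m (dn n s) = -(Complex.I • (-H.A m (ψn n s) + H.P m (H.V (ψn n s))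
              - (en n s : ℂ) • H.P m (H.M (ψn n s)))) := by
            intro n
            obtain ⟨g', hg', h⟩ := h1 hs n
            rw [eq_neg_I_smul h]
            simp only [map_neg, map_smul, map_sub, map_add]
            rw [← H.A_R, ← hg']
          have e2 : H.P m (dψ s) = -(Complex.I • (-H.A m (ψ s) + H.P m (H.V (ψ s))
              - (e s : ℂ) • H.P m (H.M (ψ s)))) := by
            simp only [dψ, map_neg, map_smul, map_sub, map_add]
            rw [← H.A_R, ← (hg s hs3).1]
          simp only [e1]
          rw [e2]
          have t0 := hψ s hs3
          have t1 := ((H.A m).continuous.tendsto _).comp t0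
          have t2 := ((H.P m ∘L H.V).continuous.tendsto _).comp t0
          have t3 := ((H.P m ∘L H.M).continuous.tendsto _).comp t0
          have t4 := (Complex.continuous_ofReal.tendsto _).comp (h2 hs)
          exact (((t1.neg.add t2).sub (t4.smul t3)).const_smul Complex.I).neg
      have hcomm : ∀ f : ℝ → X, IntervalIntegrable f volume 0 t →
          ∫ s in (0 : ℝ)..t, H.P m (f s) = H.P m (∫ s in (0 : ℝ)..t, f s) := fun f hf =>
        ((H.P m).restrictScalars ℝ).intervalIntegral_comp_comm hf
      have hn : ∀ n, H.P m (ψn n t) - H.P m (ψn n 0) = ∫ s in (0 : ℝ)..t, H.P m (dn n s) := by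
        intro n
        rw [hcomm _ (intervalIntegrable_of_memLp_top h0 ht (hpn n).memLp), ← map_sub,
          (hpn n).sub_eq_integral h0 ht]
      have hL : Tendsto (fun n => H.P m (ψn n t) - H.P m (ψn n 0)) atTop
          (𝓝 (H.P m (ψ t) - H.P m (ψ 0))) :=
        (((H.P m).continuous.tendsto _).comp (hψ t ht)).sub
          (((H.P m).continuous.tendsto _).comp (hψ 0 h0))
      have := tendsto_nhds_unique hL (hconv.congr fun n => (hn n).symm)
      rw [hcomm _ (intervalIntegrable_of_memLp_top h0 ht hmem), sub_eq_iff_eq_add'] at this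
      rw [map_add, this]
    exact tendsto_nhds_unique (H.tendsto_P _) ((H.tendsto_P _).congr fun m => (key m).symm)
  · filter_upwards [hIoo] with t ht
    refine ⟨g t, (hg t ht).1, ?_⟩
    simp only [dψ]
    rw [smul_neg, smul_smul, Complex.I_mul_I, neg_one_smul, neg_neg]

end ControlledHamiltonian

/-! ### From convergence of averages to uniform convergence. -/

/-- Equi-Lipschitz functions whose integrals over intervals converge, converge uniformly. -/
lemma uniformCauchySeqOn_of_lipschitz {T Λ : ℝ} (hT : 0 < T) (hΛ : 0 ≤ Λ) {g : ℕ → ℝ → ℝ}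
    (hlip : ∀ n, ∀ s ∈ Icc 0 T, ∀ t ∈ Icc 0 T, |g n t - g n s| ≤ Λ * |t - s|)
    (hint : ∀ s ∈ Icc 0 T, ∀ t ∈ Icc 0 T, s ≤ t → CauchySeq fun n => ∫ r in s..t, g n r) :
    UniformCauchySeqOn g atTop (Icc 0 T) := by
  have hcont : ∀ n, ContinuousOn (g n) (Icc 0 T) := fun n => by
    have : LipschitzOnWith ⟨Λ, hΛ⟩ (g n) (Icc 0 T) :=
      LipschitzOnWith.of_dist_le_mul fun x hx y hy => by
        rw [Real.dist_eq, Real.dist_eq]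
        exact hlip n y hy x hx
    exact this.continuousOn
  have hpt : ∀ t ∈ Icc 0 T, CauchySeq fun n => g n t := by
    intro t ht
    rw [Metric.cauchySeq_iff]
    intro ε hε
    -- The value at `t` is compared with the average over a window of length `h` containing `t`. For
    -- a difference of two members the error is at most `2Λh`, and starting the window at `min t (T
    -- - h)` keeps it inside `[0, T]`.
    obtain ⟨h, hh0, hhT, hhΛ⟩ : ∃ h, 0 < h ∧ h ≤ T ∧ 2 * Λ * h ≤ ε / 2 := by
      refine ⟨min T (ε / (4 * (Λ + 1))), lt_min hT (by positivity), min_le_left _ _, ?_⟩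
      calc 2 * Λ * min T (ε / (4 * (Λ + 1))) ≤ 2 * (Λ + 1) * (ε / (4 * (Λ + 1))) :=
            mul_le_mul (by linarith) (min_le_right _ _) (by positivity) (by positivity)
        _ = ε / 2 := by field_simp; norm_num
    have ha : min t (T - h) ∈ Icc 0 T :=
      ⟨le_min ht.1 (by linarith), (min_le_left _ _).trans ht.2⟩
    have hb : min t (T - h) + h ∈ Icc 0 T :=
      ⟨by linarith [ha.1], by linarith [min_le_right t (T - h)]⟩
    set a := min t (T - h) with hadef
    have hta : a ≤ t := min_le_left _ _
    have htb : t ≤ a + h := by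
      rw [hadef, ← min_add_add_right]
      exact le_min (by linarith) (by linarith [ht.2])
    obtain ⟨N, hN⟩ := Metric.cauchySeq_iff.1 (hint a ha (a + h) hb (by linarith)) (h * (ε / 2)) (by positivity)
    refine ⟨N, fun m hm n hn => ?_⟩
    have h1 := hN m hm n hn
    rw [Real.dist_eq] at h1 ⊢
    have hsub : uIcc a (a + h) ⊆ Icc 0 T := by
      rw [uIcc_of_le (by linarith)]
      exact Icc_subset_Icc ha.1 hb.2
    have hii : ∀ n, IntervalIntegrable (g n) volume a (a + h) := fun n =>
      ((hcont n).mono hsub).intervalIntegrable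
    have h2 : |(∫ r in a..(a + h), g m r) - (∫ r in a..(a + h), g n r)
        - h * (g m t - g n t)| ≤ 2 * Λ * h * h := by
      have e : (∫ r in a..(a + h), g m r) - (∫ r in a..(a + h), g n r) - h * (g m t - g n t)
          = ∫ r in a..(a + h), ((g m r - g n r) - (g m t - g n t)) := by
        rw [intervalIntegral.integral_sub ((hii m).sub (hii n)) intervalIntegrable_const,
          intervalIntegral.integral_sub (hii m) (hii n), intervalIntegral.integral_const]
        simp
      rw [e, ← Real.norm_eq_abs]
      refine (intervalIntegral.norm_integral_le_of_norm_le_const (C := 2 * Λ * h)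
        fun r hr => ?_).trans_eq ?_
      · rw [uIoc_of_le (by linarith)] at hr
        have hr' : r ∈ Icc 0 T := hsub (by
          rw [uIcc_of_le (by linarith)]
          exact Ioc_subset_Icc_self hr)
        have hrt : |r - t| ≤ h := abs_le.2 ⟨by linarith [hr.1], by linarith [hr.2]⟩
        have l1 := hlip m t ht r hr'
        have l2 := hlip n t ht r hr'
        have e2 : g m r - g n r - (g m t - g n t) = (g m r - g m t) - (g n r - g n t) := by ring
        rw [e2, Real.norm_eq_abs]
        refine (abs_sub _ _).trans ?_
        nlinarith [mul_le_mul_of_nonneg_left hrt hΛ]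
      · rw [add_sub_cancel_left, abs_of_pos hh0]
    have h3 : h * |g m t - g n t| < h * ε := by
      rw [← abs_of_pos hh0, ← abs_mul, abs_of_pos hh0]
      have := abs_sub_abs_le_abs_sub (h * (g m t - g n t))
        ((∫ r in a..(a + h), g m r) - (∫ r in a..(a + h), g n r))
      rw [abs_sub_comm (h * (g m t - g n t))] at this
      nlinarith [mul_le_mul_of_nonneg_right hhΛ hh0.le]
    exact lt_of_mul_lt_mul_left h3 hh0.le
  rw [Metric.uniformCauchySeqOn_iff]
  intro ε hε
  -- On a net of this mesh the Lipschitz bound costs at most `ε/4` for each of the two functions, so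
  -- pointwise Cauchy at finitely many points suffices.
  obtain ⟨s, hsT, hsf, hs⟩ := finite_cover_balls_of_compact (isCompact_Icc (a := (0 : ℝ)) (b := T))
    (e := ε / (4 * (Λ + 1))) (by positivity)
  have hN : ∀ᶠ N in atTop, ∀ x ∈ s, ∀ m ≥ N, ∀ n ≥ N, dist (g m x) (g n x) < ε / 4 := by
    rw [eventually_all_finite hsf]
    intro x hx
    obtain ⟨N, hN⟩ := Metric.cauchySeq_iff.1 (hpt x (hsT hx)) (ε / 4) (by positivity)
    filter_upwards [eventually_ge_atTop N] with N' hN' m hm n hn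
    exact hN m (hN'.trans hm) n (hN'.trans hn)
  obtain ⟨N, hN⟩ := hN.exists
  refine ⟨N, fun m hm n hn t ht => ?_⟩
  obtain ⟨x, hx, htx⟩ : ∃ x ∈ s, dist t x < ε / (4 * (Λ + 1)) := by
    simpa using hs ht
  have h1 := hN x hx m hm n hn
  have h4 : Λ * |t - x| ≤ ε / 4 := by
    rw [Real.dist_eq] at htx
    calc Λ * |t - x| ≤ (Λ + 1) * (ε / (4 * (Λ + 1))) :=
          mul_le_mul (by linarith) htx.le (abs_nonneg _) (by positivity)
      _ = ε / 4 := by field_simp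
  have h2 := (hlip m x (hsT hx) t ht).trans h4
  have h3 := (hlip n x (hsT hx) t ht).trans h4
  rw [Real.dist_eq] at h1 ⊢
  rw [abs_lt] at h1 ⊢
  rw [abs_le] at h2 h3
  constructor <;> linarith [h1.1, h1.2, h2.1, h2.2, h3.1, h3.2]

end QControl

/-! ### The Schrödinger equation as an instance of the abstract dynamics. -/

namespace QControl

/-- The Hamiltonian `-Δ + V` on `L²(ℝ³)`, coupled to the control through `μ`. -/
lemma exists_controlledHamiltonian {V μ : Space → ℝ} (hV : MemW2Infty V) (hμ : MemW2Infty μ) :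
    ∃ H : ControlledHamiltonian L2, H.toSpectralFrame = laplaceFrame ∧ H.V = mulOp V hV.1 ∧
      H.M = mulOp μ hμ.1 := by
  obtain ⟨BV, hBV⟩ := hV.exists_conj hV.1
  obtain ⟨BM, hBM⟩ := hμ.exists_conj hμ.1
  exact ⟨{ laplaceFrame with
    V := mulOp V hV.1
    M := mulOp μ hμ.1
    BV := BV
    BM := BM
    inner_V := inner_mulOp V hV.1
    inner_M := inner_mulOp μ hμ.1
    V_R := hBV
    M_R := hBM }, rfl, rfl, rfl⟩

/-- An `L²` function is determined by its tempered distribution, so the `L²` Laplacian of `R g` can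
only be `S g`. -/
lemma isHamiltonianApply_iff {V μ : Space → ℝ} (hV : MemLp V ∞ volume) (hμ : MemLp μ ∞ volume)
    (a : ℝ) (g h : L2) :
    IsHamiltonianApply V μ a (laplaceFrame.R g) h ↔
      h = -laplaceFrame.S g + mulOp V hV (laplaceFrame.R g)
        - (a : ℂ) • mulOp μ hμ (laplaceFrame.R g) := by
  have hae : (-laplaceFrame.S g + mulOp V hV (laplaceFrame.R g)
        - (a : ℂ) • mulOp μ hμ (laplaceFrame.R g) : L2) =ᵐ[volume]
      fun x => -laplaceFrame.S g x + (V x : ℂ) * laplaceFrame.R g x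
        - (a : ℂ) * (μ x : ℂ) * laplaceFrame.R g x := by
    filter_upwards [Lp.coeFn_sub (-laplaceFrame.S g + mulOp V hV (laplaceFrame.R g))
      ((a : ℂ) • mulOp μ hμ (laplaceFrame.R g)),
      Lp.coeFn_add (-laplaceFrame.S g) (mulOp V hV (laplaceFrame.R g)),
      Lp.coeFn_neg (laplaceFrame.S g), mulOp_coeFn V hV (laplaceFrame.R g),
      mulOp_coeFn μ hμ (laplaceFrame.R g),
      Lp.coeFn_smul (a : ℂ) (mulOp μ hμ (laplaceFrame.R g))] with x h1 h2 h3 h4 h5 h6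
    rw [h1, Pi.sub_apply, h2, Pi.add_apply, h3, Pi.neg_apply, h4, h6, Pi.smul_apply, h5,
      smul_eq_mul, mul_assoc]
  constructor
  · rintro ⟨lap, hlap, hx⟩
    rw [laplacian_R] at hlap
    obtain rfl : laplaceFrame.S g = lap := toTemperedDistribution_injective hlap
    exact Lp.ext (Filter.EventuallyEq.trans hx hae.symm)
  · rintro rfl
    exact ⟨laplaceFrame.S g, laplacian_R g, hae⟩

lemma isSchrodingerSolution_iff {T : ℝ} {V μ : Space → ℝ} (hV : MemLp V ∞ volume)
    (hμ : MemLp μ ∞ volume) {H : ControlledHamiltonian L2} (hF : H.toSpectralFrame = laplaceFrame)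
    (hHV : H.V = mulOp V hV) (hHM : H.M = mulOp μ hμ) (e : Control T) (ψ : ℝ → L2) :
    IsSchrodingerSolution T V μ e ψ ↔ H.IsSolution T e ψ := by
  unfold IsSchrodingerSolution ControlledHamiltonian.IsSolution
  simp only [H2NormLE_iff, hF, hHV, hHM]
  refine and_congr_right fun ⟨C, hC⟩ => exists_congr fun dψ => ?_
  rw [← and_assoc]
  refine and_congr ⟨fun h => ⟨h.1, h.2⟩, fun h => ⟨h.1, h.2⟩⟩ ?_
  refine eventually_congr ?_
  filter_upwards [hC] with t ⟨g, hg, _⟩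
  constructor
  · intro h
    refine ⟨g, hg, ?_⟩
    rw [hg] at h ⊢
    exact (isHamiltonianApply_iff hV hμ _ _ _).1 h
  · rintro ⟨g', hg', h⟩
    rw [hg'] at h ⊢
    exact (isHamiltonianApply_iff hV hμ _ _ _).2 h

end QControl

/-! ### The abstract scheme: uniform bounds and monotonicity. -/

namespace QControl

lemma tendsto_zero_of_le_mul_add {ρ : ℝ} (hρ0 : 0 ≤ ρ) (hρ1 : ρ < 1) {u r : ℕ → ℝ}
    (hu : ∀ k, 0 ≤ u k) (h : ∀ k, u (k + 1) ≤ ρ * u k + r k) (hr : Tendsto r atTop (𝓝 0)) :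
    Tendsto u atTop (𝓝 0) := by
  rw [Metric.tendsto_atTop]
  intro ε hε
  -- Once the errors are below `(1 - ρ) ε/2`, the level `ε/2` is preserved by the recursion and the
  -- excess above it decays like `ρ^j`.
  have hε' : 0 < (1 - ρ) * (ε / 2) := mul_pos (by linarith) (by positivity)
  obtain ⟨N, hN⟩ := eventually_atTop.1 (hr.eventually_lt_const hε')
  have key : ∀ j, u (N + j) ≤ ρ ^ j * u N + ε / 2 := by
    intro j
    induction j with
    | zero => simp; linarith
    | succ j ih =>
      have h1 := h (N + j)
      have h2 := (hN (N + j) (by omega)).le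
      have h3 := mul_le_mul_of_nonneg_left ih hρ0
      rw [← add_assoc, pow_succ]
      nlinarith
  have hp : Tendsto (fun j => ρ ^ j * u N) atTop (𝓝 0) := by
    simpa using (tendsto_pow_atTop_nhds_zero_of_lt_one hρ0 hρ1).mul_const (u N)
  obtain ⟨M, hM⟩ := eventually_atTop.1 (hp.eventually_lt_const (half_pos hε))
  refine ⟨N + M, fun n hn => ?_⟩
  obtain ⟨j, rfl⟩ := Nat.exists_eq_add_of_le ((Nat.le_add_right N M).trans hn)
  rw [Real.dist_eq, sub_zero, abs_of_nonneg (hu _)]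
  linarith [key j, hM j (by omega)]

/-- `J` is monotone and bounded above, hence convergent, so its increments vanish and dominate `a`
and `b`. -/
lemma tendsto_zero_of_increments {J a b : ℕ → ℝ} {c c' B : ℝ} (hc : 0 < c) (hc' : 0 < c')
    (ha : ∀ k, 0 ≤ a k) (hb : ∀ k, 0 ≤ b k) (h : ∀ k, c * a k + c' * b k ≤ J (k + 1) - J k)
    (hJ : ∀ k, J k ≤ B) : Tendsto a atTop (𝓝 0) ∧ Tendsto b atTop (𝓝 0) := by
  have hmono : Monotone J := monotone_nat_of_le_succ fun k => by
    have := h k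
    have := mul_nonneg hc.le (ha k)
    have := mul_nonneg hc'.le (hb k)
    linarith
  have hlim := tendsto_atTop_ciSup hmono ⟨B, by rintro _ ⟨k, rfl⟩; exact hJ k⟩
  have hd := (hlim.comp (tendsto_add_atTop_nat 1)).sub hlim
  rw [sub_self] at hd
  constructor
  · refine squeeze_zero ha (fun k => ?_) (by simpa using hd.const_mul c⁻¹)
    have h1 := h k
    have h2 := mul_nonneg hc'.le (hb k)
    rw [inv_mul_eq_div, le_div_iff₀ hc, mul_comm]
    change c * a k ≤ J (k + 1) - J k
    linarith
  · refine squeeze_zero hb (fun k => ?_) (by simpa using hd.const_mul c'⁻¹)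
    have h1 := h k
    have h2 := mul_nonneg hc.le (ha k)
    rw [inv_mul_eq_div, le_div_iff₀ hc', mul_comm]
    change c' * b k ≤ J (k + 1) - J k
    linarith

lemma integral_abs_sq_le {T : ℝ} (hT : 0 < T) {f : ℝ → ℝ} (hf : MemLp f ∞ (timeMeasure T)) :
    (∫ t, |f t| ∂timeMeasure T) ^ 2 ≤ T * ∫ t, f t ^ 2 ∂timeMeasure T := by
  have h1 : Integrable (fun t => |f t|) (timeMeasure T) := (hf.integrable le_top).abs
  have h2 : Integrable (fun t => f t ^ 2) (timeMeasure T) :=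
    (memLp_two_iff_integrable_sq hf.1).1 (hf.mono_exponent le_top)
  set b := ∫ t, |f t| ∂timeMeasure T
  -- Cauchy–Schwarz from the nonnegative variance of `|f|` about its mean `b / T`.
  have h3 : 0 ≤ ∫ t, (|f t| - b / T) ^ 2 ∂timeMeasure T := integral_nonneg fun t => sq_nonneg _
  have h4 : ∫ t, (|f t| - b / T) ^ 2 ∂timeMeasure T
      = (∫ t, f t ^ 2 ∂timeMeasure T) - 2 * (b / T) * b + (b / T) ^ 2 * T := by
    have e : ∀ t, (|f t| - b / T) ^ 2 = f t ^ 2 - 2 * (b / T) * |f t| + (b / T) ^ 2 := by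
      intro t
      rw [sub_sq, sq_abs]
      ring
    simp only [e]
    have h12 : Integrable (fun t => f t ^ 2 - 2 * (b / T) * |f t|) (timeMeasure T) :=
      h2.sub (h1.const_mul _)
    rw [integral_add h12 (integrable_const _), integral_sub h2 (h1.const_mul _),
      integral_const_mul, integral_const]
    simp [hT.le, mul_comm, b]
  rw [h4] at h3
  have h5 : (∫ t, f t ^ 2 ∂timeMeasure T) - 2 * (b / T) * b + (b / T) ^ 2 * T
      = (∫ t, f t ^ 2 ∂timeMeasure T) - b ^ 2 / T := by
    field_simp
    ring
  rw [h5, sub_nonneg, div_le_iff₀ hT] at h3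
  linarith

variable {X : Type*} [NormedAddCommGroup X] [InnerProductSpace ℂ X]

/-- The monotonic scheme for an abstract Hamiltonian. -/
structure IsScheme (H : ControlledHamiltonian X) (T α δ η : ℝ) (O : X →L[ℂ] X) (ψ₀ : X)
    (e e' : ℕ → ℝ → ℝ) (ψ χ : ℕ → ℝ → X) : Prop where
  field_zero : MemLp (e 0) ∞ (timeMeasure T)
  field'_zero : MemLp (e' 0) ∞ (timeMeasure T)
  field_meas : ∀ k, AEStronglyMeasurable (e k) (timeMeasure T)
  field'_meas : ∀ k, AEStronglyMeasurable (e' k) (timeMeasure T)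
  state : ∀ k, H.IsSolution T (e k) (ψ k)
  state_init : ∀ k, ψ k 0 = ψ₀
  adjoint_zero : H.IsSolution T (e 0) (χ 0) ∨ H.IsSolution T (e' 0) (χ 0)
  adjoint_succ : ∀ k, H.IsSolution T (e' (k + 1)) (χ (k + 1))
  adjoint_final : ∀ k, χ k T = O (ψ k T)
  field_succ : ∀ k, ∀ᵐ t ∂timeMeasure T, e (k + 1) t
    = (1 - δ) * e' k t - δ / α * (inner ℂ (χ k t) (H.M (ψ (k + 1) t)) : ℂ).im
  field'_succ : ∀ k, ∀ᵐ t ∂timeMeasure T, e' (k + 1) t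
    = (1 - η) * e (k + 1) t - η / α * (inner ℂ (χ (k + 1) t) (H.M (ψ (k + 1) t)) : ℂ).im

namespace IsScheme

variable {H : ControlledHamiltonian X} {T α δ η : ℝ} {O : X →L[ℂ] X} {ψ₀ : X}
  {e e' : ℕ → ℝ → ℝ} {ψ χ : ℕ → ℝ → X}

/-- The bounds on adjoint states only need some controlled driving field; this covers both
admissible choices for the initial one. -/
lemma exists_adjoint_field (h : IsScheme H T α δ η O ψ₀ e e' ψ χ) (k : ℕ) :
    ∃ c, H.IsSolution T c (χ k) ∧ (c = e k ∨ c = e' k) := by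
  cases k with
  | zero =>
    rcases h.adjoint_zero with h0 | h0
    · exact ⟨_, h0, Or.inl rfl⟩
    · exact ⟨_, h0, Or.inr rfl⟩
  | succ k => exact ⟨_, h.adjoint_succ k, Or.inr rfl⟩

variable [CompleteSpace X]

lemma norm_state (h : IsScheme H T α δ η O ψ₀ e e' ψ χ) (hψ₀ : ‖ψ₀‖ = 1) (k : ℕ) {t : ℝ}
    (ht : t ∈ Icc 0 T) : ‖ψ k t‖ = 1 := by
  rw [(h.state k).norm_eq ⟨le_rfl, ht.1.trans ht.2⟩ ht, h.state_init, hψ₀]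

lemma norm_adjoint_le (h : IsScheme H T α δ η O ψ₀ e e' ψ χ) (hψ₀ : ‖ψ₀‖ = 1) (k : ℕ) {t : ℝ}
    (ht : t ∈ Icc 0 T) : ‖χ k t‖ ≤ ‖O‖ := by
  have hT : T ∈ Icc 0 T := ⟨ht.1.trans ht.2, le_rfl⟩
  obtain ⟨c, hc, -⟩ := h.exists_adjoint_field k
  rw [hc.norm_eq hT ht, h.adjoint_final]
  refine (O.le_opNorm _).trans ?_
  rw [h.norm_state hψ₀ k hT, mul_one]

lemma abs_im_inner_le (h : IsScheme H T α δ η O ψ₀ e e' ψ χ) (hψ₀ : ‖ψ₀‖ = 1) (k j : ℕ) {t : ℝ}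
    (ht : t ∈ Icc 0 T) : |(inner ℂ (χ k t) (H.M (ψ j t)) : ℂ).im| ≤ ‖O‖ * ‖H.M‖ := by
  refine (Complex.abs_im_le_norm _).trans ((norm_inner_le_norm _ _).trans ?_)
  refine mul_le_mul (h.norm_adjoint_le hψ₀ k ht) ?_ (norm_nonneg _) (norm_nonneg _)
  refine (H.M.le_opNorm _).trans ?_
  rw [h.norm_state hψ₀ j ht, mul_one]

/-- For `δ ∈ (0, 2)` the relaxation factor satisfies `|1 - δ| < 1`, and `δ q / (1 - |1 - δ|)` is the
fixed point of `E ↦ |1 - δ| E + δ q`. Any `E` above it bounds an invariant interval. -/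
lemma relaxation_le {δ q E a p : ℝ} (hδ : δ ∈ Ioo (0 : ℝ) 2)
    (hE : δ * q / (1 - |1 - δ|) ≤ E) (ha : |a| ≤ E) (hp : |p| ≤ q) :
    |(1 - δ) * a - δ * p| ≤ E := by
  have h1 : |1 - δ| < 1 := abs_lt.2 ⟨by linarith [hδ.2], by linarith [hδ.1]⟩
  rw [div_le_iff₀ (by linarith)] at hE
  refine (abs_sub _ _).trans ?_
  rw [abs_mul, abs_mul, abs_of_pos hδ.1]
  have := mul_le_mul_of_nonneg_left ha (abs_nonneg (1 - δ))
  have := mul_le_mul_of_nonneg_left hp hδ.1.le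
  linarith

lemma exists_field_bound (h : IsScheme H T α δ η O ψ₀ e e' ψ χ) (hψ₀ : ‖ψ₀‖ = 1) (hα : 0 < α)
    (hδ : δ ∈ Ioo (0 : ℝ) 2) (hη : η ∈ Ioo (0 : ℝ) 2) :
    ∃ E, 0 ≤ E ∧ ∀ k, (∀ᵐ t ∂timeMeasure T, |e k t| ≤ E) ∧ ∀ᵐ t ∂timeMeasure T, |e' k t| ≤ E := by
  obtain ⟨E₁, hE₁0, hE₁⟩ := exists_ae_norm_le h.field_zero
  obtain ⟨E₂, hE₂0, hE₂⟩ := exists_ae_norm_le h.field'_zero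
  let q := ‖O‖ * ‖H.M‖ / α
  let E := max (max E₁ E₂) (max (δ * q / (1 - |1 - δ|)) (η * q / (1 - |1 - η|)))
  have hq : ∀ k j, ∀ᵐ t ∂timeMeasure T,
      |(inner ℂ (χ k t) (H.M (ψ j t)) : ℂ).im / α| ≤ q := by
    intro k j
    filter_upwards [ae_restrict_mem measurableSet_Ioo] with t ht
    rw [abs_div, abs_of_pos hα]
    exact div_le_div_of_nonneg_right (h.abs_im_inner_le hψ₀ k j (Ioo_subset_Icc_self ht)) hα.le
  refine ⟨E, hE₁0.trans ((le_max_left _ _).trans (le_max_left _ _)), fun k => ?_⟩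
  induction k with
  | zero =>
    exact ⟨hE₁.mono fun t ht => ht.trans ((le_max_left _ _).trans (le_max_left _ _)),
      hE₂.mono fun t ht => ht.trans ((le_max_right _ _).trans (le_max_left _ _))⟩
  | succ k ih =>
    have h1 : ∀ᵐ t ∂timeMeasure T, |e (k + 1) t| ≤ E := by
      filter_upwards [h.field_succ k, ih.2, hq k (k + 1)] with t h1 h2 h3
      rw [h1, div_mul_eq_mul_div, mul_div_assoc]
      exact relaxation_le hδ ((le_max_left _ _).trans (le_max_right _ _)) h2 h3
    refine ⟨h1, ?_⟩
    filter_upwards [h.field'_succ k, h1, hq (k + 1) (k + 1)] with t h1 h2 h3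
    rw [h1, div_mul_eq_mul_div, mul_div_assoc]
    exact relaxation_le hη ((le_max_right _ _).trans (le_max_right _ _)) h2 h3

lemma exists_domain_bound (h : IsScheme H T α δ η O ψ₀ e e' ψ χ) (hT : 0 ≤ T) {E : ℝ} (hE : 0 ≤ E)
    (hb : ∀ k, (∀ᵐ t ∂timeMeasure T, |e k t| ≤ E) ∧ ∀ᵐ t ∂timeMeasure T, |e' k t| ≤ E)
    (hψ₀ : ∃ g, ψ₀ = H.R g) {B : X →L[ℂ] X} (hB : ∀ g, O (H.R g) = H.R (B g)) :
    ∃ D, ∀ k, ∀ t ∈ Icc 0 T, (∃ g, ψ k t = H.R g ∧ ‖g‖ ≤ D) ∧ ∃ g, χ k t = H.R g ∧ ‖g‖ ≤ D := by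
  obtain ⟨g₀, hg₀⟩ := hψ₀
  have h0 : (0 : ℝ) ∈ Icc 0 T := ⟨le_rfl, hT⟩
  have hTm : T ∈ Icc 0 T := ⟨hT, le_rfl⟩
  let c := Real.exp (4 * (‖H.BV‖ + E * ‖H.BM‖) * T)
  have hc : ∀ r ≤ T, Real.exp (4 * (‖H.BV‖ + E * ‖H.BM‖) * r) ≤ c := fun r hr =>
    Real.exp_le_exp.2 (mul_le_mul_of_nonneg_left hr (by positivity))
  let D₁ := √(2 * ‖g₀‖ ^ 2 * c)
  let D₂ := √(2 * (‖B‖ * D₁) ^ 2 * c)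
  have h1 : ∀ k, ∀ t ∈ Icc 0 T, ∃ g, ψ k t = H.R g ∧ ‖g‖ ≤ D₁ := by
    intro k t ht
    obtain ⟨g, hg, hgn⟩ := (h.state k).exists_bound hE (hb k).1 h0 ((h.state_init k).trans hg₀)
      (one_mul 1) (fun t ht => by linarith [ht.1]) ht
    refine ⟨g, hg, Real.le_sqrt_of_sq_le (hgn.trans ?_)⟩
    exact mul_le_mul_of_nonneg_left (hc _ (by linarith [ht.2])) (by positivity)
  have h2 : ∀ k, ∀ t ∈ Icc 0 T, ∃ g, χ k t = H.R g ∧ ‖g‖ ≤ D₂ := by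
    intro k t ht
    obtain ⟨f, hf, hcf⟩ := h.exists_adjoint_field k
    have hfE : ∀ᵐ t ∂timeMeasure T, |f t| ≤ E := by
      rcases hcf with rfl | rfl
      · exact (hb k).1
      · exact (hb k).2
    obtain ⟨g₁, hg₁, hgn₁⟩ := h1 k T hTm
    -- The final condition transfers the domain bound of the state through `O` by its conjugate `B`;
    -- the estimate then runs backward from `T`.
    have hend : χ k T = H.R (B g₁) := by rw [h.adjoint_final, hg₁, hB]
    obtain ⟨g, hg, hgn⟩ := hf.exists_bound hE hfE hTm hend (σ := -1) (by norm_num)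
      (fun t ht => by linarith [ht.2]) ht
    refine ⟨g, hg, Real.le_sqrt_of_sq_le (hgn.trans ?_)⟩
    refine mul_le_mul ?_ (hc _ (by linarith [ht.1])) (Real.exp_pos _).le (by positivity)
    exact mul_le_mul_of_nonneg_left (pow_le_pow_left₀ (norm_nonneg _) (B.le_opNorm_of_le hgn₁) 2)
      zero_le_two
  refine ⟨max D₁ D₂, fun k t ht => ⟨?_, ?_⟩⟩
  · obtain ⟨g, hg, hgn⟩ := h1 k t ht
    exact ⟨g, hg, hgn.trans (le_max_left _ _)⟩
  · obtain ⟨g, hg, hgn⟩ := h2 k t ht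
    exact ⟨g, hg, hgn.trans (le_max_right _ _)⟩

lemma integral_timeMeasure {T : ℝ} (hT : 0 ≤ T) (f : ℝ → ℂ) :
    ∫ r in (0 : ℝ)..T, f r = ∫ r, f r ∂timeMeasure T := by
  rw [intervalIntegral.integral_of_le hT, integral_Ioc_eq_integral_Ioo]

/-- The functional increases along the scheme. -/
lemma functional_increment (h : IsScheme H T α δ η O ψ₀ e e' ψ χ) (hT : 0 ≤ T) (hα : 0 < α)
    (hδ : δ ≠ 0) (hη : η ≠ 0) (hO : O.IsPositive) (hψ₀ : ‖ψ₀‖ = 1)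
    (hm : ∀ k, MemLp (e k) ∞ (timeMeasure T) ∧ MemLp (e' k) ∞ (timeMeasure T)) (k : ℕ) :
    α * (2 / δ - 1) * ∫ t, (e (k + 2) t - e' (k + 1) t) ^ 2 ∂timeMeasure T
      + α * (2 / η - 1) * ∫ t, (e (k + 1) t - e' (k + 1) t) ^ 2 ∂timeMeasure T
    ≤ (RCLike.re (inner ℂ (ψ (k + 2) T) (O (ψ (k + 2) T)))
        - α * ∫ t, e (k + 2) t ^ 2 ∂timeMeasure T)
      - (RCLike.re (inner ℂ (ψ (k + 1) T) (O (ψ (k + 1) T)))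
        - α * ∫ t, e (k + 1) t ^ 2 ∂timeMeasure T) := by
  have h0 : (0 : ℝ) ∈ Icc 0 T := ⟨le_rfl, hT⟩
  have hTm : T ∈ Icc 0 T := ⟨hT, le_rfl⟩
  -- Used for `j = k + 1` and `j = k + 2`: the two pairings have the same value at time `0` because
  -- the states share their initial datum, so it drops out of their difference. Index `k + 1`
  -- ensures that the adjoint state is driven by a field given by the update rule.
  have pair : ∀ j, RCLike.re (inner ℂ (O (ψ (k + 1) T)) (ψ j T) : ℂ)
      - RCLike.re (inner ℂ (χ (k + 1) 0) ψ₀ : ℂ)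
      = ∫ t, -((e j t - e' (k + 1) t) * (inner ℂ (χ (k + 1) t) (H.M (ψ j t)) : ℂ).im)
        ∂timeMeasure T := by
    intro j
    have h1 := (h.state j).inner_sub_eq_integral (h.adjoint_succ k) h0 hTm
    rw [h.adjoint_final, h.state_init, integral_timeMeasure hT] at h1
    have hint : Integrable (fun r => Complex.I * (e j r - e' (k + 1) r : ℝ) *
        inner ℂ (χ (k + 1) r) (H.M (ψ j r))) (timeMeasure T) := by
      have hsub := ((hm j).1.sub (hm (k + 1)).2).integrable le_top
      have hc := ((h.adjoint_succ k).continuousOn.mono Ioo_subset_Icc_self).aestronglyMeasurable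
        (μ := volume) measurableSet_Ioo
      have hs := ((h.state j).continuousOn.mono Ioo_subset_Icc_self).aestronglyMeasurable
        (μ := volume) measurableSet_Ioo
      refine (hsub.ofReal.const_mul Complex.I).mul_bdd (c := ‖O‖ * ‖H.M‖)
        (hc.inner (H.M.continuous.comp_aestronglyMeasurable hs)) ?_
      filter_upwards [ae_restrict_mem measurableSet_Ioo] with t ht
      refine (norm_inner_le_norm _ _).trans (mul_le_mul
        (h.norm_adjoint_le hψ₀ _ (Ioo_subset_Icc_self ht)) ?_ (norm_nonneg _) (norm_nonneg _))
      refine (H.M.le_opNorm _).trans ?_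
      rw [h.norm_state hψ₀ j (Ioo_subset_Icc_self ht), mul_one]
    rw [← map_sub, h1, ← integral_re hint]
    congr 1
    ext r
    simp
  have p1 := pair (k + 1)
  have p2 := pair (k + 2)
  have e1 : ∫ t, -((e (k + 1) t - e' (k + 1) t) *
      (inner ℂ (χ (k + 1) t) (H.M (ψ (k + 1) t)) : ℂ).im) ∂timeMeasure T
      = ∫ t, (-(α / η) * (e (k + 1) t - e' (k + 1) t) ^ 2
        + α * ((e (k + 1) t - e' (k + 1) t) * e (k + 1) t)) ∂timeMeasure T := by
    apply integral_congr_ae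
    filter_upwards [h.field'_succ k] with t ht
    rw [ht]
    field_simp
    ring
  have e2 : ∫ t, -((e (k + 2) t - e' (k + 1) t) *
      (inner ℂ (χ (k + 1) t) (H.M (ψ (k + 2) t)) : ℂ).im) ∂timeMeasure T
      = ∫ t, (α / δ * (e (k + 2) t - e' (k + 1) t) ^ 2
        + α * ((e (k + 2) t - e' (k + 1) t) * e' (k + 1) t)) ∂timeMeasure T := by
    apply integral_congr_ae
    filter_upwards [h.field_succ (k + 1)] with t ht
    rw [ht]
    field_simp
    ring
  have hprod : ∀ f g : ℝ → ℝ, MemLp f ∞ (timeMeasure T) → MemLp g ∞ (timeMeasure T) →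
      Integrable (fun t => f t * g t) (timeMeasure T) := by
    intro f g hf hg
    have hf2 : MemLp f 2 (timeMeasure T) := hf.mono_exponent le_top
    have hg2 : MemLp g 2 (timeMeasure T) := hg.mono_exponent le_top
    exact hf2.integrable_mul hg2
  have a1 := (hm (k + 1)).1
  have a2 := (hm (k + 2)).1
  have a3 := (hm (k + 1)).2
  have hsq : ∀ f : ℝ → ℝ, MemLp f ∞ (timeMeasure T) →
      Integrable (fun t => f t ^ 2) (timeMeasure T) := by
    intro f hf
    simpa only [sq] using hprod f f hf hf
  have i1 : Integrable (fun t => e (k + 1) t ^ 2) (timeMeasure T) := hsq _ a1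
  have i2 : Integrable (fun t => e (k + 2) t ^ 2) (timeMeasure T) := hsq _ a2
  have i3 : Integrable (fun t => (e (k + 1) t - e' (k + 1) t) ^ 2) (timeMeasure T) :=
    hsq (fun t => e (k + 1) t - e' (k + 1) t) (a1.sub a3)
  have i4 : Integrable (fun t => (e (k + 2) t - e' (k + 1) t) ^ 2) (timeMeasure T) :=
    hsq (fun t => e (k + 2) t - e' (k + 1) t) (a2.sub a3)
  have i5 : Integrable (fun t => (e (k + 1) t - e' (k + 1) t) * e (k + 1) t) (timeMeasure T) :=
    hprod _ _ (a1.sub a3) a1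
  have i6 : Integrable (fun t => (e (k + 2) t - e' (k + 1) t) * e' (k + 1) t) (timeMeasure T) :=
    hprod _ _ (a2.sub a3) a3
  have i21 : Integrable (fun t => e (k + 2) t ^ 2 - e (k + 1) t ^ 2) (timeMeasure T) := i2.sub i1
  have i214 : Integrable (fun t => e (k + 2) t ^ 2 - e (k + 1) t ^ 2
      - (e (k + 2) t - e' (k + 1) t) ^ 2) (timeMeasure T) := i21.sub i4
  have combo : 2 * (∫ t, (e (k + 2) t - e' (k + 1) t) * e' (k + 1) t ∂timeMeasure T)
      - 2 * (∫ t, (e (k + 1) t - e' (k + 1) t) * e (k + 1) t ∂timeMeasure T)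
      = (∫ t, e (k + 2) t ^ 2 ∂timeMeasure T) - (∫ t, e (k + 1) t ^ 2 ∂timeMeasure T)
        - (∫ t, (e (k + 2) t - e' (k + 1) t) ^ 2 ∂timeMeasure T)
        - (∫ t, (e (k + 1) t - e' (k + 1) t) ^ 2 ∂timeMeasure T) := by
    rw [← integral_const_mul, ← integral_const_mul,
      ← integral_sub (i6.const_mul 2) (i5.const_mul 2), ← integral_sub i2 i1,
      ← integral_sub i21 i4, ← integral_sub i214 i3]
    congr 1
    ext t
    ring
  rw [e1, integral_add (i3.const_mul _) (i5.const_mul _), integral_const_mul,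
    integral_const_mul] at p1
  rw [e2, integral_add (i4.const_mul _) (i6.const_mul _), integral_const_mul,
    integral_const_mul] at p2
  -- Convexity of `ψ ↦ ⟨ψ|O|ψ⟩`: the increment of the final cost is at least its linearization at `ψ
  -- (k + 1) T`, which the pairings compute.
  have hpos : 0 ≤ RCLike.re (inner ℂ (ψ (k + 2) T - ψ (k + 1) T)
      (O (ψ (k + 2) T - ψ (k + 1) T)) : ℂ) := hO.re_inner_nonneg_right _
  have hs : RCLike.re (inner ℂ (ψ (k + 2) T) (O (ψ (k + 1) T)) : ℂ)
      = RCLike.re (inner ℂ (O (ψ (k + 1) T)) (ψ (k + 2) T) : ℂ) := inner_re_symm _ _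
  have hs2 : RCLike.re (inner ℂ (ψ (k + 1) T) (O (ψ (k + 2) T)) : ℂ)
      = RCLike.re (inner ℂ (O (ψ (k + 1) T)) (ψ (k + 2) T) : ℂ) :=
    congrArg RCLike.re (hO.isSymmetric (ψ (k + 1) T) (ψ (k + 2) T)).symm
  have hs3 : RCLike.re (inner ℂ (ψ (k + 1) T) (O (ψ (k + 1) T)) : ℂ)
      = RCLike.re (inner ℂ (O (ψ (k + 1) T)) (ψ (k + 1) T) : ℂ) := inner_re_symm _ _
  simp only [map_sub, inner_sub_left, inner_sub_right] at hpos
  rw [hs, hs2] at hpos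
  rw [hs3] at hpos ⊢
  have e3 : α * (2 / δ - 1) = 2 * (α / δ) - α := by ring
  have e4 : α * (2 / η - 1) = 2 * (α / η) - α := by ring
  rw [e3, e4]
  linear_combination hpos + 2 * p1 - 2 * p2 - α * combo

end IsScheme

end QControl

/-! ### Asymptotic agreement of the fields with their feedback. -/

namespace QControl

lemma tendsto_weak_apply {E : Type*} [NormedAddCommGroup E] [NormedSpace ℝ E] {x : ℕ → E} {y : E}
    (h : Tendsto (fun n => toWeakSpace ℝ E (x n)) atTop (𝓝 (toWeakSpace ℝ E y)))
    (φ : E →L[ℝ] ℝ) : Tendsto (fun n => φ (x n)) atTop (𝓝 (φ y)) :=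
  ((WeakBilin.eval_continuous (topDualPairing ℝ E).flip φ).tendsto (toWeakSpace ℝ E y)).comp h

/-- Weak convergence of controls implies convergence of their integrals over intervals. -/
lemma tendsto_intervalIntegral_of_weak {T : ℝ} {x : ℕ → Control T} {y : Control T}
    (h : Tendsto (fun n => toWeakSpace ℝ (Control T) (x n)) atTop
      (𝓝 (toWeakSpace ℝ (Control T) y))) {s t : ℝ} (hs : s ∈ Icc 0 T) (ht : t ∈ Icc 0 T)
    (hst : s ≤ t) : Tendsto (fun n => ∫ r in s..t, x n r) atTop (𝓝 (∫ r in s..t, y r)) := by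
  have hfin : timeMeasure T (Ioo s t) ≠ ⊤ := measure_ne_top _ _
  have key : ∀ z : Control T,
      innerSL ℝ (indicatorConstLp 2 measurableSet_Ioo hfin (1 : ℝ)) z = ∫ r in s..t, z r := by
    intro z
    rw [innerSL_apply_apply, L2.inner_indicatorConstLp_one measurableSet_Ioo hfin,
      Measure.restrict_restrict measurableSet_Ioo,
      inter_eq_self_of_subset_left (Ioo_subset_Ioo hs.1 ht.2), intervalIntegral.integral_of_le hst,
      integral_Ioc_eq_integral_Ioo]
  simpa only [key] using
    tendsto_weak_apply h (innerSL ℝ (indicatorConstLp 2 measurableSet_Ioo hfin (1 : ℝ)))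

/-- A function is determined almost everywhere by its integrals over intervals. -/
lemma ae_eq_of_intervalIntegral_eq {T : ℝ} (hT : 0 ≤ T) {f g : ℝ → ℝ}
    (hf : IntervalIntegrable f volume 0 T) (hg : IntervalIntegrable g volume 0 T)
    (h : ∀ t ∈ Icc 0 T, ∫ r in (0 : ℝ)..t, f r = ∫ r in (0 : ℝ)..t, g r) :
    ∀ᵐ t ∂timeMeasure T, f t = g t := by
  rw [ae_restrict_iff' measurableSet_Ioo]
  have h0 : (0 : ℝ) ∈ uIcc 0 T := left_mem_uIcc
  filter_upwards [hf.ae_hasDerivAt_integral, hg.ae_hasDerivAt_integral] with t h1 h2 hmem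
  have ht : t ∈ uIcc 0 T := by
    rw [uIcc_of_le hT]
    exact Ioo_subset_Icc_self hmem
  refine (h1 ht 0 h0).unique ((h2 ht 0 h0).congr_of_eventuallyEq ?_)
  filter_upwards [Ioo_mem_nhds hmem.1 hmem.2] with r hr
  exact h r (Ioo_subset_Icc_self hr)

lemma exists_tendsto_of_norm_sub_sq_le {X : Type*} [NormedAddCommGroup X] [CompleteSpace X]
    {S : Set ℝ} {z : ℕ → ℝ → X} (hz : ∀ n, ContinuousOn (z n) S)
    (h : ∀ c > 0, ∀ᶠ p in atTop ×ˢ atTop, ∀ t ∈ S, ‖z p.1 t - z p.2 t‖ ^ 2 ≤ c) :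
    ∃ w : ℝ → X, ContinuousOn w S ∧ ∀ t ∈ S, Tendsto (fun n => z n t) atTop (𝓝 (w t)) := by
  have hu : UniformCauchySeqOn z atTop S := by
    intro U hU
    obtain ⟨c, hc, hcU⟩ := Metric.mem_uniformity_dist.1 hU
    filter_upwards [h ((c / 2) ^ 2) (by positivity)] with p hp t ht
    apply hcU
    rw [dist_eq_norm]
    have := (pow_le_pow_iff_left₀ (norm_nonneg _) (by positivity) two_ne_zero).1 (hp t ht)
    linarith
  have hlim : ∀ t, ∃ w, t ∈ S → Tendsto (fun n => z n t) atTop (𝓝 w) := by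
    intro t
    by_cases ht : t ∈ S
    · obtain ⟨w, hw⟩ := cauchySeq_tendsto_of_complete (hu.cauchySeq ht)
      exact ⟨w, fun _ => hw⟩
    · exact ⟨0, fun h => absurd h ht⟩
  choose w hw using hlim
  exact ⟨w, (hu.tendstoUniformlyOn_of_tendsto hw).continuousOn (Frequently.of_forall hz), hw⟩

lemma integral_abs_le_of_ae_le {T c : ℝ} (hT : 0 ≤ T) {f : ℝ → ℝ}
    (h : ∀ᵐ t ∂timeMeasure T, |f t| ≤ c) :
    ∫ t, |f t| ∂timeMeasure T ≤ c * T := by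
  have h1 := norm_integral_le_of_norm_le_const (μ := timeMeasure T) (f := fun t => |f t|) (C := c)
    (by simpa using h)
  refine (le_abs_self _).trans (h1.trans_eq ?_)
  simp [hT]

variable {X : Type*} [NormedAddCommGroup X] [InnerProductSpace ℂ X]

/-- The field that a pair adjoint state, state feeds back to the scheme. -/
noncomputable def feedback (H : ControlledHamiltonian X) (α : ℝ) (χ ψ : X) : ℝ :=
  -(inner ℂ χ (H.M ψ) : ℂ).im / α

lemma abs_feedback_sub_le (H : ControlledHamiltonian X) {α : ℝ} (hα : 0 < α) (c c' p p' : X) :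
    |feedback H α c p - feedback H α c' p'|
      ≤ (‖c - c'‖ * (‖H.M‖ * ‖p‖) + ‖c'‖ * (‖H.M‖ * ‖p - p'‖)) / α := by
  have e : feedback H α c p - feedback H α c' p'
      = -(inner ℂ (c - c') (H.M p) + inner ℂ c' (H.M (p - p')) : ℂ).im / α := by
    simp only [feedback, map_sub, inner_sub_left, inner_sub_right, Complex.add_im, Complex.sub_im]
    ring
  rw [e, abs_div, abs_neg, abs_of_pos hα]
  refine div_le_div_of_nonneg_right ((Complex.abs_im_le_norm _).trans ((norm_add_le _ _).trans
    (add_le_add ((norm_inner_le_norm _ _).trans ?_) ((norm_inner_le_norm _ _).trans ?_)))) hα.le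
  · exact mul_le_mul_of_nonneg_left (H.M.le_opNorm _) (norm_nonneg _)
  · exact mul_le_mul_of_nonneg_left (H.M.le_opNorm _) (norm_nonneg _)

namespace IsScheme

variable {H : ControlledHamiltonian X} {T α δ η : ℝ} {O : X →L[ℂ] X} {ψ₀ : X}
  {e e' : ℕ → ℝ → ℝ} {ψ χ : ℕ → ℝ → X} [CompleteSpace X]

lemma state_sub_le (h : IsScheme H T α δ η O ψ₀ e e' ψ χ) (hψ₀ : ‖ψ₀‖ = 1)
    (hm : ∀ k, MemLp (e k) ∞ (timeMeasure T) ∧ MemLp (e' k) ∞ (timeMeasure T)) (i j : ℕ) {t : ℝ}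
    (ht : t ∈ Icc 0 T) :
    ‖ψ i t - ψ j t‖ ^ 2 ≤ 2 * (‖H.M‖ * ∫ r, |e i r - e j r| ∂timeMeasure T) := by
  have h1 := (h.state i).norm_sub_sq_le (h.state j) (C := ‖H.M‖) (s := 0) (t := t) ?_
    (((hm i).1.sub (hm j).1).integrable le_top) ⟨le_rfl, ht.1.trans ht.2⟩ ht
  · simpa [h.state_init] using h1
  · intro r hr
    rw [h.norm_state hψ₀ j hr, one_mul]
    refine (H.M.le_opNorm _).trans ?_
    rw [h.norm_state hψ₀ i hr, mul_one]

/-- The first term is the discrepancy at the final time, inherited from the states through `O`; the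
second is accumulated backward from the different driving fields. -/
lemma adjoint_sub_le (h : IsScheme H T α δ η O ψ₀ e e' ψ χ) (hψ₀ : ‖ψ₀‖ = 1)
    (hm : ∀ k, MemLp (e k) ∞ (timeMeasure T) ∧ MemLp (e' k) ∞ (timeMeasure T)) (i j : ℕ) {t : ℝ}
    (ht : t ∈ Icc 0 T) :
    ‖χ (i + 1) t - χ (j + 1) t‖ ^ 2
      ≤ ‖O‖ ^ 2 * (2 * (‖H.M‖ * ∫ r, |e (i + 1) r - e (j + 1) r| ∂timeMeasure T))
        + 2 * (‖O‖ * (‖H.M‖ * ‖O‖) * ∫ r, |e' (i + 1) r - e' (j + 1) r| ∂timeMeasure T) := by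
  have hTm : T ∈ Icc 0 T := ⟨ht.1.trans ht.2, le_rfl⟩
  have h1 := (h.adjoint_succ i).norm_sub_sq_le (h.adjoint_succ j) (C := ‖O‖ * (‖H.M‖ * ‖O‖))
    (s := T) (t := t) ?_ (((hm (i + 1)).2.sub (hm (j + 1)).2).integrable le_top) hTm ht
  · refine h1.trans (add_le_add_left ?_ _)
    rw [h.adjoint_final, h.adjoint_final, ← map_sub]
    refine (pow_le_pow_left₀ (norm_nonneg _) (O.le_opNorm _) 2).trans ?_
    rw [mul_pow]
    exact mul_le_mul_of_nonneg_left (h.state_sub_le hψ₀ hm _ _ hTm) (sq_nonneg _)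
  · intro r hr
    refine mul_le_mul (h.norm_adjoint_le hψ₀ _ hr) ((H.M.le_opNorm _).trans ?_) (norm_nonneg _)
      (norm_nonneg _)
    exact mul_le_mul_of_nonneg_left (h.norm_adjoint_le hψ₀ _ hr) (norm_nonneg _)

/-- Consecutive fields approach each other in `L¹`. -/
lemma tendsto_integral_abs_increment (h : IsScheme H T α δ η O ψ₀ e e' ψ χ) (hT : 0 < T)
    (hα : 0 < α) (hδ : δ ∈ Ioo (0 : ℝ) 2) (hη : η ∈ Ioo (0 : ℝ) 2) (hO : O.IsPositive)
    (hψ₀ : ‖ψ₀‖ = 1)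
    (hm : ∀ k, MemLp (e k) ∞ (timeMeasure T) ∧ MemLp (e' k) ∞ (timeMeasure T)) :
    Tendsto (fun k => ∫ t, |e (k + 2) t - e (k + 1) t| ∂timeMeasure T) atTop (𝓝 0) ∧
      Tendsto (fun k => ∫ t, |e' (k + 2) t - e' (k + 1) t| ∂timeMeasure T) atTop (𝓝 0) := by
  have hTm : T ∈ Icc 0 T := ⟨hT.le, le_rfl⟩
  have hsq := tendsto_zero_of_increments
    (a := fun k => ∫ t, (e (k + 2) t - e' (k + 1) t) ^ 2 ∂timeMeasure T)
    (b := fun k => ∫ t, (e (k + 1) t - e' (k + 1) t) ^ 2 ∂timeMeasure T)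
    (J := fun k => RCLike.re (inner ℂ (ψ (k + 1) T) (O (ψ (k + 1) T)))
        - α * ∫ t, e (k + 1) t ^ 2 ∂timeMeasure T)
    (B := ‖O‖)
    (mul_pos hα (sub_pos.2 ((one_lt_div hδ.1).2 hδ.2)))
    (mul_pos hα (sub_pos.2 ((one_lt_div hη.1).2 hη.2)))
    (fun k => integral_nonneg fun t => sq_nonneg _)
    (fun k => integral_nonneg fun t => sq_nonneg _)
    (h.functional_increment hT.le hα hδ.1.ne' hη.1.ne' hO hψ₀ hm) (fun k => by
      have h1 : 0 ≤ α * ∫ t, e (k + 1) t ^ 2 ∂timeMeasure T :=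
        mul_nonneg hα.le (integral_nonneg fun t => sq_nonneg _)
      have h2 := re_inner_le_norm (𝕜 := ℂ) (ψ (k + 1) T) (O (ψ (k + 1) T))
      have h3 := O.le_opNorm (ψ (k + 1) T)
      rw [h.norm_state hψ₀ _ hTm, one_mul] at h2
      rw [h.norm_state hψ₀ _ hTm, mul_one] at h3
      linarith)
  have sqrt0 : ∀ {c : ℕ → ℝ}, Tendsto c atTop (𝓝 0) →
      Tendsto (fun k => √(T * c k)) atTop (𝓝 0) := by
    intro c hc
    simpa using ((hc.const_mul T).sqrt)
  have ha1 : Tendsto (fun k => ∫ t, |e (k + 2) t - e' (k + 1) t| ∂timeMeasure T) atTop (𝓝 0) :=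
    squeeze_zero (fun k => integral_nonneg fun t => abs_nonneg _)
      (fun k => Real.le_sqrt_of_sq_le
        (integral_abs_sq_le hT (f := fun t => e (k + 2) t - e' (k + 1) t)
          ((hm (k + 2)).1.sub (hm (k + 1)).2))) (sqrt0 hsq.1)
  have hb1 : Tendsto (fun k => ∫ t, |e (k + 1) t - e' (k + 1) t| ∂timeMeasure T) atTop (𝓝 0) :=
    squeeze_zero (fun k => integral_nonneg fun t => abs_nonneg _)
      (fun k => Real.le_sqrt_of_sq_le
        (integral_abs_sq_le hT (f := fun t => e (k + 1) t - e' (k + 1) t)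
          ((hm (k + 1)).1.sub (hm (k + 1)).2))) (sqrt0 hsq.2)
  have i1 : ∀ k, Integrable (fun t => |e (k + 2) t - e' (k + 1) t|) (timeMeasure T) := fun k =>
    (((hm (k + 2)).1.sub (hm (k + 1)).2).integrable le_top).abs
  have i2 : ∀ k, Integrable (fun t => |e (k + 1) t - e' (k + 1) t|) (timeMeasure T) := fun k =>
    (((hm (k + 1)).1.sub (hm (k + 1)).2).integrable le_top).abs
  constructor
  · refine squeeze_zero (fun k => integral_nonneg fun t => abs_nonneg _) (fun k => ?_)
      (by simpa using ha1.add hb1)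
    rw [← integral_add (i1 k) (i2 k)]
    refine integral_mono (((hm (k + 2)).1.sub (hm (k + 1)).1).integrable le_top).abs
      ((i1 k).add (i2 k)) fun t => ?_
    change |e (k + 2) t - e (k + 1) t| ≤ |e (k + 2) t - e' (k + 1) t| + |e (k + 1) t - e' (k + 1) t|
    rw [abs_sub_comm (e (k + 1) t)]
    exact abs_sub_le _ _ _
  · refine squeeze_zero (fun k => integral_nonneg fun t => abs_nonneg _) (fun k => ?_)
      (by simpa using (hb1.comp (tendsto_add_atTop_nat 1)).add ha1)
    change _ ≤ (∫ t, |e (k + 2) t - e' (k + 2) t| ∂timeMeasure T) + _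
    rw [← integral_add (i2 (k + 1)) (i1 k)]
    refine integral_mono (((hm (k + 2)).2.sub (hm (k + 1)).2).integrable le_top).abs
      ((i2 (k + 1)).add (i1 k)) fun t => ?_
    change |e' (k + 2) t - e' (k + 1) t|
      ≤ |e (k + 2) t - e' (k + 2) t| + |e (k + 2) t - e' (k + 1) t|
    rw [abs_sub_comm (e (k + 2) t) (e' (k + 2) t)]
    exact abs_sub_le _ _ _

/-- The fields approach the feedback of the current states uniformly. -/
lemma exists_feedback_bound (h : IsScheme H T α δ η O ψ₀ e e' ψ χ) (hT : 0 < T)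
    (hα : 0 < α) (hδ : δ ∈ Ioo (0 : ℝ) 2) (hη : η ∈ Ioo (0 : ℝ) 2) (hO : O.IsPositive)
    (hψ₀ : ‖ψ₀‖ = 1) {E : ℝ}
    (hb : ∀ k, (∀ᵐ t ∂timeMeasure T, |e k t| ≤ E) ∧ ∀ᵐ t ∂timeMeasure T, |e' k t| ≤ E)
    (hm : ∀ k, MemLp (e k) ∞ (timeMeasure T) ∧ MemLp (e' k) ∞ (timeMeasure T)) :
    ∃ u : ℕ → ℝ, Tendsto u atTop (𝓝 0) ∧ ∀ k, ∀ᵐ t ∂timeMeasure T,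
      |e (k + 1) t - feedback H α (χ (k + 1) t) (ψ (k + 1) t)| ≤ u k ∧
      |e' (k + 1) t - feedback H α (χ (k + 1) t) (ψ (k + 1) t)| ≤ u k := by
  obtain ⟨hA, hA'⟩ := h.tendsto_integral_abs_increment hT hα hδ hη hO hψ₀ hm
  have hδ1 : |1 - δ| < 1 := abs_lt.2 ⟨by linarith [hδ.2], by linarith [hδ.1]⟩
  have hη1 : |1 - η| < 1 := abs_lt.2 ⟨by linarith [hη.2], by linarith [hη.1]⟩
  let x : ℕ → ℝ := fun k => √(2 * (‖H.M‖ * ∫ r, |e (k + 2) r - e (k + 1) r| ∂timeMeasure T))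
  let y : ℕ → ℝ := fun k =>
    √(‖O‖ ^ 2 * (2 * (‖H.M‖ * ∫ r, |e (k + 2) r - e (k + 1) r| ∂timeMeasure T))
        + 2 * (‖O‖ * (‖H.M‖ * ‖O‖) * ∫ r, |e' (k + 2) r - e' (k + 1) r| ∂timeMeasure T))
  have hx : Tendsto x atTop (𝓝 0) := by
    simpa only [mul_zero, Real.sqrt_zero] using ((hA.const_mul ‖H.M‖).const_mul 2).sqrt
  have hy : Tendsto y atTop (𝓝 0) := by
    simpa using ((((hA.const_mul ‖H.M‖).const_mul 2).const_mul (‖O‖ ^ 2)).add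
      ((hA'.const_mul (‖O‖ * (‖H.M‖ * ‖O‖))).const_mul 2)).sqrt
  let r : ℕ → ℝ := fun k => |1 - δ| * (‖O‖ * (‖H.M‖ * x k) / α) + y k * ‖H.M‖ / α
  have hr : Tendsto r atTop (𝓝 0) := by
    simpa using ((((hx.const_mul ‖H.M‖).const_mul ‖O‖).div_const α).const_mul |1 - δ|).add
      ((hy.mul_const ‖H.M‖).div_const α)
  have hx0 : ∀ k, 0 ≤ x k := fun k => Real.sqrt_nonneg _
  have hy0 : ∀ k, 0 ≤ y k := fun k => Real.sqrt_nonneg _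
  have hr0 : ∀ k, 0 ≤ r k := fun k => by
    have := hx0 k
    have := hy0 k
    positivity
  let ρ := |1 - δ| * |1 - η|
  have hρ0 : 0 ≤ ρ := by positivity
  have hρ1 : ρ < 1 := mul_lt_one_of_nonneg_of_lt_one_left (abs_nonneg _) hδ1 hη1.le
  -- The majorant is independent of `t`, which makes the convergence uniform. Its initial value
  -- bounds the first field plus its feedback.
  let u : ℕ → ℝ := fun k => Nat.rec (|E| + ‖O‖ * ‖H.M‖ / α) (fun k v => ρ * v + r k) k
  have hu0 : ∀ k, 0 ≤ u k := by
    intro k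
    induction k with
    | zero => change 0 ≤ |E| + ‖O‖ * ‖H.M‖ / α; positivity
    | succ k ih => exact add_nonneg (mul_nonneg hρ0 ih) (hr0 k)
  have hu : Tendsto u atTop (𝓝 0) :=
    tendsto_zero_of_le_mul_add hρ0 hρ1 hu0 (fun k => le_rfl) hr
  have hadj : ∀ k, ∀ᵐ t ∂timeMeasure T,
      |e' (k + 1) t - feedback H α (χ (k + 1) t) (ψ (k + 1) t)|
        ≤ |1 - η| * |e (k + 1) t - feedback H α (χ (k + 1) t) (ψ (k + 1) t)| := by
    intro k
    filter_upwards [h.field'_succ k] with t ht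
    rw [ht, ← abs_mul, feedback]
    refine (congrArg abs ?_).le
    ring
  have hmain : ∀ k, ∀ᵐ t ∂timeMeasure T,
      |e (k + 1) t - feedback H α (χ (k + 1) t) (ψ (k + 1) t)| ≤ u k := by
    intro k
    induction k with
    | zero =>
      filter_upwards [(hb 1).1, ae_restrict_mem measurableSet_Ioo] with t ht hmem
      refine (abs_sub _ _).trans (add_le_add (ht.trans (le_abs_self E)) ?_)
      rw [feedback, abs_div, abs_neg, abs_of_pos hα]
      exact div_le_div_of_nonneg_right
        (h.abs_im_inner_le hψ₀ _ _ (Ioo_subset_Icc_self hmem)) hα.le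
    | succ k ih =>
      filter_upwards [ih, hadj k, h.field_succ (k + 1), ae_restrict_mem measurableSet_Ioo]
        with t h1 h2 h3 hmem
      have hmem' := Ioo_subset_Icc_self hmem
      have hxt : ‖ψ (k + 1) t - ψ (k + 2) t‖ ≤ x k := by
        rw [norm_sub_rev]
        exact Real.le_sqrt_of_sq_le (h.state_sub_le hψ₀ hm _ _ hmem')
      have hyt : ‖χ (k + 1) t - χ (k + 2) t‖ ≤ y k := by
        rw [norm_sub_rev]
        exact Real.le_sqrt_of_sq_le (h.adjoint_sub_le hψ₀ hm _ _ hmem')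
      have f1 : |feedback H α (χ (k + 1) t) (ψ (k + 1) t)
          - feedback H α (χ (k + 1) t) (ψ (k + 2) t)| ≤ ‖O‖ * (‖H.M‖ * x k) / α := by
        refine (abs_feedback_sub_le H hα _ _ _ _).trans (div_le_div_of_nonneg_right ?_ hα.le)
        rw [sub_self, norm_zero, zero_mul, zero_add]
        exact mul_le_mul (h.norm_adjoint_le hψ₀ _ hmem')
          (mul_le_mul_of_nonneg_left hxt (norm_nonneg _)) (by positivity) (norm_nonneg _)
      have f2 : |feedback H α (χ (k + 1) t) (ψ (k + 2) t)
          - feedback H α (χ (k + 2) t) (ψ (k + 2) t)| ≤ y k * ‖H.M‖ / α := by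
        refine (abs_feedback_sub_le H hα _ _ _ _).trans (div_le_div_of_nonneg_right ?_ hα.le)
        rw [sub_self, norm_zero, mul_zero, mul_zero, add_zero, h.norm_state hψ₀ _ hmem', mul_one]
        exact mul_le_mul_of_nonneg_right hyt (norm_nonneg _)
      -- The update uses the old adjoint state with the new state. The deviation of `e'` is
      -- contracted by `1 - δ`; the other two terms replace first the state, then the adjoint state,
      -- and are small by `x k` and `y k`.
      have split : e (k + 2) t - feedback H α (χ (k + 2) t) (ψ (k + 2) t)
          = (1 - δ) * (e' (k + 1) t - feedback H α (χ (k + 1) t) (ψ (k + 1) t))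
            + (1 - δ) * (feedback H α (χ (k + 1) t) (ψ (k + 1) t)
              - feedback H α (χ (k + 1) t) (ψ (k + 2) t))
            + (feedback H α (χ (k + 1) t) (ψ (k + 2) t)
              - feedback H α (χ (k + 2) t) (ψ (k + 2) t)) := by
        rw [h3]
        simp only [feedback]
        ring
      have h4 : |e' (k + 1) t - feedback H α (χ (k + 1) t) (ψ (k + 1) t)| ≤ |1 - η| * u k :=
        h2.trans (mul_le_mul_of_nonneg_left h1 (abs_nonneg _))
      change |e (k + 2) t - feedback H α (χ (k + 2) t) (ψ (k + 2) t)| ≤ ρ * u k + r k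
      rw [split]
      refine (abs_add_three _ _ _).trans ?_
      rw [abs_mul, abs_mul]
      have h5 := mul_le_mul_of_nonneg_left h4 (abs_nonneg (1 - δ))
      have h6 := mul_le_mul_of_nonneg_left f1 (abs_nonneg (1 - δ))
      have h7 : ρ * u k = |1 - δ| * (|1 - η| * u k) := mul_assoc _ _ _
      have h8 : r k = |1 - δ| * (‖O‖ * (‖H.M‖ * x k) / α) + y k * ‖H.M‖ / α := rfl
      linarith
  refine ⟨u, hu, fun k => ?_⟩
  filter_upwards [hmain k, hadj k] with t h1 h2
  refine ⟨h1, h2.trans ((mul_le_of_le_one_left (abs_nonneg _) hη1.le).trans h1)⟩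

end IsScheme

end QControl

/-! ### Uniform convergence and the critical point equations. -/

namespace QControl

namespace IsScheme

variable {X : Type*} [NormedAddCommGroup X] [InnerProductSpace ℂ X]
  {H : ControlledHamiltonian X} {T α δ η : ℝ} {O : X →L[ℂ] X} {ψ₀ : X}
  {e e' : ℕ → ℝ → ℝ} {ψ χ : ℕ → ℝ → X} [CompleteSpace X]

/-- The uniform domain bound `D` and field bound `E` control the time derivatives through the
equation, so states and adjoint states share a Lipschitz constant, and the feedback is bilinear in
them over the reals. -/
lemma exists_feedback_lipschitz (h : IsScheme H T α δ η O ψ₀ e e' ψ χ) (hT : 0 < T) (hα : 0 < α)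
    (hψ₀ : ‖ψ₀‖ = 1) {E D : ℝ} (hE : 0 ≤ E)
    (hb : ∀ k, (∀ᵐ t ∂timeMeasure T, |e k t| ≤ E) ∧ ∀ᵐ t ∂timeMeasure T, |e' k t| ≤ E)
    (hD : ∀ k, ∀ t ∈ Icc 0 T, (∃ g, ψ k t = H.R g ∧ ‖g‖ ≤ D) ∧ ∃ g, χ k t = H.R g ∧ ‖g‖ ≤ D) :
    ∃ Λ, 0 ≤ Λ ∧ ∀ k, ∀ s ∈ Icc 0 T, ∀ t ∈ Icc 0 T,
      |feedback H α (χ (k + 1) t) (ψ (k + 1) t) - feedback H α (χ (k + 1) s) (ψ (k + 1) s)|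
        ≤ Λ * |t - s| := by
  have hD0 : 0 ≤ D := by
    obtain ⟨g, -, hg⟩ := (hD 0 0 ⟨le_rfl, hT.le⟩).1
    exact (norm_nonneg g).trans hg
  let K := (‖H.S‖ + ‖H.V‖ * ‖H.R‖ + E * (‖H.M‖ * ‖H.R‖)) * D
  have hK : 0 ≤ K := by positivity
  refine ⟨(K * ‖H.M‖ + ‖O‖ * (‖H.M‖ * K)) / α, by positivity, fun k s hs t ht => ?_⟩
  refine (abs_feedback_sub_le H hα _ _ _ _).trans ?_
  rw [div_mul_eq_mul_div]
  refine div_le_div_of_nonneg_right ?_ hα.le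
  have h1 : ‖χ (k + 1) t - χ (k + 1) s‖ ≤ K * |t - s| :=
    (h.adjoint_succ k).norm_sub_le (fun t ht => (hD (k + 1) t ht).2) (hb (k + 1)).2 hs ht
  have h2 : ‖ψ (k + 1) t - ψ (k + 1) s‖ ≤ K * |t - s| :=
    (h.state (k + 1)).norm_sub_le (fun t ht => (hD (k + 1) t ht).1) (hb (k + 1)).1 hs ht
  rw [h.norm_state hψ₀ _ ht, mul_one]
  have h3 := mul_le_mul_of_nonneg_right h1 (norm_nonneg H.M)
  have h4 : ‖O‖ * (‖H.M‖ * (K * |t - s|)) ≥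
      ‖χ (k + 1) s‖ * (‖H.M‖ * ‖ψ (k + 1) t - ψ (k + 1) s‖) :=
    mul_le_mul (h.norm_adjoint_le hψ₀ _ hs) (mul_le_mul_of_nonneg_left h2 (norm_nonneg _))
      (by positivity) (norm_nonneg _)
  linarith

/-- Fields whose integrals over intervals converge, converge uniformly. -/
lemma uniform_convergence (h : IsScheme H T α δ η O ψ₀ e e' ψ χ) (hT : 0 < T)
    (hα : 0 < α) (hδ : δ ∈ Ioo (0 : ℝ) 2) (hη : η ∈ Ioo (0 : ℝ) 2) (hO : O.IsPositive)
    (hψ₀ : ‖ψ₀‖ = 1) {E D : ℝ} (hE : 0 ≤ E)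
    (hb : ∀ k, (∀ᵐ t ∂timeMeasure T, |e k t| ≤ E) ∧ ∀ᵐ t ∂timeMeasure T, |e' k t| ≤ E)
    (hD : ∀ k, ∀ t ∈ Icc 0 T, (∃ g, ψ k t = H.R g ∧ ‖g‖ ≤ D) ∧ ∃ g, χ k t = H.R g ∧ ‖g‖ ≤ D)
    (hm : ∀ k, MemLp (e k) ∞ (timeMeasure T) ∧ MemLp (e' k) ∞ (timeMeasure T))
    {i : ℕ → ℕ} (hi : Tendsto i atTop atTop) {f : ℝ → ℝ} (hf : Integrable f (timeMeasure T))
    (hconv : ∀ s ∈ Icc 0 T, ∀ t ∈ Icc 0 T, s ≤ t →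
      Tendsto (fun n => ∫ r in s..t, e (i n + 1) r) atTop (𝓝 (∫ r in s..t, f r))) :
    (∀ c > 0, ∀ᶠ n in atTop, ∀ᵐ t ∂timeMeasure T,
      |e (i n + 1) t - f t| ≤ c ∧ |e' (i n + 1) t - f t| ≤ c) ∧
    ∀ᵐ t ∂timeMeasure T, Tendsto (fun n => e (i n + 1) t) atTop (𝓝 (f t)) ∧
      Tendsto (fun n => e' (i n + 1) t) atTop (𝓝 (f t)) ∧
      Tendsto (fun n => feedback H α (χ (i n + 1) t) (ψ (i n + 1) t)) atTop (𝓝 (f t)) := by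
  obtain ⟨u, hu, hub⟩ := h.exists_feedback_bound hT hα hδ hη hO hψ₀ hb hm
  obtain ⟨Λ, hΛ, hlip⟩ := h.exists_feedback_lipschitz hT hα hψ₀ hE hb hD
  let g : ℕ → ℝ → ℝ := fun n t => feedback H α (χ (i n + 1) t) (ψ (i n + 1) t)
  have hgc : ∀ n, ContinuousOn (g n) (Icc 0 T) := fun n => by
    have : LipschitzOnWith ⟨Λ, hΛ⟩ (g n) (Icc 0 T) :=
      LipschitzOnWith.of_dist_le_mul fun x hx y hy => by
        rw [Real.dist_eq, Real.dist_eq]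
        exact hlip (i n) y hy x hx
    exact this.continuousOn
  have hui : Tendsto (fun n => u (i n)) atTop (𝓝 0) := hu.comp hi
  have hgint : ∀ n, ∀ s ∈ Icc 0 T, ∀ t ∈ Icc 0 T, IntervalIntegrable (g n) volume s t :=
    fun n s hs t ht => ((hgc n).mono (uIcc_subset_Icc hs ht)).intervalIntegrable
  have hlimg : ∀ s ∈ Icc 0 T, ∀ t ∈ Icc 0 T, s ≤ t →
      Tendsto (fun n => ∫ r in s..t, g n r) atTop (𝓝 (∫ r in s..t, f r)) := by
    intro s hs t ht hst
    -- The fields need not be continuous, so the equi-Lipschitz argument is applied to the feedback,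
    -- whose interval integrals have the same limits.
    have hdiff : Tendsto (fun n => ∫ r in s..t, (e (i n + 1) r - g n r)) atTop (𝓝 0) := by
      refine squeeze_zero_norm (a := fun n => u (i n) * |t - s|) (fun n => ?_)
        (by simpa using hui.mul_const |t - s|)
      refine intervalIntegral.norm_integral_le_of_norm_le_const_ae ?_
      filter_upwards [ae_uIoc_of_ae_timeMeasure hs ht (hub (i n))] with r hr hmem
      exact (hr hmem).1
    have := (hconv s hs t ht hst).sub hdiff
    rw [sub_zero] at this
    refine this.congr fun n => ?_
    rw [intervalIntegral.integral_sub (intervalIntegrable_of_memLp_top hs ht (hm _).1)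
      (hgint n s hs t ht), sub_sub_cancel]
  have hcauchy : UniformCauchySeqOn g atTop (Icc 0 T) :=
    uniformCauchySeqOn_of_lipschitz hT hΛ (fun n => hlip (i n))
      fun s hs t ht hst => (hlimg s hs t ht hst).cauchySeq
  have hlim : ∀ t, ∃ w, t ∈ Icc 0 T → Tendsto (fun n => g n t) atTop (𝓝 w) := by
    intro t
    by_cases ht : t ∈ Icc 0 T
    · obtain ⟨w, hw⟩ := cauchySeq_tendsto_of_complete (hcauchy.cauchySeq ht)
      exact ⟨w, fun _ => hw⟩
    · exact ⟨0, fun h => absurd h ht⟩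
  choose G hG using hlim
  have hunif := hcauchy.tendstoUniformlyOn_of_tendsto hG
  have hGc : ContinuousOn G (Icc 0 T) := hunif.continuousOn (Frequently.of_forall hgc)
  have h0 : (0 : ℝ) ∈ Icc 0 T := ⟨le_rfl, hT.le⟩
  have hTm : T ∈ Icc 0 T := ⟨hT.le, le_rfl⟩
  have hGint : ∀ t ∈ Icc 0 T, IntervalIntegrable G volume 0 t :=
    fun t ht => (hGc.mono (uIcc_subset_Icc h0 ht)).intervalIntegrable
  have hclose : ∀ c > 0, ∀ᶠ n in atTop, ∀ t ∈ Icc 0 T, |g n t - G t| ≤ c := by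
    intro c hc
    filter_upwards [Metric.tendstoUniformlyOn_iff.1 hunif c hc] with n hn t ht
    have := hn t ht
    rw [dist_comm, Real.dist_eq] at this
    exact this.le
  -- The uniform limit `G` and the weak limit `f` have the same integral over every `[0, t]`, so
  -- they agree almost everywhere.
  have hfG : ∀ᵐ t ∂timeMeasure T, f t = G t := by
    refine ae_eq_of_intervalIntegral_eq hT.le (intervalIntegrable_of_integrable h0 hTm hf)
      (hGint T hTm) fun t ht => tendsto_nhds_unique (hlimg 0 h0 t ht ht.1) ?_
    rw [Metric.tendsto_nhds]
    intro c hc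
    have hc' : 0 < c / (2 * T) := by positivity
    filter_upwards [hclose _ hc'] with n hn
    rw [dist_eq_norm, ← intervalIntegral.integral_sub (hgint n 0 h0 t ht) (hGint t ht)]
    have h1 := intervalIntegral.norm_integral_le_of_norm_le_const (a := 0) (b := t)
      (f := fun r => g n r - G r) (C := c / (2 * T)) (fun r hr => by
        rw [uIoc_of_le ht.1] at hr
        exact hn r ⟨hr.1.le, hr.2.trans ht.2⟩)
    refine h1.trans_lt ?_
    rw [sub_zero, abs_of_nonneg ht.1]
    calc c / (2 * T) * t ≤ c / (2 * T) * T := mul_le_mul_of_nonneg_left ht.2 hc'.le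
      _ = c / 2 := by field_simp
      _ < c := by linarith
  have hsmall : ∀ {v : ℕ → ℝ} {w : ℕ → ℝ} {y : ℝ}, (∀ n, |v n - w n| ≤ u (i n)) →
      Tendsto w atTop (𝓝 y) → Tendsto v atTop (𝓝 y) := by
    intro v w y hvw hw
    have := (squeeze_zero_norm hvw hui).add hw
    simpa using this
  have hall : ∀ᵐ t ∂timeMeasure T, ∀ n, |e (i n + 1) t - g n t| ≤ u (i n) ∧
      |e' (i n + 1) t - g n t| ≤ u (i n) := ae_all_iff.2 fun n => hub (i n)
  constructor
  · intro c hc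
    filter_upwards [hclose _ (half_pos hc), hui.eventually_lt_const (half_pos hc)] with n h1 h2
    filter_upwards [hall, hfG, ae_restrict_mem measurableSet_Ioo] with t h3 h4 hmem
    have h5 := h1 t (Ioo_subset_Icc_self hmem)
    rw [h4]
    exact ⟨(abs_sub_le _ (g n t) _).trans (by linarith [(h3 n).1]),
      (abs_sub_le _ (g n t) _).trans (by linarith [(h3 n).2])⟩
  · filter_upwards [hall, hfG, ae_restrict_mem measurableSet_Ioo] with t h3 h4 hmem
    have hgt := hG t (Ioo_subset_Icc_self hmem)
    rw [← h4] at hgt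
    exact ⟨hsmall (fun n => (h3 n).1) hgt, hsmall (fun n => (h3 n).2) hgt, hgt⟩

/-- The limit field of the scheme satisfies the critical point equations. -/
lemma exists_critical_point (h : IsScheme H T α δ η O ψ₀ e e' ψ χ) (hT : 0 < T)
    (hα : 0 < α) (hψ₀ : ‖ψ₀‖ = 1) {E D : ℝ}
    (hb : ∀ k, (∀ᵐ t ∂timeMeasure T, |e k t| ≤ E) ∧ ∀ᵐ t ∂timeMeasure T, |e' k t| ≤ E)
    (hD : ∀ k, ∀ t ∈ Icc 0 T, (∃ g, ψ k t = H.R g ∧ ‖g‖ ≤ D) ∧ ∃ g, χ k t = H.R g ∧ ‖g‖ ≤ D)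
    (hm : ∀ k, MemLp (e k) ∞ (timeMeasure T) ∧ MemLp (e' k) ∞ (timeMeasure T))
    {i : ℕ → ℕ} {f : ℝ → ℝ} (hf : AEStronglyMeasurable f (timeMeasure T))
    (hunif : ∀ c > 0, ∀ᶠ n in atTop, ∀ᵐ t ∂timeMeasure T,
      |e (i n + 1) t - f t| ≤ c ∧ |e' (i n + 1) t - f t| ≤ c)
    (hpt : ∀ᵐ t ∂timeMeasure T, Tendsto (fun n => e (i n + 1) t) atTop (𝓝 (f t)) ∧
      Tendsto (fun n => e' (i n + 1) t) atTop (𝓝 (f t)) ∧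
      Tendsto (fun n => feedback H α (χ (i n + 1) t) (ψ (i n + 1) t)) atTop (𝓝 (f t))) :
    ∃ φ θ : ℝ → X, H.IsSolution T f φ ∧ φ 0 = ψ₀ ∧ H.IsSolution T f θ ∧ θ T = O (φ T) ∧
      ∀ᵐ t ∂timeMeasure T, α * f t + (inner ℂ (θ t) (H.M (φ t)) : ℂ).im = 0 := by
  have h0 : (0 : ℝ) ∈ Icc 0 T := ⟨le_rfl, hT.le⟩
  have hTm : T ∈ Icc 0 T := ⟨hT.le, le_rfl⟩
  have hint : ∀ c > 0, ∀ᶠ p : ℕ × ℕ in atTop ×ˢ atTop,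
      ∫ r, |e (i p.1 + 1) r - e (i p.2 + 1) r| ∂timeMeasure T ≤ c ∧
      ∫ r, |e' (i p.1 + 1) r - e' (i p.2 + 1) r| ∂timeMeasure T ≤ c := by
    intro c hc
    have hc' : 0 < c / (2 * T) := by positivity
    have hcT : c / T * T = c := by field_simp
    have hcc : c / (2 * T) + c / (2 * T) = c / T := by field_simp; norm_num
    filter_upwards [(hunif _ hc').prod_mk (hunif _ hc')] with p ⟨h1, h2⟩
    rw [← hcT]
    constructor
    · refine integral_abs_le_of_ae_le hT.le ?_
      filter_upwards [h1, h2] with t h3 h4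
      rw [← hcc]
      refine (abs_sub_le _ (f t) _).trans (add_le_add h3.1 ?_)
      rw [abs_sub_comm]
      exact h4.1
    · refine integral_abs_le_of_ae_le hT.le ?_
      filter_upwards [h1, h2] with t h3 h4
      rw [← hcc]
      refine (abs_sub_le _ (f t) _).trans (add_le_add h3.2 ?_)
      rw [abs_sub_comm]
      exact h4.2
  -- The `L¹` Cauchy property of the fields becomes a Cauchy property of the states uniform in time;
  -- the limits are thus constructed without any existence theorem for the equation.
  obtain ⟨φ, hφc, hφ⟩ := exists_tendsto_of_norm_sub_sq_le (z := fun n => ψ (i n + 1))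
    (S := Icc 0 T) (fun n => (h.state _).continuousOn) (fun c hc => by
      have hc' : 0 < c / (2 * (‖H.M‖ + 1)) := by positivity
      filter_upwards [hint _ hc'] with p hp t ht
      refine (h.state_sub_le hψ₀ hm _ _ ht).trans ?_
      calc 2 * (‖H.M‖ * ∫ r, |e (i p.1 + 1) r - e (i p.2 + 1) r| ∂timeMeasure T)
          ≤ 2 * ((‖H.M‖ + 1) * (c / (2 * (‖H.M‖ + 1)))) := by
            refine mul_le_mul_of_nonneg_left (mul_le_mul (by linarith) hp.1
              (integral_nonneg fun t => abs_nonneg _) (by positivity)) zero_le_two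
        _ = c := by field_simp)
  obtain ⟨θ, hθc, hθ⟩ := exists_tendsto_of_norm_sub_sq_le (z := fun n => χ (i n + 1))
    (S := Icc 0 T) (fun n => (h.adjoint_succ _).continuousOn) (fun c hc => by
      let K := ‖O‖ ^ 2 * (2 * ‖H.M‖) + 2 * (‖O‖ * (‖H.M‖ * ‖O‖))
      have hK : 0 ≤ K := by positivity
      have hc' : 0 < c / (K + 1) := by positivity
      filter_upwards [hint _ hc'] with p hp t ht
      refine (h.adjoint_sub_le hψ₀ hm _ _ ht).trans ?_
      have h1 := mul_le_mul_of_nonneg_left hp.1 (a := ‖O‖ ^ 2 * (2 * ‖H.M‖)) (by positivity)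
      have h2 := mul_le_mul_of_nonneg_left hp.2 (a := 2 * (‖O‖ * (‖H.M‖ * ‖O‖))) (by positivity)
      have h3 : K * (c / (K + 1)) ≤ c := by
        rw [mul_div_assoc', div_le_iff₀ (by positivity)]
        nlinarith
      have h4 : K * (c / (K + 1)) = ‖O‖ ^ 2 * (2 * ‖H.M‖) * (c / (K + 1))
        + 2 * (‖O‖ * (‖H.M‖ * ‖O‖)) * (c / (K + 1)) := add_mul _ _ _
      linarith)
  refine ⟨φ, θ, ?_, ?_, ?_, ?_, ?_⟩
  · exact ControlledHamiltonian.isSolution_of_tendsto (fun n => h.state (i n + 1))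
      (fun n t ht => (hD _ t ht).1) (fun n => (hb _).1) hφc hφ hf (hpt.mono fun t ht => ht.1)
  · refine tendsto_nhds_unique (hφ 0 h0) ?_
    simp only [h.state_init]
    exact tendsto_const_nhds
  · exact ControlledHamiltonian.isSolution_of_tendsto (fun n => h.adjoint_succ (i n))
      (fun n t ht => (hD _ t ht).2) (fun n => (hb _).2) hθc hθ hf (hpt.mono fun t ht => ht.2.1)
  · refine tendsto_nhds_unique (hθ T hTm) ?_
    simp only [h.adjoint_final]
    exact (O.continuous.tendsto _).comp (hφ T hTm)
  · filter_upwards [hpt, ae_restrict_mem measurableSet_Ioo] with t ht hmem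
    have hmem' := Ioo_subset_Icc_self hmem
    have h1 : Tendsto (fun n => feedback H α (χ (i n + 1) t) (ψ (i n + 1) t)) atTop
        (𝓝 (feedback H α (θ t) (φ t))) :=
      ((Complex.continuous_im.tendsto _).comp ((hθ t hmem').inner
        ((H.M.continuous.tendsto _).comp (hφ t hmem')))).neg.div_const α
    rw [tendsto_nhds_unique ht.2.2 h1, feedback]
    field_simp
    ring

end IsScheme

end QControl

/-! ### Assembly of the theorem. -/

open QControl in
theorem lemma6p4
    (T α δ η : ℝ) (hT : 0 < T) (hα : 0 < α)
    (hδ : δ ∈ Set.Ioo (0 : ℝ) 2) (hη : η ∈ Set.Ioo (0 : ℝ) 2)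
    (V μ : QControl.Space → ℝ) (hV : QControl.MemW2Infty V) (hμ : QControl.MemW2Infty μ)
    (O : QControl.L2 →L[ℂ] QControl.L2) (hO : O.IsPositive)
    (hOH2 : ∀ f : QControl.L2, QControl.MemH2 f → QControl.MemH2 (O f))
    (ψ₀ : QControl.L2) (hψ₀ : QControl.MemH2 ψ₀) (hψ₀_norm : ‖ψ₀‖ = 1)
    (ε ε' : ℕ → QControl.Control T) (ψ χ : ℕ → ℝ → QControl.L2)
    (hscheme : QControl.IsMonotonicScheme T α δ η V μ O ψ₀ ε ε' ψ χ)
    (k : ℕ → ℕ) (hk : StrictMono k) (εlim : QControl.Control T)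
    (hweak : Tendsto (fun n => toWeakSpace ℝ (QControl.Control T) (ε (k n))) atTop
      (𝓝 (toWeakSpace ℝ (QControl.Control T) εlim))) :
    (∀ n, MemLp (ε (k n)) ∞ (QControl.timeMeasure T)) ∧
    MemLp εlim ∞ (QControl.timeMeasure T) ∧
    Tendsto (fun n => eLpNorm (fun t => ε (k n) t - εlim t) ∞ (QControl.timeMeasure T))
      atTop (𝓝 0) ∧
    εlim ∈ QControl.criticalSet T α V μ O ψ₀ := by
  obtain ⟨H, hF, hHV, hHM⟩ := exists_controlledHamiltonian hV hμ
  have hsol := isSchrodingerSolution_iff (T := T) hV.1 hμ.1 hF hHV hHM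
  have hbr : ∀ f g, bracket f μ g = inner ℂ f (H.M g) := fun f g => by
    rw [bracket_eq_inner μ hμ.1, hHM]
  have hR : H.R = laplaceFrame.R := by rw [hF]
  have h : IsScheme H T α δ η O ψ₀ (fun j => ε j) (fun j => ε' j) ψ χ :=
    { field_zero := hscheme.field_zero
      field'_zero := hscheme.field'_zero
      field_meas := fun j => (Lp.aestronglyMeasurable (ε j))
      field'_meas := fun j => (Lp.aestronglyMeasurable (ε' j))
      state := fun j => (hsol _ _).1 (hscheme.state j)
      state_init := hscheme.state_init
      adjoint_zero := hscheme.adjoint_zero.imp (hsol _ _).1 (hsol _ _).1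
      adjoint_succ := fun j => (hsol _ _).1 (hscheme.adjoint_succ j)
      adjoint_final := hscheme.adjoint_final
      field_succ := fun j => by simpa only [hbr] using hscheme.field_succ j
      field'_succ := fun j => by simpa only [hbr] using hscheme.field'_succ j }
  obtain ⟨B, hB⟩ := laplaceFrame.exists_conj O fun g =>
    (MemH2_iff _).1 (hOH2 _ ((MemH2_iff _).2 ⟨g, rfl⟩))
  obtain ⟨E, hE, hb⟩ := h.exists_field_bound hψ₀_norm hα hδ hη
  obtain ⟨D, hD⟩ := h.exists_domain_bound hT.le hE hb (by rw [hR]; exact (MemH2_iff _).1 hψ₀)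
    (B := B) (by rw [hR]; exact hB)
  have hm : ∀ j, MemLp (ε j) ∞ (timeMeasure T) ∧ MemLp (ε' j) ∞ (timeMeasure T) := fun j =>
    ⟨memLp_top_of_bound (h.field_meas j) E (hb j).1, memLp_top_of_bound (h.field'_meas j) E (hb j).2⟩
  -- Dropping the first term of the subsequence guarantees `k (n + 1) ≥ 1`, so every remaining field
  -- has the form `ε (i n + 1)` produced by the scheme rather than being an arbitrary initial field.
  let i : ℕ → ℕ := fun n => k (n + 1) - 1
  have hki : ∀ n, i n + 1 = k (n + 1) := fun n =>
    Nat.sub_add_cancel ((Nat.succ_le_succ n.zero_le).trans (hk.id_le (n + 1)))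
  have hi : Tendsto i atTop atTop := tendsto_atTop_mono (fun n => by
    have := hk.id_le (n + 1)
    have := hki n
    simp only [id_eq] at *
    omega) tendsto_id
  have hconv : ∀ s ∈ Icc 0 T, ∀ t ∈ Icc 0 T, s ≤ t →
      Tendsto (fun n => ∫ r in s..t, ε (i n + 1) r) atTop (𝓝 (∫ r in s..t, εlim r)) := by
    intro s hs t ht hst
    simp only [hki]
    exact (tendsto_intervalIntegral_of_weak hweak hs ht hst).comp (tendsto_add_atTop_nat 1)
  obtain ⟨hunif, hpt⟩ := h.uniform_convergence hT hα hδ hη hO hψ₀_norm hE hb hD hm hi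
    ((Lp.memLp εlim).integrable one_le_two) hconv
  refine ⟨fun n => (hm _).1, ?_, ?_, ?_⟩
  · obtain ⟨n, hn⟩ := (hunif 1 one_pos).exists
    refine memLp_top_of_bound (Lp.aestronglyMeasurable εlim) (E + 1) ?_
    filter_upwards [hn, (hb (i n + 1)).1] with t h1 h2
    rw [Real.norm_eq_abs]
    have := abs_sub_abs_le_abs_sub (εlim t) (ε (i n + 1) t)
    rw [abs_sub_comm] at this
    linarith [h1.1]
  · rw [← tendsto_add_atTop_iff_nat 1, ENNReal.tendsto_nhds_zero]
    intro c hc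
    obtain ⟨c', hc'0, hc'⟩ : ∃ c' : ℝ, 0 < c' ∧ ENNReal.ofReal c' ≤ c := by
      obtain ⟨q, hq0, hq⟩ := ENNReal.lt_iff_exists_nnreal_btwn.1 hc
      exact ⟨q, by exact_mod_cast hq0, by simpa using hq.le⟩
    filter_upwards [hunif c' hc'0] with n hn
    rw [eLpNorm_exponent_top]
    refine (eLpNormEssSup_le_of_ae_bound ?_).trans hc'
    filter_upwards [hn] with t ht
    rw [← hki n]
    exact ht.1
  · obtain ⟨φ, θ, h1, h2, h3, h4, h5⟩ := h.exists_critical_point hT hα hψ₀_norm hb hD hm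
      (Lp.aestronglyMeasurable εlim) hunif hpt
    refine ⟨φ, θ, (hsol _ _).2 h1, h2, (hsol _ _).2 h3, h4, ?_⟩
    simpa only [hbr] using h5
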